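/- Let $\Omega\subset\mathbb R^N$ be a compact smooth embedded submanifold of dimension $d$ with (possibly empty) smooth boundary, carrying the Riemannian metric induced by $\mathbb R^N$ and the Riemannian volume $dx$. Let $f\in C^1(\Omega)$, let $p\in C^\infty(\Omega)$ be a probability density with respect to $dx$ with $0<a\le p(x)\le b<\infty$ on $\Omega$, let $X_1,X_2,\dots$ be i.i.d. random points with density $p$, and let $\alpha\in\mathbb R$. For $t>0$ and $n\ge 1$ put $$w_t(x,y)=t^{-d/2}e^{-\|x-y\|_{\mathbb R^N}^2/t},\qquad d_{t,n}(X_i)=\frac1n\sum_{j=1}^n w_t(X_i,X_j),\qquad W_{\alpha,t,n}(i,j)=\frac{w_t(X_i,X_j)}{[d_{t,n}(X_i)\,d_{t,n}(X_j)]^{\alpha}},$$ let $D_{\alpha,t,n}$ be the diagonal matrix with entries $\sum_{j=1}^n W_{\alpha,t,n}(i,j)$, and let $L^u_{\alpha,t,n}=D_{\alpha,t,n}-W_{\alpha,t,n}$ be the unnormalized graph Laplacian. In $f^TL^u_{\alpha,t,n}f$ write $f$ for the vector $(f(X_1),\dots,f(X_n))^T$, so that $f^TL^u_{\alpha,t,n}f=\frac12\sum_{i,j=1}^n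 W_{\alpha,t,n}(i,j)\,(f(X_i)-f(X_j))^2$. Then for every sequence $t=t_n>0$ with $t_n\to0$ and $n^2t_n^{d+2}\to\infty$ as $n\to\infty$, $$\frac1{n^2t_n}\,f^TL^u_{\alpha,t_n,n}f\;\longrightarrow\; C\int_\Omega\|\nabla f(x)\|^2\,[p(x)]^{2-2\alpha}\,dx\quad\text{in probability},\qquad C=\tfrac14\,\pi^{d(1/2-\alpha)},$$ where $\nabla f$ is the Riemannian gradient of $f$ on $\Omega$ and the integral on the right is finite. -/

import Mathlib

open MeasureTheory ProbabilityTheory Filter Topology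
open scoped ContDiff Matrix

namespace GraphLaplacian

/-- Local model, inside `ℝ^N`, of a `d`-dimensional submanifold with boundary: the half space
`{y | 0 ≤ y₀}` of the coordinate subspace `ℝ^d × {0}` (a single point when `d = 0`).
Points with `0 < y₀` are interior points, points with `y₀ = 0` are boundary points. -/
def halfSpaceModel (N d : ℕ) : Set (EuclideanSpace ℝ (Fin N)) :=
  {y | (∀ i : Fin N, d ≤ (i : ℕ) → y i = 0) ∧ (∀ i : Fin N, (i : ℕ) = 0 → 0 ≤ y i)}

/-- `M` is a smooth embedded `d`-dimensional submanifold of `ℝ^N` with (possibly empty) smooth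
boundary: around each of its points, a smooth diffeomorphism between open subsets of `ℝ^N`
straightens `M` to the half space model. -/
def IsSubmanifoldWithBoundary {N : ℕ} (d : ℕ) (M : Set (EuclideanSpace ℝ (Fin N))) : Prop :=
  d ≤ N ∧ ∀ x ∈ M,
    ∃ φ : OpenPartialHomeomorph (EuclideanSpace ℝ (Fin N)) (EuclideanSpace ℝ (Fin N)),
      x ∈ φ.source ∧ ContDiffOn ℝ ∞ φ φ.source ∧ ContDiffOn ℝ ∞ φ.symm φ.target ∧
        φ '' (M ∩ φ.source) = halfSpaceModel N d ∩ φ.target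

/-- The `d`-dimensional Riemannian volume of `M ⊆ ℝ^N` for the metric induced by `ℝ^N`:
the `d`-dimensional Hausdorff measure, normalized to agree with Lebesgue measure on `ℝ^d`,
restricted to `M`. -/
noncomputable def riemannianVolume {N : ℕ} (d : ℕ) (M : Set (EuclideanSpace ℝ (Fin N))) :
    Measure (EuclideanSpace ℝ (Fin N)) :=
  (Measure.euclideanHausdorffMeasure d).restrict M

/-- The tangent space of `M` at `x`, the linear span of the tangent cone (at a boundary point of
a submanifold the cone is not a linear space, but its span is the full tangent space). -/
noncomputable def tangentSpace {N : ℕ} (M : Set (EuclideanSpace ℝ (Fin N)))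
    (x : EuclideanSpace ℝ (Fin N)) : Submodule ℝ (EuclideanSpace ℝ (Fin N)) :=
  Submodule.span ℝ (tangentConeAt ℝ M x)

/-- The Riemannian gradient at `x` of a function on `M`: the vector of the tangent space that
represents the differential. All derivatives of `f` within `M` at `x` agree on the tangent space,
so this does not depend on the one that `fderivWithin` picks, nor on `f` outside `M`. -/
noncomputable def gradientOn {N : ℕ} (M : Set (EuclideanSpace ℝ (Fin N)))
    (f : EuclideanSpace ℝ (Fin N) → ℝ) (x : EuclideanSpace ℝ (Fin N)) : tangentSpace M x :=
  (InnerProductSpace.toDual ℝ (tangentSpace M x)).symm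
    ((fderivWithin ℝ f M x).comp (tangentSpace M x).subtypeL)

/-- The Gaussian weight `w_t(x, y) = t^{-d/2} exp (-‖x - y‖² / t)`. -/
noncomputable def gaussianWeight {N : ℕ} (d : ℕ) (t : ℝ) (x y : EuclideanSpace ℝ (Fin N)) : ℝ :=
  1 / t ^ ((d : ℝ) / 2) * Real.exp (-(‖x - y‖ ^ 2 / t))

/-- The weight matrix `W_{t,n}` of the points `x₁, …, xₙ`. -/
noncomputable def weightMatrix {N n : ℕ} (d : ℕ) (t : ℝ)
    (x : Fin n → EuclideanSpace ℝ (Fin N)) : Matrix (Fin n) (Fin n) ℝ :=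
  Matrix.of fun i j => gaussianWeight d t (x i) (x j)

/-- The empirical degree `d_{t,n}(x_i) = (1/n) ∑_j w_t(x_i, x_j)`. -/
noncomputable def empiricalDegree {N n : ℕ} (d : ℕ) (t : ℝ)
    (x : Fin n → EuclideanSpace ℝ (Fin N)) (i : Fin n) : ℝ :=
  1 / (n : ℝ) * ∑ j, weightMatrix d t x i j

/-- The normalized weight matrix `W_{α,t,n} = D_{t,n}^{-α} W_{t,n} D_{t,n}^{-α}`, with entries
`w_t(x_i, x_j) / (d_{t,n}(x_i) d_{t,n}(x_j))^α`. -/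
noncomputable def normalizedWeightMatrix {N n : ℕ} (d : ℕ) (α t : ℝ)
    (x : Fin n → EuclideanSpace ℝ (Fin N)) : Matrix (Fin n) (Fin n) ℝ :=
  Matrix.diagonal (fun i => empiricalDegree d t x i ^ (-α)) * weightMatrix d t x *
    Matrix.diagonal (fun i => empiricalDegree d t x i ^ (-α))

/-- The unnormalized graph Laplacian `L^u_{α,t,n} = D_{α,t,n} - W_{α,t,n}`, where `D_{α,t,n}` is
the diagonal matrix of the row sums of `W_{α,t,n}`. -/
noncomputable def unnormalizedLaplacian {N n : ℕ} (d : ℕ) (α t : ℝ)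
    (x : Fin n → EuclideanSpace ℝ (Fin N)) : Matrix (Fin n) (Fin n) ℝ :=
  Matrix.diagonal (fun i => ∑ j, normalizedWeightMatrix d α t x i j) -
    normalizedWeightMatrix d α t x

/-- The graph Laplacian regularizer `fᵀ L^u_{α,t,n} f`, with `f` the vector
`(f(x₁), …, f(xₙ))`. -/
noncomputable def regularizer {N n : ℕ} (d : ℕ) (α t : ℝ)
    (f : EuclideanSpace ℝ (Fin N) → ℝ) (x : Fin n → EuclideanSpace ℝ (Fin N)) : ℝ :=
  (fun i => f (x i)) ⬝ᵥ (unnormalizedLaplacian d α t x *ᵥ fun i => f (x i))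

end GraphLaplacian

/-!
Write `w_t` for the Gaussian weight, `ν` for the law of the sample points and `m_t` for the mean
degree, `m_t(x) = ∫ w_t(x, y) dν(y)`. The quantity `(n² t)⁻¹ fᵀ L f` is the average over all pairs
of sample points of the edge energy `w_t(x, y) (f x - f y)² / (2 t)` times the degree factors
`(d(x) d(y))^(-α)`.

*Sampling.* The weight and the edge energy have row integrals that are bounded uniformly in `t`,
while their values are `O(t^(-d/2))`. Chernoff's bound therefore shows that a row average deviates
from its mean by `ε` with probability `exp (-c ε² n t^(d/2))`, and a union bound over the `n` rows
costs `log n = o(n t^(d/2))`. Hence all empirical degrees are uniformly close to `m_t`, which is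
bounded away from `0`, and it suffices to study the double integral of the edge energy times
`(m_t(x) m_t(y))^(-α)`.

*Blow-up.* At almost every point `x` of `M`, zooming in at the scale `√t` turns `M` into its tangent
space and `f` into its differential. Gaussian integrals then give `m_t(x) → π^(d/2) p(x)`, and the
energy of the edges from `x`, weighted by a continuous function `v`, tends to
`π^(d/2) / 4 ‖∇f(x)‖² v(x) p(x)`. The factor `m_t(y)^(-α)` depends on `t` and converges only almost
everywhere; the symmetry of the edge energy moves its error to the variable `x`, where dominated
convergence applies.
-/

namespace GraphLaplacian

open scoped NNReal ENNReal

/-! ### Lipschitz images and Hausdorff measure -/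

section Lipschitz

variable {X Y : Type*} [MetricSpace X] [MeasurableSpace X] [BorelSpace X] [MetricSpace Y]
  [MeasurableSpace Y] [BorelSpace Y] {K : ℝ≥0} {g : X → Y} {s : Set X}

theorem euclideanHausdorffMeasure_image_le (hg : LipschitzOnWith K g s) (d : ℕ) :
    (Measure.euclideanHausdorffMeasure d : Measure Y) (g '' s) ≤
      (K : ℝ≥0∞) ^ d * (Measure.euclideanHausdorffMeasure d : Measure X) s := by
  have h := hg.hausdorffMeasure_image_le (Nat.cast_nonneg (α := ℝ) d)
  rw [ENNReal.rpow_natCast] at h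
  simp_rw [Measure.euclideanHausdorffMeasure_def, Measure.smul_apply, mul_smul_comm,
    ENNReal.smul_def]
  exact mul_le_mul_right h _

theorem setLIntegral_image_le (hg : LipschitzOnWith K g s) (hs : MeasurableSet s) (d : ℕ)
    (F : Y → ℝ≥0∞) :
    ∫⁻ y in g '' s, F y ∂Measure.euclideanHausdorffMeasure d ≤
      (K : ℝ≥0∞) ^ d * ∫⁻ x in s, F (g x) ∂Measure.euclideanHausdorffMeasure d := by
  have hgm : AEMeasurable g ((Measure.euclideanHausdorffMeasure d).restrict s) :=
    hg.continuousOn.aemeasurable hs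
  have hle : (Measure.euclideanHausdorffMeasure d).restrict (g '' s) ≤
      (K : ℝ≥0∞) ^ d • ((Measure.euclideanHausdorffMeasure d).restrict s).map g := by
    refine Measure.le_iff.2 fun A hA => ?_
    rw [Measure.restrict_apply hA, Measure.smul_apply, smul_eq_mul,
      Measure.map_apply_of_aemeasurable hgm hA, Measure.restrict_apply' hs,
      ← Set.image_preimage_inter]
    exact euclideanHausdorffMeasure_image_le (hg.mono Set.inter_subset_right) d
  calc ∫⁻ y in g '' s, F y ∂Measure.euclideanHausdorffMeasure d
      ≤ (K : ℝ≥0∞) ^ d *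
          ∫⁻ y, F y ∂((Measure.euclideanHausdorffMeasure d).restrict s).map g := by
        rw [← smul_eq_mul, ← lintegral_smul_measure]
        exact lintegral_mono' hle le_rfl
    _ ≤ (K : ℝ≥0∞) ^ d * ∫⁻ x in s, F (g x) ∂Measure.euclideanHausdorffMeasure d := by
        gcongr
        exact lintegral_map_le F g

end Lipschitz

/-- `σ` distorts the distances between points of `S` by a factor at most `K`. This is used for
parametrizations of pieces of a submanifold by subsets of `ℝ^d`. -/
def IsBilipschitzOn {X Y : Type*} [PseudoMetricSpace X] [PseudoMetricSpace Y] (K : ℝ≥0)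
    (σ : X → Y) (S : Set X) : Prop :=
  ∀ u ∈ S, ∀ v ∈ S, dist (σ u) (σ v) ≤ K * dist u v ∧ dist u v ≤ K * dist (σ u) (σ v)

namespace IsBilipschitzOn

variable {N d : ℕ} {K : ℝ≥0} {σ : EuclideanSpace ℝ (Fin d) → EuclideanSpace ℝ (Fin N)}
  {S : Set (EuclideanSpace ℝ (Fin d))}

theorem lipschitzOnWith (h : IsBilipschitzOn K σ S) : LipschitzOnWith K σ S :=
  LipschitzOnWith.of_dist_le_mul fun u hu v hv => (h u hu v hv).1

theorem mono {T : Set (EuclideanSpace ℝ (Fin d))} (h : IsBilipschitzOn K σ S) (hT : T ⊆ S) :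
    IsBilipschitzOn K σ T := fun u hu v hv => h u (hT hu) v (hT hv)

theorem injOn (h : IsBilipschitzOn K σ S) : Set.InjOn σ S := fun u hu v hv huv =>
  dist_le_zero.1 <| by simpa [huv] using (h u hu v hv).2

theorem lipschitzOnWith_invFunOn (h : IsBilipschitzOn K σ S) :
    LipschitzOnWith K (Function.invFunOn σ S) (σ '' S) := by
  refine LipschitzOnWith.of_dist_le_mul ?_
  rintro _ ⟨u, hu, rfl⟩ _ ⟨v, hv, rfl⟩
  rw [h.injOn.leftInvOn_invFunOn hu, h.injOn.leftInvOn_invFunOn hv]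
  exact (h u hu v hv).2

theorem lintegral_image_le (h : IsBilipschitzOn K σ S) (hS : MeasurableSet S)
    (F : EuclideanSpace ℝ (Fin N) → ℝ≥0∞) :
    ∫⁻ y in σ '' S, F y ∂Measure.euclideanHausdorffMeasure d ≤
      (K : ℝ≥0∞) ^ d * ∫⁻ u in S, F (σ u) := by
  simpa only [EuclideanSpace.euclideanHausdorffMeasure_eq_volume] using
    setLIntegral_image_le h.lipschitzOnWith hS d F

theorem lintegral_le_lintegral_image (h : IsBilipschitzOn K σ S) (hS : IsCompact S)
    (F : EuclideanSpace ℝ (Fin N) → ℝ≥0∞) :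
    ∫⁻ u in S, F (σ u) ≤
      (K : ℝ≥0∞) ^ d * ∫⁻ y in σ '' S, F y ∂Measure.euclideanHausdorffMeasure d := by
  have himage : MeasurableSet (σ '' S) :=
    (hS.image_of_continuousOn h.lipschitzOnWith.continuousOn).measurableSet
  have hinv := setLIntegral_image_le h.lipschitzOnWith_invFunOn himage d fun u => F (σ u)
  rw [h.injOn.leftInvOn_invFunOn.image_image,
    EuclideanSpace.euclideanHausdorffMeasure_eq_volume] at hinv
  refine hinv.trans (mul_le_mul_right (setLIntegral_mono' himage ?_) _)
  rintro _ ⟨u, hu, rfl⟩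
  rw [h.injOn.leftInvOn_invFunOn hu]

end IsBilipschitzOn

/-! ### Local parametrizations -/

/-- The half space `{v | 0 ≤ v₀}` of `ℝ^d` (a single point when `d = 0`), the intrinsic form of
`halfSpaceModel N d`. -/
def halfSpace (d : ℕ) : Set (EuclideanSpace ℝ (Fin d)) := {v | ∀ i : Fin d, (i : ℕ) = 0 → 0 ≤ v i}

theorem convex_halfSpace (d : ℕ) : Convex ℝ (halfSpace d) := by
  intro x hx y hy a b ha hb _ i hi
  simp only [PiLp.add_apply, PiLp.smul_apply, smul_eq_mul]
  exact add_nonneg (mul_nonneg ha (hx i hi)) (mul_nonneg hb (hy i hi))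

theorem isClosed_halfSpace (d : ℕ) : IsClosed (halfSpace d) := by
  simp only [halfSpace, Set.ofPred_forall]
  exact isClosed_iInter fun i => isClosed_iInter fun _ =>
    isClosed_le continuous_const (PiLp.continuous_apply 2 _ i)

theorem halfSpace_mem_nhds {d : ℕ} {v : EuclideanSpace ℝ (Fin d)}
    (hv : ∀ i : Fin d, (i : ℕ) = 0 → 0 < v i) : halfSpace d ∈ 𝓝 v := by
  refine eventually_all.2 fun i => ?_
  by_cases hi : (i : ℕ) = 0
  · have hc : ContinuousAt (fun u : EuclideanSpace ℝ (Fin d) => u i) v := by fun_prop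
    filter_upwards [hc.eventually (lt_mem_nhds (hv i hi))] with u hu _ using hu.le
  · exact Eventually.of_forall fun u h => absurd h hi

theorem volume_halfSpace_inter_closedBall_pos {d : ℕ} {v : EuclideanSpace ℝ (Fin d)}
    (hv : v ∈ halfSpace d) {r : ℝ} (hr : 0 < r) :
    0 < volume (halfSpace d ∩ Metric.closedBall v r) := by
  set e : EuclideanSpace ℝ (Fin d) := WithLp.toLp 2 fun _ => 1
  have hpos : 0 < r / (‖e‖ + 1) := by positivity
  refine Measure.measure_pos_of_mem_nhds volume (x := v + (r / (‖e‖ + 1)) • e)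
    (inter_mem (halfSpace_mem_nhds fun i hi => ?_)
      (mem_of_superset (Metric.isOpen_ball.mem_nhds ?_) Metric.ball_subset_closedBall))
  · simpa [e] using add_pos_of_nonneg_of_pos (hv i hi) hpos
  · rw [mem_ball_iff_norm, add_sub_cancel_left, norm_smul, Real.norm_of_nonneg hpos.le,
      div_mul_eq_mul_div, div_lt_iff₀ (by positivity)]
    nlinarith [norm_nonneg e]

theorem volume_setOf_coord_eq_zero {d : ℕ} (i : Fin d) :
    volume {v : EuclideanSpace ℝ (Fin d) | v i = 0} = 0 := by
  have hker : {v : EuclideanSpace ℝ (Fin d) | v i = 0} =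
      (LinearMap.ker (EuclideanSpace.proj i : EuclideanSpace ℝ (Fin d) →L[ℝ] ℝ).toLinearMap :
        Set (EuclideanSpace ℝ (Fin d))) := by
    ext v
    simp
  rw [hker]
  refine Measure.addHaar_submodule _ _ fun htop => ?_
  have hmem : EuclideanSpace.single i (1 : ℝ) ∈
      LinearMap.ker (EuclideanSpace.proj i : EuclideanSpace ℝ (Fin d) →L[ℝ] ℝ).toLinearMap := by
    rw [htop]
    trivial
  simp at hmem

/-- The inclusion of `ℝ^d` in `ℝ^N` as the first `d` coordinates, onto the span of
`halfSpaceModel N d`. -/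
noncomputable def coordIncl (N d : ℕ) : EuclideanSpace ℝ (Fin d) →L[ℝ] EuclideanSpace ℝ (Fin N) :=
  LinearMap.toContinuousLinearMap
    { toFun := fun v => WithLp.toLp 2 fun i => if h : (i : ℕ) < d then v ⟨i, h⟩ else 0
      map_add' := fun u v => by ext i; by_cases h : (i : ℕ) < d <;> simp [h]
      map_smul' := fun c v => by ext i; by_cases h : (i : ℕ) < d <;> simp [h] }

/-- The projection of `ℝ^N` to its first `d` coordinates, a left inverse of `coordIncl N d`. -/
noncomputable def coordProj {N d : ℕ} (hd : d ≤ N) :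
    EuclideanSpace ℝ (Fin N) →L[ℝ] EuclideanSpace ℝ (Fin d) :=
  LinearMap.toContinuousLinearMap
    { toFun := fun v => WithLp.toLp 2 fun i => v (Fin.castLE hd i)
      map_add' := fun u v => by ext i; simp
      map_smul' := fun c v => by ext i; simp }

section Coordinates

variable {N d : ℕ}

theorem coordIncl_apply (v : EuclideanSpace ℝ (Fin d)) (i : Fin N) :
    coordIncl N d v i = if h : (i : ℕ) < d then v ⟨i, h⟩ else 0 := rfl

theorem coordProj_apply (hd : d ≤ N) (v : EuclideanSpace ℝ (Fin N)) (i : Fin d) :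
    coordProj hd v i = v (Fin.castLE hd i) := rfl

theorem coordProj_coordIncl (hd : d ≤ N) (v : EuclideanSpace ℝ (Fin d)) :
    coordProj hd (coordIncl N d v) = v := by
  ext i
  simp [coordProj_apply, coordIncl_apply]

theorem coordIncl_coordProj (hd : d ≤ N) {y : EuclideanSpace ℝ (Fin N)}
    (hy : y ∈ halfSpaceModel N d) : coordIncl N d (coordProj hd y) = y := by
  ext i
  by_cases h : (i : ℕ) < d
  · simp only [coordIncl_apply, h, dite_true, coordProj_apply]
    rfl
  · simp [coordIncl_apply, h, hy.1 i (not_lt.1 h)]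

theorem coordIncl_mem {v : EuclideanSpace ℝ (Fin d)} (hv : v ∈ halfSpace d) :
    coordIncl N d v ∈ halfSpaceModel N d := by
  refine ⟨fun i hi => by simp [coordIncl_apply, not_lt.2 hi], fun i hi => ?_⟩
  by_cases h : (i : ℕ) < d
  · simpa [coordIncl_apply, h] using hv ⟨i, h⟩ hi
  · simp [coordIncl_apply, h]

theorem coordProj_mem (hd : d ≤ N) {y : EuclideanSpace ℝ (Fin N)}
    (hy : y ∈ halfSpaceModel N d) : coordProj hd y ∈ halfSpace d := fun i hi => by
  simpa [coordProj_apply] using hy.2 (Fin.castLE hd i) (by simpa using hi)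

end Coordinates

/-- `ψ` parametrizes `M ∩ U` by the part of the half space of `ℝ^d` that lies in `V`, with
inverse `χ`; both maps are `C¹` on open sets. -/
structure IsLocalParam {N d : ℕ} (M U : Set (EuclideanSpace ℝ (Fin N)))
    (V : Set (EuclideanSpace ℝ (Fin d))) (χ : EuclideanSpace ℝ (Fin N) → EuclideanSpace ℝ (Fin d))
    (ψ : EuclideanSpace ℝ (Fin d) → EuclideanSpace ℝ (Fin N)) : Prop where
  isOpen_source : IsOpen U
  isOpen_target : IsOpen V
  contDiffOn : ContDiffOn ℝ 1 χ U
  contDiffOn_symm : ContDiffOn ℝ 1 ψ V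
  mem_target : ∀ x ∈ M ∩ U, χ x ∈ halfSpace d ∩ V
  left_inv : ∀ x ∈ M ∩ U, ψ (χ x) = x
  mem_source : ∀ v ∈ halfSpace d ∩ V, ψ v ∈ M ∩ U
  right_inv : ∀ v ∈ halfSpace d ∩ V, χ (ψ v) = v

section LocalParam

variable {N d : ℕ} {M U : Set (EuclideanSpace ℝ (Fin N))} {V : Set (EuclideanSpace ℝ (Fin d))}
  {χ : EuclideanSpace ℝ (Fin N) → EuclideanSpace ℝ (Fin d)}
  {ψ : EuclideanSpace ℝ (Fin d) → EuclideanSpace ℝ (Fin N)} {x : EuclideanSpace ℝ (Fin N)}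
  {v : EuclideanSpace ℝ (Fin d)} {f : EuclideanSpace ℝ (Fin N) → ℝ}

theorem IsSubmanifoldWithBoundary.exists_isLocalParam (hM : IsSubmanifoldWithBoundary d M)
    (hx : x ∈ M) :
    ∃ (U : Set (EuclideanSpace ℝ (Fin N))) (V : Set (EuclideanSpace ℝ (Fin d)))
      (χ : EuclideanSpace ℝ (Fin N) → EuclideanSpace ℝ (Fin d))
      (ψ : EuclideanSpace ℝ (Fin d) → EuclideanSpace ℝ (Fin N)),
      x ∈ U ∧ IsLocalParam M U V χ ψ := by
  obtain ⟨hd, hM⟩ := hM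
  obtain ⟨φ, hxφ, hφ, hφ_symm, himage⟩ := hM x hx
  have hto : ∀ y ∈ M ∩ φ.source, φ y ∈ halfSpaceModel N d ∩ φ.target := fun y hy =>
    himage ▸ Set.mem_image_of_mem φ hy
  have hfrom : ∀ y ∈ halfSpaceModel N d ∩ φ.target, φ.symm y ∈ M ∩ φ.source := fun y hy => by
    obtain ⟨z, hz, rfl⟩ := himage.symm ▸ hy
    rwa [φ.left_inv hz.2]
  have hincl : ∀ v ∈ halfSpace d ∩ coordIncl N d ⁻¹' φ.target,
      coordIncl N d v ∈ halfSpaceModel N d ∩ φ.target := fun v hv => ⟨coordIncl_mem hv.1, hv.2⟩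
  refine ⟨φ.source, coordIncl N d ⁻¹' φ.target, coordProj hd ∘ φ, φ.symm ∘ coordIncl N d, hxφ, {
    isOpen_source := φ.open_source
    isOpen_target := φ.open_target.preimage (coordIncl N d).continuous
    contDiffOn := (coordProj hd).contDiff.comp_contDiffOn (hφ.of_le (by exact_mod_cast le_top))
    contDiffOn_symm := (hφ_symm.of_le (by exact_mod_cast le_top)).comp
      (coordIncl N d).contDiff.contDiffOn fun _ h => h
    mem_target := fun y hy => ⟨coordProj_mem hd (hto y hy).1, ?_⟩
    left_inv := fun y hy => ?_
    mem_source := fun v hv => hfrom _ (hincl v hv)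
    right_inv := fun v hv => ?_ }⟩
  · rw [Set.mem_preimage, Function.comp_apply, coordIncl_coordProj hd (hto y hy).1]
    exact (hto y hy).2
  · simp only [Function.comp_apply]
    rw [coordIncl_coordProj hd (hto y hy).1, φ.left_inv hy.2]
  · simp only [Function.comp_apply]
    rw [φ.right_inv hv.2, coordProj_coordIncl]

namespace IsLocalParam

theorem contDiffAt (h : IsLocalParam M U V χ ψ) (hx : x ∈ U) : ContDiffAt ℝ 1 χ x :=
  h.contDiffOn.contDiffAt (h.isOpen_source.mem_nhds hx)

theorem contDiffAt_symm (h : IsLocalParam M U V χ ψ) (hv : v ∈ V) : ContDiffAt ℝ 1 ψ v :=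
  h.contDiffOn_symm.contDiffAt (h.isOpen_target.mem_nhds hv)

theorem map_nhdsWithin (h : IsLocalParam M U V χ ψ) (hv : v ∈ halfSpace d ∩ V) :
    map ψ (𝓝[halfSpace d] v) = 𝓝[M] (ψ v) := by
  have hvU := h.mem_source v hv
  refine le_antisymm (tendsto_nhdsWithin_iff.2
    ⟨(h.contDiffAt_symm hv.2).continuousAt.continuousWithinAt, ?_⟩) ?_
  · filter_upwards [inter_mem_nhdsWithin _ (h.isOpen_target.mem_nhds hv.2)] with u hu
      using (h.mem_source u hu).1
  have hnear : M ∩ U ∈ 𝓝[M] (ψ v) := inter_mem_nhdsWithin _ (h.isOpen_source.mem_nhds hvU.2)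
  have hχ : Tendsto χ (𝓝[M] (ψ v)) (𝓝[halfSpace d] v) := by
    refine tendsto_nhdsWithin_iff.2 ⟨?_, ?_⟩
    · simpa only [h.right_inv v hv] using
        (h.contDiffAt hvU.2).continuousAt.tendsto.mono_left (nhdsWithin_le_nhds (s := M))
    · filter_upwards [hnear] with y hy using (h.mem_target y hy).1
  calc 𝓝[M] (ψ v) = map (ψ ∘ χ) (𝓝[M] (ψ v)) := by
        refine map_id.symm.trans (Filter.map_congr ?_)
        filter_upwards [hnear] with y hy using (h.left_inv y hy).symm
    _ ≤ map ψ (𝓝[halfSpace d] v) := map_mono hχ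

theorem exists_isBilipschitzOn (h : IsLocalParam M U V χ ψ) (hv : v ∈ halfSpace d ∩ V) :
    ∃ K : ℝ≥0, ∃ r > 0, IsBilipschitzOn K ψ (halfSpace d ∩ Metric.closedBall v r) ∧
      Metric.closedBall v r ⊆ V := by
  have hψ := h.contDiffAt_symm hv.2
  obtain ⟨K, s, hs, hK⟩ := hψ.exists_lipschitzOnWith
  obtain ⟨K', s', hs', hK'⟩ := (h.contDiffAt (h.mem_source v hv).2).exists_lipschitzOnWith
  have hnhds : s ∩ V ∩ ψ ⁻¹' s' ∈ 𝓝 v :=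
    inter_mem (inter_mem hs (h.isOpen_target.mem_nhds hv.2))
      (hψ.continuousAt.preimage_mem_nhds hs')
  obtain ⟨r, hr, hball⟩ := Metric.nhds_basis_closedBall.mem_iff.1 hnhds
  refine ⟨max K K', r, hr, fun u hu w hw => ⟨?_, ?_⟩, fun u hu => (hball hu).1.2⟩
  · refine (hK.dist_le_mul u (hball hu.2).1.1 w (hball hw.2).1.1).trans ?_
    gcongr
    exact le_max_left _ _
  · have hle := hK'.dist_le_mul (ψ u) (hball hu.2).2 (ψ w) (hball hw.2).2
    rw [h.right_inv u ⟨hu.1, (hball hu.2).1.2⟩, h.right_inv w ⟨hw.1, (hball hw.2).1.2⟩] at hle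
    refine hle.trans ?_
    gcongr
    exact le_max_right _ _

end IsLocalParam

/-- `σ '' S` is a piece of `M` parametrized with bounded distortion by a compact convex body `S`
of positive volume. Compactness of `M` reduces uniform estimates to such pieces. -/
structure IsConvexPatch (M : Set (EuclideanSpace ℝ (Fin N))) (K : ℝ≥0)
    (σ : EuclideanSpace ℝ (Fin d) → EuclideanSpace ℝ (Fin N)) (S : Set (EuclideanSpace ℝ (Fin d))) :
    Prop where
  isBilipschitzOn : IsBilipschitzOn K σ S
  image_subset : σ '' S ⊆ M
  isCompact : IsCompact S
  convex : Convex ℝ S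
  volume_pos : 0 < volume S

theorem IsSubmanifoldWithBoundary.exists_isConvexPatch (hM : IsSubmanifoldWithBoundary d M)
    (hx : x ∈ M) :
    ∃ (K : ℝ≥0) (σ : EuclideanSpace ℝ (Fin d) → EuclideanSpace ℝ (Fin N))
      (S : Set (EuclideanSpace ℝ (Fin d))), IsConvexPatch M K σ S ∧ σ '' S ∈ 𝓝[M] x := by
  obtain ⟨U, V, χ, ψ, hxU, h⟩ := hM.exists_isLocalParam hx
  have hv := h.mem_target x ⟨hx, hxU⟩
  obtain ⟨K, r, hr, hbil, hball⟩ := h.exists_isBilipschitzOn hv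
  refine ⟨K, ψ, halfSpace d ∩ Metric.closedBall (χ x) r, {
    isBilipschitzOn := hbil
    image_subset := Set.image_subset_iff.2 fun u hu => (h.mem_source u ⟨hu.1, hball hu.2⟩).1
    isCompact := (isCompact_closedBall _ _).inter_left (isClosed_halfSpace d)
    convex := (convex_halfSpace d).inter (convex_closedBall _ _)
    volume_pos := volume_halfSpace_inter_closedBall_pos hv.1 hr }, ?_⟩
  have hmap := h.map_nhdsWithin hv
  rw [h.left_inv x ⟨hx, hxU⟩] at hmap
  rw [← hmap]
  exact image_mem_map (inter_mem_nhdsWithin _ (Metric.closedBall_mem_nhds _ hr))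

theorem IsSubmanifoldWithBoundary.measure_lt_top (hM : IsSubmanifoldWithBoundary d M)
    (hMc : IsCompact M) : Measure.euclideanHausdorffMeasure d M < ⊤ := by
  refine hMc.measure_lt_top_of_nhdsWithin fun x hx => ?_
  obtain ⟨K, σ, S, hS, hnhds⟩ := hM.exists_isConvexPatch hx
  have hle := euclideanHausdorffMeasure_image_le hS.isBilipschitzOn.lipschitzOnWith d
  refine ⟨_, hnhds, hle.trans_lt (ENNReal.mul_lt_top (by finiteness) ?_)⟩
  rw [EuclideanSpace.euclideanHausdorffMeasure_eq_volume]
  exact hS.isCompact.measure_lt_top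

theorem IsSubmanifoldWithBoundary.exists_lipschitzOnWith (hM : IsSubmanifoldWithBoundary d M)
    (hMc : IsCompact M) (hf : ContDiffOn ℝ 1 f M) : ∃ K, LipschitzOnWith K f M := by
  refine LocallyLipschitzOn.exists_lipschitzOnWith_of_compact hMc fun x hx => ?_
  obtain ⟨U, V, χ, ψ, hxU, h⟩ := hM.exists_isLocalParam hx
  have hv := h.mem_target x ⟨hx, hxU⟩
  obtain ⟨K, r, hr, hbil, hball⟩ := h.exists_isBilipschitzOn hv
  set S := halfSpace d ∩ Metric.closedBall (χ x) r
  have hmap := h.map_nhdsWithin hv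
  rw [h.left_inv x ⟨hx, hxU⟩] at hmap
  have hfψ : ContDiffWithinAt ℝ 1 (f ∘ ψ) S (χ x) := by
    refine ContDiffWithinAt.comp (t := M) (χ x) ?_ (h.contDiffAt_symm hv.2).contDiffWithinAt
      fun u hu => (h.mem_source u ⟨hu.1, hball hu.2⟩).1
    rw [h.left_inv x ⟨hx, hxU⟩]
    exact hf x hx
  obtain ⟨K', T, hT, hK'⟩ :=
    hfψ.exists_lipschitzOnWith ((convex_halfSpace d).inter (convex_closedBall _ _))
  rw [nhdsWithin_inter_of_mem' (mem_nhdsWithin_of_mem_nhds (Metric.closedBall_mem_nhds _ hr))] at hT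
  refine ⟨K' * K, ψ '' (T ∩ S), ?_, ?_⟩
  · rw [← hmap]
    exact image_mem_map (inter_mem hT (inter_mem_nhdsWithin _ (Metric.closedBall_mem_nhds _ hr)))
  · have hinv := hbil.injOn.leftInvOn_invFunOn
    have hcomp : LipschitzOnWith (K' * K) ((f ∘ ψ) ∘ Function.invFunOn ψ S) (ψ '' (T ∩ S)) := by
      refine hK'.comp
        (hbil.lipschitzOnWith_invFunOn.mono (Set.image_mono Set.inter_subset_right)) ?_
      rintro _ ⟨u, hu, rfl⟩
      rw [hinv hu.2]
      exact hu.1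
    rintro _ ⟨u, hu, rfl⟩ _ ⟨w, hw, rfl⟩
    have hle := hcomp (Set.mem_image_of_mem ψ hu) (Set.mem_image_of_mem ψ hw)
    simpa only [Function.comp_apply, hinv hu.2, hinv hw.2] using hle

end LocalParam

/-! ### Parametrizations tangent to `M` -/

/-- `σ` is a parametrization of a neighborhood of `x` in `M`, with `σ 0 = x`, whose differential
at the origin is the isometry `ι` of `ℝ^d` onto the tangent space. Such a `σ` distorts lengths
near the origin by a factor as close to `1` as desired. -/
structure IsTangentParam {N d : ℕ} (M : Set (EuclideanSpace ℝ (Fin N)))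
    (x : EuclideanSpace ℝ (Fin N)) (ι : EuclideanSpace ℝ (Fin d) →ₗᵢ[ℝ] EuclideanSpace ℝ (Fin N))
    (σ : EuclideanSpace ℝ (Fin d) → EuclideanSpace ℝ (Fin N)) : Prop where
  range_eq : LinearMap.range ι.toLinearMap = tangentSpace M x
  apply_zero : σ 0 = x
  hasStrictFDerivAt : HasStrictFDerivAt σ ι.toContinuousLinearMap 0
  map_nhds : map σ (𝓝 0) = 𝓝[M] x

section TangentParam

variable {N d : ℕ} {M U : Set (EuclideanSpace ℝ (Fin N))} {V : Set (EuclideanSpace ℝ (Fin d))}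
  {χ : EuclideanSpace ℝ (Fin N) → EuclideanSpace ℝ (Fin d)}
  {ψ : EuclideanSpace ℝ (Fin d) → EuclideanSpace ℝ (Fin N)} {x : EuclideanSpace ℝ (Fin N)}
  {v : EuclideanSpace ℝ (Fin d)}

namespace IsLocalParam

theorem fderiv_comp_fderiv_symm (h : IsLocalParam M U V χ ψ) (hv : v ∈ V)
    (hint : halfSpace d ∈ 𝓝 v) :
    (fderiv ℝ χ (ψ v)).comp (fderiv ℝ ψ v) = ContinuousLinearMap.id ℝ _ := by
  have hvU := (h.mem_source v ⟨mem_of_mem_nhds hint, hv⟩).2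
  have hχ := ((h.contDiffAt hvU).differentiableAt one_ne_zero).hasFDerivAt
  have hψ := ((h.contDiffAt_symm hv).differentiableAt one_ne_zero).hasFDerivAt
  refine (hχ.comp v hψ).unique ((hasFDerivAt_id v).congr_of_eventuallyEq ?_)
  filter_upwards [inter_mem hint (h.isOpen_target.mem_nhds hv)] with u hu using h.right_inv u hu

theorem fderiv_symm_apply_mem_tangentSpace (h : IsLocalParam M U V χ ψ) (hv : v ∈ V)
    (hint : halfSpace d ∈ 𝓝 v) (u : EuclideanSpace ℝ (Fin d)) :
    fderiv ℝ ψ v u ∈ tangentSpace M (ψ v) := by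
  have hψ := ((h.contDiffAt_symm hv).differentiableAt one_ne_zero).hasFDerivAt
  have hcone : u ∈ tangentConeAt ℝ (halfSpace d ∩ V) v := by
    rw [tangentConeAt_of_mem_nhds (inter_mem hint (h.isOpen_target.mem_nhds hv))]
    trivial
  refine Submodule.subset_span (tangentConeAt_mono ?_
    (hψ.hasFDerivWithinAt.mapsTo_tangent_cone hcone))
  exact Set.image_subset_iff.2 fun w hw => (h.mem_source w hw).1

theorem fderiv_symm_fderiv_apply (h : IsLocalParam M U V χ ψ) (hv : v ∈ halfSpace d ∩ V)
    {w : EuclideanSpace ℝ (Fin N)} (hw : w ∈ tangentSpace M (ψ v)) :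
    fderiv ℝ ψ v (fderiv ℝ χ (ψ v) w) = w := by
  have hvU := h.mem_source v hv
  have hχ := ((h.contDiffAt hvU.2).differentiableAt one_ne_zero).hasFDerivAt
  have hψ := ((h.contDiffAt_symm hv.2).differentiableAt one_ne_zero).hasFDerivAt
  rw [← h.right_inv v hv] at hψ
  have hid : HasFDerivWithinAt (ψ ∘ χ) (ContinuousLinearMap.id ℝ _) M (ψ v) := by
    refine (hasFDerivWithinAt_id _ M).congr_of_eventuallyEq ?_ (h.left_inv _ hvU)
    filter_upwards [inter_mem_nhdsWithin M (h.isOpen_source.mem_nhds hvU.2)] with y hy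
      using h.left_inv y hy
  have hcone := (hψ.comp (ψ v) hχ).hasFDerivWithinAt.unique_on hid
  rw [h.right_inv v hv] at hcone
  exact LinearMap.eqOn_span (f := ((fderiv ℝ ψ v).comp (fderiv ℝ χ (ψ v))).toLinearMap)
    (g := LinearMap.id) (fun w hw => hcone hw) hw

theorem exists_linearIsometry_range_eq (h : IsLocalParam M U V χ ψ) (hv : v ∈ V)
    (hint : halfSpace d ∈ 𝓝 v) :
    ∃ ι : EuclideanSpace ℝ (Fin d) →ₗᵢ[ℝ] EuclideanSpace ℝ (Fin N),
      LinearMap.range ι.toLinearMap = tangentSpace M (ψ v) := by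
  have hinj : Function.Injective (fderiv ℝ ψ v) := Function.LeftInverse.injective
    (g := fderiv ℝ χ (ψ v)) fun u => DFunLike.congr_fun (h.fderiv_comp_fderiv_symm hv hint) u
  have hrange : LinearMap.range (fderiv ℝ ψ v).toLinearMap = tangentSpace M (ψ v) := by
    refine le_antisymm ?_ fun w hw =>
      ⟨_, h.fderiv_symm_fderiv_apply ⟨mem_of_mem_nhds hint, hv⟩ hw⟩
    rintro _ ⟨u, rfl⟩
    exact h.fderiv_symm_apply_mem_tangentSpace hv hint u
  have hfinrank : Module.finrank ℝ (tangentSpace M (ψ v)) = d := by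
    rw [← hrange, LinearMap.finrank_range_of_inj hinj, finrank_euclideanSpace_fin]
  let e := ((stdOrthonormalBasis ℝ (tangentSpace M (ψ v))).reindex (finCongr hfinrank)).repr
  refine ⟨(tangentSpace M (ψ v)).subtypeₗᵢ.comp e.symm.toLinearIsometry, ?_⟩
  ext w
  exact ⟨fun ⟨u, hu⟩ => hu ▸ (e.symm u).2, fun hw => ⟨e ⟨w, hw⟩, by simp⟩⟩

theorem exists_isTangentParam (h : IsLocalParam M U V χ ψ) (hv : v ∈ V)
    (hint : halfSpace d ∈ 𝓝 v) :
    ∃ (ι : EuclideanSpace ℝ (Fin d) →ₗᵢ[ℝ] EuclideanSpace ℝ (Fin N))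
      (σ : EuclideanSpace ℝ (Fin d) → EuclideanSpace ℝ (Fin N)), IsTangentParam M (ψ v) ι σ := by
  obtain ⟨ι, hι⟩ := h.exists_linearIsometry_range_eq hv hint
  have hvH : v ∈ halfSpace d ∩ V := ⟨mem_of_mem_nhds hint, hv⟩
  set C := (fderiv ℝ χ (ψ v)).comp ι.toContinuousLinearMap
  have hAC : (fderiv ℝ ψ v).comp C = ι.toContinuousLinearMap := by
    ext1 u
    exact h.fderiv_symm_fderiv_apply hvH (hι ▸ LinearMap.mem_range_self ι.toLinearMap u)
  have hsurj : LinearMap.range C.toLinearMap = ⊤ := by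
    refine LinearMap.range_eq_top.2 (LinearMap.injective_iff_surjective.1 ?_)
    refine Function.Injective.of_comp (f := fderiv ℝ ψ v) ?_
    convert ι.injective
    exact congrArg DFunLike.coe hAC
  have htranslate : HasStrictFDerivAt (fun u => v + C u) C 0 := C.hasStrictFDerivAt.const_add v
  have hmap : map (fun u => v + C u) (𝓝 0) = 𝓝 v := by
    simpa using htranslate.map_nhds_eq_of_surj hsurj
  refine ⟨ι, fun u => ψ (v + C u), {
    range_eq := hι
    apply_zero := by simp
    hasStrictFDerivAt := ?_
    map_nhds := ?_ }⟩
  · rw [← hAC]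
    refine HasStrictFDerivAt.comp (0 : EuclideanSpace ℝ (Fin d)) ?_ htranslate
    simpa using (h.contDiffAt_symm hv).hasStrictFDerivAt one_ne_zero
  · rw [← h.map_nhdsWithin hvH, nhdsWithin_eq_nhds.2 hint, ← hmap, Filter.map_map]
    rfl

theorem ae_differentiableAt_comp (h : IsLocalParam M U V χ ψ) {f : EuclideanSpace ℝ (Fin N) → ℝ}
    {K : ℝ≥0} (hf : LipschitzWith K f) :
    ∀ᵐ v : EuclideanSpace ℝ (Fin d), v ∈ V → DifferentiableAt ℝ (f ∘ ψ) v := by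
  refine measure_null_of_locally_null _ fun v hv => ?_
  obtain ⟨K', s, hs, hψ⟩ := (h.contDiffAt_symm (Classical.not_imp.1 hv).1).exists_lipschitzOnWith
  have hrademacher := (hf.comp_lipschitzOnWith hψ).ae_differentiableWithinAt_of_mem (μ := volume)
  refine ⟨_, inter_mem_nhdsWithin _ (interior_mem_nhds.2 hs), measure_mono_null ?_ hrademacher⟩
  exact fun u hu hd => hu.1 fun _ =>
    (hd (interior_subset hu.2)).differentiableAt (mem_interior_iff_mem_nhds.1 hu.2)

theorem differentiableWithinAt_of_comp (h : IsLocalParam M U V χ ψ) (hv : v ∈ halfSpace d ∩ V)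
    {f : EuclideanSpace ℝ (Fin N) → ℝ} (hf : DifferentiableAt ℝ (f ∘ ψ) v) :
    DifferentiableWithinAt ℝ f M (ψ v) := by
  have hvU := h.mem_source v hv
  rw [← h.right_inv v hv] at hf
  refine (hf.comp (ψ v) ((h.contDiffAt hvU.2).differentiableAt one_ne_zero)
    ).differentiableWithinAt.congr_of_eventuallyEq ?_ ?_
  · filter_upwards [inter_mem_nhdsWithin M (h.isOpen_source.mem_nhds hvU.2)] with y hy
    exact congr_arg f (h.left_inv y hy).symm
  · exact congr_arg f (h.left_inv _ hvU).symm

end IsLocalParam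

namespace IsSubmanifoldWithBoundary

theorem ae_of_forall_isLocalParam (hM : IsSubmanifoldWithBoundary d M) (hMm : MeasurableSet M)
    {q : EuclideanSpace ℝ (Fin N) → Prop}
    (hq : ∀ ⦃U V χ ψ⦄, IsLocalParam M U V χ ψ →
      ∀ᵐ v : EuclideanSpace ℝ (Fin d), v ∈ V → halfSpace d ∈ 𝓝 v → q (ψ v)) :
    ∀ᵐ x ∂riemannianVolume d M, q x := by
  refine (ae_restrict_iff' hMm).2 (measure_null_of_locally_null _ fun x hx => ?_)
  simp only [Set.mem_compl_iff, Set.mem_ofPred_eq, Classical.not_imp] at hx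
  obtain ⟨U, V, χ, ψ, hxU, h⟩ := hM.exists_isLocalParam hx.1
  have hv := h.mem_target x ⟨hx.1, hxU⟩
  obtain ⟨K, r, hr, hbil, hball⟩ := h.exists_isBilipschitzOn hv
  set S := halfSpace d ∩ Metric.closedBall (χ x) r
  have hmap := h.map_nhdsWithin hv
  rw [h.left_inv x ⟨hx.1, hxU⟩] at hmap
  have hnhds : ψ '' S ∈ 𝓝[M] x := by
    rw [← hmap]
    exact image_mem_map (inter_mem_nhdsWithin _ (Metric.closedBall_mem_nhds _ hr))
  have hgood : ∀ᵐ v : EuclideanSpace ℝ (Fin d), v ∈ S → q (ψ v) := by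
    filter_upwards [hq h, ae_all_iff.2 fun i : Fin d =>
      measure_eq_zero_iff_ae_notMem.1 (volume_setOf_coord_eq_zero i)] with v hqv hne hvS
    exact hqv (hball hvS.2) (halfSpace_mem_nhds fun i hi => (hvS.1 i hi).lt_of_ne' (hne i))
  refine ⟨_, inter_mem self_mem_nhdsWithin (nhdsWithin_mono x ?_ hnhds),
    measure_mono_null (t := ψ '' {v | ¬(v ∈ S → q (ψ v))}) ?_ ?_⟩
  · exact fun y hy => (Classical.not_imp.1 hy).1
  · rintro _ ⟨hy, u, hu, rfl⟩
    exact ⟨u, fun hqu => (Classical.not_imp.1 hy).2 (hqu hu), rfl⟩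
  · refine le_antisymm ((euclideanHausdorffMeasure_image_le (hbil.lipschitzOnWith.mono
      fun v hv => (Classical.not_imp.1 hv).1) d).trans (le_of_eq ?_)) zero_le
    rw [EuclideanSpace.euclideanHausdorffMeasure_eq_volume]
    exact mul_eq_zero_of_right _ hgood

theorem ae_exists_isTangentParam (hM : IsSubmanifoldWithBoundary d M) (hMm : MeasurableSet M) :
    ∀ᵐ x ∂riemannianVolume d M, ∃ (ι : EuclideanSpace ℝ (Fin d) →ₗᵢ[ℝ] EuclideanSpace ℝ (Fin N))
      (σ : EuclideanSpace ℝ (Fin d) → EuclideanSpace ℝ (Fin N)), IsTangentParam M x ι σ :=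
  hM.ae_of_forall_isLocalParam hMm fun _ _ _ _ h => .of_forall fun _ => h.exists_isTangentParam

theorem ae_differentiableWithinAt (hM : IsSubmanifoldWithBoundary d M) (hMm : MeasurableSet M)
    {f : EuclideanSpace ℝ (Fin N) → ℝ} {K : ℝ≥0} (hf : LipschitzWith K f) :
    ∀ᵐ x ∂riemannianVolume d M, DifferentiableWithinAt ℝ f M x := by
  refine hM.ae_of_forall_isLocalParam hMm fun U V χ ψ h => ?_
  filter_upwards [h.ae_differentiableAt_comp hf] with v hd hv hint
  exact h.differentiableWithinAt_of_comp ⟨mem_of_mem_nhds hint, hv⟩ (hd hv)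

end IsSubmanifoldWithBoundary

namespace IsTangentParam

variable {ι : EuclideanSpace ℝ (Fin d) →ₗᵢ[ℝ] EuclideanSpace ℝ (Fin N)}
  {σ : EuclideanSpace ℝ (Fin d) → EuclideanSpace ℝ (Fin N)}

theorem eventually_isBilipschitzOn (h : IsTangentParam M x ι σ) {K : ℝ≥0} (hK : 1 < K) :
    ∀ᶠ r in 𝓝[>] (0 : ℝ), IsBilipschitzOn K σ (Metric.closedBall 0 r) := by
  have hK0 : (0 : ℝ) < K := zero_lt_one.trans (by exact_mod_cast hK)
  have hK1 : (1 : ℝ) < K := by exact_mod_cast hK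
  have hε : 0 < (K - 1 : ℝ) / K := div_pos (by linarith) hK0
  have hstrict := Asymptotics.isLittleO_iff.1 h.hasStrictFDerivAt.isLittleO hε
  rw [nhds_prod_eq, (Metric.nhds_basis_closedBall.prod_self).eventually_iff] at hstrict
  obtain ⟨r₀, hr₀, hball⟩ := hstrict
  filter_upwards [Ioo_mem_nhdsGT hr₀] with r hr u hu v hv
  have hsub := Metric.closedBall_subset_closedBall (x := (0 : EuclideanSpace ℝ (Fin d))) hr.2.le
  have hclose := hball (x := (u, v)) ⟨hsub hu, hsub hv⟩
  have hι : ‖ι.toContinuousLinearMap (u - v)‖ = ‖u - v‖ := ι.norm_map _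
  have hupper := norm_sub_norm_le (σ u - σ v) (ι.toContinuousLinearMap (u - v))
  have hlower := norm_sub_norm_le (ι.toContinuousLinearMap (u - v)) (σ u - σ v)
  rw [norm_sub_rev (ι.toContinuousLinearMap (u - v)) (σ u - σ v), hι] at hlower
  rw [hι] at hupper
  simp only at hclose
  have hexpand : K * ((K - 1 : ℝ) / K * ‖u - v‖) = (K - 1) * ‖u - v‖ := by field_simp
  have hle : (K - 1 : ℝ) / K * ‖u - v‖ ≤ (K - 1) * ‖u - v‖ := by
    gcongr
    exact div_le_self (by linarith) hK1.le
  rw [dist_eq_norm, dist_eq_norm]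
  exact ⟨by linarith, by nlinarith⟩

theorem image_mem_nhdsWithin (h : IsTangentParam M x ι σ) {s : Set (EuclideanSpace ℝ (Fin d))}
    (hs : s ∈ 𝓝 0) : σ '' s ∈ 𝓝[M] x :=
  h.map_nhds ▸ image_mem_map hs

theorem eventually_mem (h : IsTangentParam M x ι σ) : ∀ᶠ u in 𝓝 0, σ u ∈ M :=
  eventually_map.1 (h.map_nhds ▸ self_mem_nhdsWithin)

end IsTangentParam

end TangentParam

/-! ### Gaussian integrals -/

section EuclideanGaussian

variable {d : ℕ}

theorem lintegral_comp_rescale {t : ℝ} (ht : 0 < t) (v₀ : EuclideanSpace ℝ (Fin d))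
    (F : EuclideanSpace ℝ (Fin d) → ℝ≥0∞) :
    ∫⁻ v, ENNReal.ofReal (1 / t ^ ((d : ℝ) / 2)) * F ((√t)⁻¹ • (v - v₀)) = ∫⁻ v, F v := by
  have hs : (√t)⁻¹ ≠ 0 := inv_ne_zero (Real.sqrt_pos.2 ht).ne'
  have hscale := lintegral_map_equiv (μ := volume) F (MeasurableEquiv.smul₀ (√t)⁻¹ hs)
  rw [MeasurableEquiv.coe_smul₀, Measure.map_addHaar_smul volume hs, lintegral_smul_measure,
    smul_eq_mul, finrank_euclideanSpace_fin, inv_pow, inv_inv, abs_of_nonneg (by positivity),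
    Real.sqrt_eq_rpow, ← Real.rpow_natCast, ← Real.rpow_mul ht.le,
    show 1 / 2 * (d : ℝ) = (d : ℝ) / 2 by ring, ← Real.sqrt_eq_rpow] at hscale
  rw [lintegral_const_mul' _ _ ENNReal.ofReal_ne_top,
    lintegral_sub_right_eq_self (fun v => F ((√t)⁻¹ • v)) v₀, ← hscale, ← mul_assoc,
    ← ENNReal.ofReal_mul (by positivity), one_div_mul_cancel (by positivity), ENNReal.ofReal_one,
    one_mul]

theorem tendsto_one_div_rpow_mul_exp (k : ℝ) {c : ℝ} (hc : 0 < c) :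
    Tendsto (fun t : ℝ => 1 / t ^ k * Real.exp (-(c / t))) (𝓝[>] 0) (𝓝 0) := by
  refine ((tendsto_rpow_mul_exp_neg_mul_atTop_nhds_zero k c hc).comp
    tendsto_inv_nhdsGT_zero).congr' ?_
  filter_upwards [self_mem_nhdsWithin] with t ht
  rw [Function.comp_apply, Real.inv_rpow (le_of_lt ht), one_div, neg_mul, div_eq_mul_inv]

theorem norm_inv_sqrt_smul_sq {E : Type*} [NormedAddCommGroup E] [NormedSpace ℝ E] {t : ℝ}
    (ht : 0 < t) (v : E) : ‖(√t)⁻¹ • v‖ ^ 2 = ‖v‖ ^ 2 / t := by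
  rw [norm_smul, mul_pow, norm_inv, Real.norm_of_nonneg (Real.sqrt_nonneg t), inv_pow,
    Real.sq_sqrt ht.le, inv_mul_eq_div]

theorem integrable_exp_neg_mul_sq_norm (d : ℕ) {b : ℝ} (hb : 0 < b) :
    Integrable fun v : EuclideanSpace ℝ (Fin d) => Real.exp (-b * ‖v‖ ^ 2) := by
  refine not_imp_comm.1 integral_undef ?_
  rw [GaussianFourier.integral_rexp_neg_mul_sq_norm hb]
  positivity

theorem integral_exp_neg_sq_norm (d : ℕ) :
    ∫ u : EuclideanSpace ℝ (Fin d), Real.exp (-‖u‖ ^ 2) = Real.pi ^ ((d : ℝ) / 2) := by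
  simpa using GaussianFourier.integral_rexp_neg_mul_sq_norm (V := EuclideanSpace ℝ (Fin d)) one_pos

theorem sq_mul_exp_neg_sq_le (s : ℝ) : s ^ 2 * Real.exp (-s ^ 2) ≤ 2 * Real.exp (-(s ^ 2 / 2)) := by
  have hle := Real.add_one_le_exp (s ^ 2 / 2)
  have hsplit : Real.exp (-s ^ 2) = Real.exp (-(s ^ 2 / 2)) * Real.exp (-(s ^ 2 / 2)) := by
    rw [← Real.exp_add]
    ring_nf
  have hcancel : Real.exp (s ^ 2 / 2) * Real.exp (-(s ^ 2 / 2)) = 1 := by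
    rw [← Real.exp_add, add_neg_cancel, Real.exp_zero]
  rw [hsplit, ← mul_assoc]
  gcongr
  nlinarith [Real.exp_pos (-(s ^ 2 / 2))]

theorem integrable_sq_mul_exp_neg_sq_norm (ℓ : EuclideanSpace ℝ (Fin d) →L[ℝ] ℝ) :
    Integrable fun u : EuclideanSpace ℝ (Fin d) => ℓ u ^ 2 * Real.exp (-‖u‖ ^ 2) := by
  refine Integrable.mono' ((integrable_exp_neg_mul_sq_norm d one_half_pos).const_mul
    (‖ℓ‖ ^ 2 * 2)) (by fun_prop) (.of_forall fun u => ?_)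
  rw [Real.norm_of_nonneg (by positivity), mul_assoc, neg_mul, one_div_mul_eq_div]
  calc ℓ u ^ 2 * Real.exp (-‖u‖ ^ 2) ≤ (‖ℓ‖ * ‖u‖) ^ 2 * Real.exp (-‖u‖ ^ 2) := by
        rw [← sq_abs (ℓ u)]
        gcongr
        exact ℓ.le_opNorm u
    _ = ‖ℓ‖ ^ 2 * (‖u‖ ^ 2 * Real.exp (-‖u‖ ^ 2)) := by ring
    _ ≤ ‖ℓ‖ ^ 2 * (2 * Real.exp (-(‖u‖ ^ 2 / 2))) :=
        mul_le_mul_of_nonneg_left (sq_mul_exp_neg_sq_le _) (sq_nonneg _)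

theorem hasFDerivAt_exp_neg_sq_norm (u : EuclideanSpace ℝ (Fin d)) :
    HasFDerivAt (fun u => Real.exp (-‖u‖ ^ 2)) ((-2 * Real.exp (-‖u‖ ^ 2)) • innerSL ℝ u) u := by
  have h : HasFDerivAt (fun u => Real.exp (-‖u‖ ^ 2))
      (Real.exp (-‖u‖ ^ 2) • (-(2 • innerSL ℝ u) : EuclideanSpace ℝ (Fin d) →L[ℝ] ℝ)) u :=
    (hasStrictFDerivAt_norm_sq u).hasFDerivAt.neg.exp
  exact h.congr_fderiv (by module)

theorem integral_sq_mul_exp_neg_sq_norm (ℓ : EuclideanSpace ℝ (Fin d) →L[ℝ] ℝ) :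
    ∫ u : EuclideanSpace ℝ (Fin d), ℓ u ^ 2 * Real.exp (-‖u‖ ^ 2) =
      Real.pi ^ ((d : ℝ) / 2) / 2 * ‖ℓ‖ ^ 2 := by
  set a := (InnerProductSpace.toDual ℝ (EuclideanSpace ℝ (Fin d))).symm ℓ
  have hℓ : ∀ u, inner ℝ a u = ℓ u := fun u => InnerProductSpace.toDual_symm_apply
  have hℓa : ℓ a = ‖ℓ‖ ^ 2 := by
    rw [← hℓ, real_inner_self_eq_norm_sq, LinearIsometryEquiv.norm_map]
  have hexp : ∀ u : EuclideanSpace ℝ (Fin d),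
      fderiv ℝ (fun u => Real.exp (-‖u‖ ^ 2)) u a = -2 * (ℓ u * Real.exp (-‖u‖ ^ 2)) := fun u => by
    rw [(hasFDerivAt_exp_neg_sq_norm u).fderiv, ← hℓ, real_inner_comm]
    simp only [smul_apply, innerSL_apply_apply, smul_eq_mul]
    ring
  have hgauss := integrable_exp_neg_mul_sq_norm d one_pos
  simp only [neg_mul, one_mul] at hgauss
  have hsq := integrable_sq_mul_exp_neg_sq_norm ℓ
  have hlin : Integrable fun u => ℓ u * Real.exp (-‖u‖ ^ 2) := by
    refine (hgauss.add hsq).mono' (by fun_prop) (.of_forall fun u => ?_)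
    rw [norm_mul, Real.norm_eq_abs, Real.norm_of_nonneg (Real.exp_pos _).le, Pi.add_apply,
      ← one_add_mul]
    gcongr
    nlinarith [sq_nonneg (|ℓ u| - 1), abs_nonneg (ℓ u), sq_abs (ℓ u)]
  have hparts := integral_mul_fderiv_eq_neg_fderiv_mul_of_integrable (μ := volume) (f := ℓ)
    (g := fun u : EuclideanSpace ℝ (Fin d) => Real.exp (-‖u‖ ^ 2)) (v := a)
    (by simpa [hℓa] using hgauss.const_mul (‖ℓ‖ ^ 2))
    (by simp_rw [hexp]; convert hsq.const_mul (-2) using 2; ring) hlin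
    (fun u _ => ℓ.differentiableAt) fun u _ => (hasFDerivAt_exp_neg_sq_norm u).differentiableAt
  simp_rw [hexp, ContinuousLinearMap.fderiv, hℓa, integral_const_mul, integral_exp_neg_sq_norm]
    at hparts
  have hrw : ∀ u, ℓ u * (-2 * (ℓ u * Real.exp (-‖u‖ ^ 2))) =
      -2 * (ℓ u ^ 2 * Real.exp (-‖u‖ ^ 2)) := fun u => by ring
  simp_rw [hrw, integral_const_mul] at hparts
  linarith

end EuclideanGaussian

section GaussianWeight

variable {N d : ℕ} {t : ℝ}

theorem gaussianWeight_nonneg (ht : 0 < t) (x y : EuclideanSpace ℝ (Fin N)) :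
    0 ≤ gaussianWeight d t x y := by
  unfold gaussianWeight
  positivity

theorem gaussianWeight_comm (x y : EuclideanSpace ℝ (Fin N)) :
    gaussianWeight d t x y = gaussianWeight d t y x := by
  rw [gaussianWeight, norm_sub_rev, gaussianWeight]

theorem gaussianWeight_le (ht : 0 < t) (x y : EuclideanSpace ℝ (Fin N)) :
    gaussianWeight d t x y ≤ 1 / t ^ ((d : ℝ) / 2) :=
  mul_le_of_le_one_right (by positivity) (Real.exp_le_one_iff.2 (neg_nonpos.2 (by positivity)))

theorem continuous_gaussianWeight (d : ℕ) (t : ℝ) :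
    Continuous fun z : EuclideanSpace ℝ (Fin N) × EuclideanSpace ℝ (Fin N) =>
      gaussianWeight d t z.1 z.2 := by
  unfold gaussianWeight
  fun_prop

theorem continuous_gaussianWeight_right (d : ℕ) (t : ℝ) (x : EuclideanSpace ℝ (Fin N)) :
    Continuous fun y => gaussianWeight d t x y := by
  unfold gaussianWeight
  fun_prop

theorem gaussianWeight_le_of_dist_le (ht : 0 < t) {L : ℝ} (hL : 0 < L)
    {x y : EuclideanSpace ℝ (Fin N)} {u v : EuclideanSpace ℝ (Fin d)}
    (h : dist u v ≤ L * dist x y) :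
    gaussianWeight d t x y ≤
      1 / t ^ ((d : ℝ) / 2) * Real.exp (-(L ^ 2)⁻¹ * ‖(√t)⁻¹ • (v - u)‖ ^ 2) := by
  rw [dist_eq_norm', dist_eq_norm] at h
  rw [gaussianWeight, norm_inv_sqrt_smul_sq ht, neg_mul, ← mul_div_assoc]
  gcongr
  rw [inv_mul_le_iff₀ (by positivity), ← mul_pow]
  gcongr

theorem exp_neg_one_div_le_gaussianWeight (ht : 0 < t) {x y : EuclideanSpace ℝ (Fin N)}
    (h : dist x y ≤ √t) : 1 / t ^ ((d : ℝ) / 2) * Real.exp (-1) ≤ gaussianWeight d t x y := by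
  rw [gaussianWeight]
  gcongr
  rw [div_le_one ht, ← Real.sq_sqrt ht.le, ← dist_eq_norm]
  gcongr

end GaussianWeight

section GaussianMass

variable {N d : ℕ} {M : Set (EuclideanSpace ℝ (Fin N))}

theorem IsBilipschitzOn.lintegral_gaussianWeight_le {K : ℝ≥0}
    {σ : EuclideanSpace ℝ (Fin d) → EuclideanSpace ℝ (Fin N)} {S : Set (EuclideanSpace ℝ (Fin d))}
    (h : IsBilipschitzOn K σ S) (hS : IsCompact S) {t : ℝ} (ht : 0 < t)
    (x : EuclideanSpace ℝ (Fin N)) :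
    ∫⁻ y in σ '' S, ENNReal.ofReal (gaussianWeight d t x y) ∂Measure.euclideanHausdorffMeasure d ≤
      (K : ℝ≥0∞) ^ d * ∫⁻ v : EuclideanSpace ℝ (Fin d),
        ENNReal.ofReal (Real.exp (-((2 * K + 1 : ℝ) ^ 2)⁻¹ * ‖v‖ ^ 2)) := by
  obtain rfl | hne := S.eq_empty_or_nonempty
  · simp
  have hcont := h.lipschitzOnWith.continuousOn
  obtain ⟨v₀, hv₀, hmin⟩ := hS.exists_isMinOn hne (f := fun v => dist (σ v) x) (by fun_prop)
  have hdist : ∀ v ∈ S, dist v₀ v ≤ (2 * K + 1) * dist x (σ v) := fun v hv => by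
    have hnearest : dist (σ v₀) x ≤ dist (σ v) x := hmin hv
    have htriangle := dist_triangle (σ v₀) x (σ v)
    have hbil := (h v₀ hv₀ v hv).2
    rw [dist_comm (σ v)] at hnearest
    nlinarith [K.coe_nonneg, dist_nonneg (x := x) (y := σ v)]
  refine (h.lintegral_image_le hS.measurableSet _).trans (mul_le_mul_right ?_ _)
  rw [← lintegral_comp_rescale ht v₀]
  refine (setLIntegral_mono' hS.measurableSet fun v hv => ?_).trans (setLIntegral_le_lintegral _ _)
  rw [← ENNReal.ofReal_mul (by positivity)]
  exact ENNReal.ofReal_le_ofReal (gaussianWeight_le_of_dist_le ht (by positivity) (hdist v hv))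

theorem IsSubmanifoldWithBoundary.exists_lintegral_gaussianWeight_le
    (hM : IsSubmanifoldWithBoundary d M) (hMc : IsCompact M) :
    ∃ C : ℝ≥0, ∀ t > 0, ∀ x,
      ∫⁻ y, ENNReal.ofReal (gaussianWeight d t x y) ∂riemannianVolume d M ≤ C := by
  refine hMc.induction_on (p := fun s => ∃ C : ℝ≥0, ∀ t > 0, ∀ x, ∫⁻ y in s,
    ENNReal.ofReal (gaussianWeight d t x y) ∂Measure.euclideanHausdorffMeasure d ≤ C)
    ⟨0, by simp⟩ ?_ ?_ ?_
  · rintro s s' hs ⟨C, hC⟩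
    exact ⟨C, fun t ht x => (lintegral_mono_set hs).trans (hC t ht x)⟩
  · rintro s s' ⟨C, hC⟩ ⟨C', hC'⟩
    refine ⟨C + C', fun t ht x => (lintegral_union_le _ _ _).trans ?_⟩
    rw [ENNReal.coe_add]
    exact add_le_add (hC t ht x) (hC' t ht x)
  · intro x₀ hx₀
    obtain ⟨K, σ, S, hpatch, hnhds⟩ := hM.exists_isConvexPatch hx₀
    have hfinite := (integrable_exp_neg_mul_sq_norm d
      (by positivity : 0 < ((2 * K + 1 : ℝ) ^ 2)⁻¹)).lintegral_lt_top
    refine ⟨_, hnhds, ((K : ℝ≥0∞) ^ d * ∫⁻ v : EuclideanSpace ℝ (Fin d),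
      ENNReal.ofReal (Real.exp (-((2 * K + 1 : ℝ) ^ 2)⁻¹ * ‖v‖ ^ 2))).toNNReal, fun t ht x => ?_⟩
    rw [ENNReal.coe_toNNReal (by finiteness)]
    exact hpatch.isBilipschitzOn.lintegral_gaussianWeight_le hpatch.isCompact ht x

theorem setLIntegral_const_image_homothety {t L c : ℝ} (ht : 0 < t) (hL : 0 < L) (hc : 0 ≤ c)
    (v : EuclideanSpace ℝ (Fin d)) (S : Set (EuclideanSpace ℝ (Fin d))) :
    ∫⁻ _ in AffineMap.homothety v (√t / L) '' S, ENNReal.ofReal (1 / t ^ ((d : ℝ) / 2) * c) =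
      ENNReal.ofReal (c / L ^ d) * volume S := by
  rw [setLIntegral_const, Measure.addHaar_image_homothety, ← mul_assoc,
    ← ENNReal.ofReal_mul (by positivity), finrank_euclideanSpace_fin,
    abs_of_nonneg (by positivity), div_pow, Real.sqrt_eq_rpow, ← Real.rpow_natCast (t ^ _),
    ← Real.rpow_mul ht.le, one_div_mul_eq_div 2 (d : ℝ)]
  field_simp

theorem IsConvexPatch.exists_le_lintegral_gaussianWeight {K : ℝ≥0}
    {σ : EuclideanSpace ℝ (Fin d) → EuclideanSpace ℝ (Fin N)} {S : Set (EuclideanSpace ℝ (Fin d))}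
    (h : IsConvexPatch M K σ S) :
    ∃ c : ℝ≥0∞, c ≠ 0 ∧ ∀ t ∈ Set.Ioc (0 : ℝ) 1, ∀ x ∈ σ '' S,
      c ≤ ∫⁻ y, ENNReal.ofReal (gaussianWeight d t x y) ∂riemannianVolume d M := by
  set L : ℝ := K * Metric.diam S + 1
  have hL : 1 ≤ L := le_add_of_nonneg_left (mul_nonneg K.2 Metric.diam_nonneg)
  refine ⟨ENNReal.ofReal (Real.exp (-1) / L ^ d) * volume S / (K : ℝ≥0∞) ^ d,
    (ENNReal.div_pos (mul_ne_zero ?_ h.volume_pos.ne') (by finiteness)).ne', ?_⟩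
  · exact (ENNReal.ofReal_pos.2 (by positivity)).ne'
  rintro t ⟨ht, ht1⟩ _ ⟨v, hv, rfl⟩
  have hsqrt : √t ≤ 1 := Real.sqrt_le_one.2 ht1
  have hratio0 : 0 < √t / L := by positivity
  set s := AffineMap.homothety v (√t / L) '' S
  have hsS : s ⊆ S := by
    rintro _ ⟨u, hu, rfl⟩
    rw [AffineMap.homothety_eq_lineMap]
    exact h.convex.lineMap_mem hv hu ⟨hratio0.le, div_le_one_of_le₀ (by linarith) (by positivity)⟩
  have hdist : ∀ u ∈ s, dist (σ v) (σ u) ≤ √t := by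
    rintro _ ⟨u, hu, rfl⟩
    have hdiam := Metric.dist_le_diam_of_mem h.isCompact.isBounded hv hu
    refine (h.isBilipschitzOn v hv _ (hsS ⟨u, hu, rfl⟩)).1.trans ?_
    rw [dist_center_homothety, Real.norm_of_nonneg hratio0.le]
    calc K * (√t / L * dist v u) = K * dist v u / L * √t := by ring
      _ ≤ 1 * √t := by
          gcongr
          rw [div_le_one (by positivity)]
          nlinarith [K.coe_nonneg]
      _ = √t := one_mul _
  have hscompact : IsCompact s := h.isCompact.image (AffineMap.homothety_continuous v _)
  refine ENNReal.div_le_of_le_mul' ?_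
  calc _ ≤ ∫⁻ u in s, ENNReal.ofReal (gaussianWeight d t (σ v) (σ u)) := by
        rw [← setLIntegral_const_image_homothety ht (zero_lt_one.trans_le hL) (Real.exp_nonneg _)]
        exact setLIntegral_mono' hscompact.measurableSet fun u hu =>
          ENNReal.ofReal_le_ofReal (exp_neg_one_div_le_gaussianWeight ht (hdist u hu))
    _ ≤ _ := (h.isBilipschitzOn.mono hsS).lintegral_le_lintegral_image hscompact _
    _ ≤ _ := mul_le_mul_right
        (lintegral_mono_set ((Set.image_mono hsS).trans h.image_subset)) _

theorem IsSubmanifoldWithBoundary.exists_le_lintegral_gaussianWeight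
    (hM : IsSubmanifoldWithBoundary d M) (hMc : IsCompact M) :
    ∃ c : ℝ≥0, 0 < c ∧ ∀ t ∈ Set.Ioc (0 : ℝ) 1, ∀ x ∈ M,
      c ≤ ∫⁻ y, ENNReal.ofReal (gaussianWeight d t x y) ∂riemannianVolume d M := by
  suffices h : ∃ c : ℝ≥0∞, c ≠ 0 ∧ ∀ t ∈ Set.Ioc (0 : ℝ) 1, ∀ x ∈ M,
      c ≤ ∫⁻ y, ENNReal.ofReal (gaussianWeight d t x y) ∂riemannianVolume d M by
    obtain ⟨c, hc0, hc⟩ := h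
    obtain ⟨c', hc'0, hc'⟩ := ENNReal.lt_iff_exists_nnreal_btwn.1 (pos_iff_ne_zero.2 hc0)
    exact ⟨c', ENNReal.coe_pos.1 hc'0, fun t ht x hx => hc'.le.trans (hc t ht x hx)⟩
  refine hMc.induction_on (p := fun s => ∃ c : ℝ≥0∞, c ≠ 0 ∧ ∀ t ∈ Set.Ioc (0 : ℝ) 1, ∀ x ∈ s,
    c ≤ ∫⁻ y, ENNReal.ofReal (gaussianWeight d t x y) ∂riemannianVolume d M)
    ⟨1, by simp⟩ ?_ ?_ fun x hx => ?_
  · rintro s s' hs ⟨c, hc0, hc⟩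
    exact ⟨c, hc0, fun t ht x hx => hc t ht x (hs hx)⟩
  · rintro s s' ⟨c, hc0, hc⟩ ⟨c', hc'0, hc'⟩
    refine ⟨min c c', (lt_min (pos_iff_ne_zero.2 hc0) (pos_iff_ne_zero.2 hc'0)).ne',
      fun t ht x hx => ?_⟩
    rcases hx with hx | hx
    · exact (min_le_left _ _).trans (hc t ht x hx)
    · exact (min_le_right _ _).trans (hc' t ht x hx)
  · obtain ⟨K, σ, S, hpatch, hnhds⟩ := hM.exists_isConvexPatch hx
    exact ⟨_, hnhds, hpatch.exists_le_lintegral_gaussianWeight⟩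

end GaussianMass

/-! ### Blow-up at a point -/

/-- The profile `Φ` concentrated at scale `√t` around `x`, with the normalization of a kernel on a
`d`-dimensional space. The Gaussian weight is the case `Φ z = exp (-‖z‖²)`. -/
noncomputable def scaledProfile {N : ℕ} (d : ℕ) (Φ : EuclideanSpace ℝ (Fin N) → ℝ≥0∞) (t : ℝ)
    (x y : EuclideanSpace ℝ (Fin N)) : ℝ≥0∞ :=
  ENNReal.ofReal (1 / t ^ ((d : ℝ) / 2)) * Φ ((√t)⁻¹ • (y - x))

theorem tendsto_sqrt_nhdsGT_zero : Tendsto (fun t : ℝ => √t) (𝓝[>] 0) (𝓝[>] 0) := by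
  refine tendsto_nhdsWithin_iff.2 ⟨?_, eventually_mem_nhdsWithin.mono fun _ => Real.sqrt_pos.2⟩
  simpa using (Real.continuous_sqrt.tendsto 0).mono_left nhdsWithin_le_nhds

section BlowUp

variable {N d : ℕ} {M : Set (EuclideanSpace ℝ (Fin N))} {x : EuclideanSpace ℝ (Fin N)}
  {ι : EuclideanSpace ℝ (Fin d) →ₗᵢ[ℝ] EuclideanSpace ℝ (Fin N)}
  {σ : EuclideanSpace ℝ (Fin d) → EuclideanSpace ℝ (Fin N)}
  {Φ : EuclideanSpace ℝ (Fin N) → ℝ≥0∞} {C : ℝ≥0}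

namespace IsTangentParam

theorem tendsto_inv_sqrt_smul (h : IsTangentParam M x ι σ) (v : EuclideanSpace ℝ (Fin d)) :
    Tendsto (fun t : ℝ => (√t)⁻¹ • (σ (√t • v) - x)) (𝓝[>] 0) (𝓝 (ι v)) := by
  have hderiv : HasDerivAt (fun s : ℝ => σ (0 + s • v)) (ι v) 0 :=
    h.hasStrictFDerivAt.hasFDerivAt.hasLineDerivAt v
  simpa [Function.comp_def, h.apply_zero] using
    hderiv.tendsto_slope_zero_right.comp tendsto_sqrt_nhdsGT_zero

theorem exp_neg_sq_inv_sqrt_smul_le (h : IsTangentParam M x ι σ) {K : ℝ≥0} (hK : 0 < K)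
    {ρ : ℝ} (hρ : 0 ≤ ρ) (hbil : IsBilipschitzOn K σ (Metric.closedBall 0 ρ)) {t : ℝ} (ht : 0 < t)
    {v : EuclideanSpace ℝ (Fin d)} (hv : √t • v ∈ Metric.closedBall 0 ρ) :
    Real.exp (-(‖(√t)⁻¹ • (σ (√t • v) - x)‖ ^ 2 / 2)) ≤
      Real.exp (-(2 * (K : ℝ) ^ 2)⁻¹ * ‖v‖ ^ 2) := by
  have hle := (hbil _ hv 0 (Metric.mem_closedBall_self hρ)).2
  have hnorm : ‖v‖ ^ 2 ≤ (K : ℝ) ^ 2 * ‖(√t)⁻¹ • (σ (√t • v) - x)‖ ^ 2 := by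
    rw [h.apply_zero, dist_zero_right, dist_eq_norm] at hle
    rw [norm_inv_sqrt_smul_sq ht, ← mul_div_assoc, ← mul_pow,
      ← inv_smul_smul₀ (Real.sqrt_pos.2 ht).ne' v, norm_inv_sqrt_smul_sq ht,
      smul_inv_smul₀ (Real.sqrt_pos.2 ht).ne']
    gcongr
  rw [Real.exp_le_exp, neg_mul, neg_le_neg_iff, inv_mul_le_iff₀ (by positivity)]
  linarith

theorem tendsto_setLIntegral_scaledProfile (h : IsTangentParam M x ι σ) {K : ℝ≥0} (hK : 0 < K)
    {ρ : ℝ} (hρ : 0 < ρ) (hbil : IsBilipschitzOn K σ (Metric.closedBall 0 ρ))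
    (hΦ : Continuous Φ) (hΦC : ∀ z, Φ z ≤ C * ENNReal.ofReal (Real.exp (-(‖z‖ ^ 2 / 2)))) :
    Tendsto (fun t => ∫⁻ u in Metric.closedBall 0 ρ, scaledProfile d Φ t x (σ u)) (𝓝[>] 0)
      (𝓝 (∫⁻ v, Φ (ι v))) := by
  set B := Metric.closedBall (0 : EuclideanSpace ℝ (Fin d)) ρ
  have hBm : MeasurableSet B := Metric.isClosed_closedBall.measurableSet
  set F : ℝ → EuclideanSpace ℝ (Fin d) → ℝ≥0∞ := fun t v =>
    B.indicator (fun u => Φ ((√t)⁻¹ • (σ u - x))) (√t • v) with hF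
  have hsub : ∀ t > 0, ∫⁻ u in B, scaledProfile d Φ t x (σ u) = ∫⁻ v, F t v := fun t ht => by
    rw [← lintegral_comp_rescale ht 0, ← lintegral_indicator hBm]
    refine lintegral_congr fun u => ?_
    simp only [hF, sub_zero, smul_inv_smul₀ (Real.sqrt_pos.2 ht).ne', scaledProfile]
    exact Set.indicator_const_mul B _ _ u
  have hmeas : ∀ t, Measurable (F t) := fun t => by
    have hσ : ContinuousOn σ B := hbil.lipschitzOnWith.continuousOn
    have hcont : ContinuousOn (fun u => Φ ((√t)⁻¹ • (σ u - x))) B :=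
      hΦ.comp_continuousOn (by fun_prop)
    classical
    have hpiece := hcont.measurable_piecewise (g := 0) continuousOn_const hBm
    rw [Set.piecewise_eq_indicator] at hpiece
    exact hpiece.comp (measurable_const_smul √t)
  have hbound : ∀ t > 0, ∀ v,
      F t v ≤ C * ENNReal.ofReal (Real.exp (-(2 * (K : ℝ) ^ 2)⁻¹ * ‖v‖ ^ 2)) := fun t ht v =>
    Set.indicator_apply_le' (fun hv => (hΦC _).trans <| by
      gcongr C * ENNReal.ofReal ?_
      exact h.exp_neg_sq_inv_sqrt_smul_le hK hρ.le hbil ht hv) fun _ => zero_le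
  have hlim : ∀ v, Tendsto (fun t => F t v) (𝓝[>] 0) (𝓝 (Φ (ι v))) := fun v => by
    refine ((hΦ.tendsto _).comp (h.tendsto_inv_sqrt_smul v)).congr' ?_
    have hsmall : Tendsto (fun t : ℝ => √t • v) (𝓝[>] 0) (𝓝 0) := by
      simpa using (tendsto_sqrt_nhdsGT_zero.mono_right nhdsWithin_le_nhds).smul_const v
    filter_upwards [hsmall (Metric.closedBall_mem_nhds 0 hρ)] with t ht
    exact (Set.indicator_of_mem ht _).symm
  refine Tendsto.congr' (eventually_mem_nhdsWithin.mono fun t ht => (hsub t ht).symm)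
    (tendsto_lintegral_filter_of_dominated_convergence (l := 𝓝[>] (0 : ℝ)) _ (.of_forall hmeas)
      (eventually_mem_nhdsWithin.mono fun t ht => .of_forall (hbound t ht)) ?_ (.of_forall hlim))
  rw [lintegral_const_mul' _ _ ENNReal.coe_ne_top]
  exact (ENNReal.mul_lt_top ENNReal.coe_lt_top (integrable_exp_neg_mul_sq_norm d
    (by positivity)).lintegral_lt_top).ne

end IsTangentParam

theorem scaledProfile_le_of_le_dist
    (hΦC : ∀ z, Φ z ≤ C * ENNReal.ofReal (Real.exp (-(‖z‖ ^ 2 / 2)))) {t r : ℝ} (ht : 0 < t)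
    (hr : 0 ≤ r) {y : EuclideanSpace ℝ (Fin N)} (hy : r ≤ dist y x) :
    scaledProfile d Φ t x y ≤
      C * ENNReal.ofReal (1 / t ^ ((d : ℝ) / 2) * Real.exp (-(r ^ 2 / 2 / t))) := by
  rw [ENNReal.ofReal_mul (by positivity), mul_left_comm, scaledProfile]
  gcongr
  refine (hΦC _).trans ?_
  rw [norm_inv_sqrt_smul_sq ht, div_right_comm, ← dist_eq_norm]
  gcongr

theorem tendsto_setLIntegral_scaledProfile_diff
    (hMfin : Measure.euclideanHausdorffMeasure d M < ⊤)
    (hΦC : ∀ z, Φ z ≤ C * ENNReal.ofReal (Real.exp (-(‖z‖ ^ 2 / 2))))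
    {T : Set (EuclideanSpace ℝ (Fin N))} (hT : T ∈ 𝓝[M] x) (hTm : MeasurableSet (M \ T)) :
    Tendsto (fun t => ∫⁻ y in M \ T, scaledProfile d Φ t x y ∂Measure.euclideanHausdorffMeasure d)
      (𝓝[>] 0) (𝓝 0) := by
  obtain ⟨r, hr, hball⟩ := Metric.mem_nhdsWithin_iff.1 hT
  have hdecay : Tendsto (fun t : ℝ => C * ENNReal.ofReal (1 / t ^ ((d : ℝ) / 2) *
      Real.exp (-(r ^ 2 / 2 / t))) * Measure.euclideanHausdorffMeasure d M) (𝓝[>] 0) (𝓝 0) := by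
    have hexp := ENNReal.tendsto_ofReal (tendsto_one_div_rpow_mul_exp ((d : ℝ) / 2)
      (by positivity : 0 < r ^ 2 / 2))
    simpa using ENNReal.Tendsto.mul_const
      (ENNReal.Tendsto.const_mul hexp (.inr ENNReal.coe_ne_top)) (.inr hMfin.ne)
  refine tendsto_of_tendsto_of_tendsto_of_le_of_le' tendsto_const_nhds hdecay
    (.of_forall fun _ => zero_le) (eventually_mem_nhdsWithin.mono fun t ht => ?_)
  calc ∫⁻ y in M \ T, scaledProfile d Φ t x y ∂Measure.euclideanHausdorffMeasure d
      ≤ ∫⁻ _ in M \ T, C * ENNReal.ofReal (1 / t ^ ((d : ℝ) / 2) *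
          Real.exp (-(r ^ 2 / 2 / t))) ∂Measure.euclideanHausdorffMeasure d :=
        setLIntegral_mono' hTm fun y hy => scaledProfile_le_of_le_dist hΦC ht hr.le
          (not_lt.1 fun hlt => hy.2 (hball ⟨hlt, hy.1⟩))
    _ ≤ _ := by
        rw [setLIntegral_const]
        gcongr
        exact Set.sdiff_subset

theorem tendsto_coe_pow_mul (d : ℕ) {a : ℝ≥0∞} (ha : a ≠ ⊤) :
    Tendsto (fun K : ℝ≥0 => (K : ℝ≥0∞) ^ d * a) (𝓝[>] 1) (𝓝 a) := by
  have hcont : Continuous fun K : ℝ≥0 => (K : ℝ≥0∞) ^ d :=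
    (ENNReal.continuous_pow d).comp ENNReal.continuous_coe
  simpa using ENNReal.Tendsto.mul_const ((hcont.tendsto 1).mono_left nhdsWithin_le_nhds) (.inr ha)

namespace IsTangentParam

theorem exists_isBilipschitzOn_closedBall (h : IsTangentParam M x ι σ) {K : ℝ≥0} (hK : 1 < K) :
    ∃ ρ > 0, IsBilipschitzOn K σ (Metric.closedBall 0 ρ) ∧ σ '' Metric.closedBall 0 ρ ⊆ M := by
  obtain ⟨r, hr, hmem⟩ := Metric.eventually_nhds_iff_ball.1 h.eventually_mem
  obtain ⟨ρ, ⟨hbil, hρr⟩, hρ⟩ := (((h.eventually_isBilipschitzOn hK).and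
    ((eventually_lt_nhds hr).filter_mono nhdsWithin_le_nhds)).and eventually_mem_nhdsWithin).exists
  exact ⟨ρ, hρ, hbil, Set.image_subset_iff.2 fun u hu =>
    hmem u (Metric.closedBall_subset_ball hρr hu)⟩

theorem tendsto_lintegral_scaledProfile (h : IsTangentParam M x ι σ) (hMm : MeasurableSet M)
    (hMfin : Measure.euclideanHausdorffMeasure d M < ⊤) (hΦ : Continuous Φ)
    (hΦC : ∀ z, Φ z ≤ C * ENNReal.ofReal (Real.exp (-(‖z‖ ^ 2 / 2)))) :
    Tendsto (fun t => ∫⁻ y, scaledProfile d Φ t x y ∂riemannianVolume d M) (𝓝[>] 0)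
      (𝓝 (∫⁻ v, Φ (ι v))) := by
  refine tendsto_order.2 ⟨fun c hc => ?_, fun c hc => ?_⟩
  · obtain ⟨K, hKc, hK⟩ := (((tendsto_coe_pow_mul d hc.ne_top).eventually_lt_const hc).and
      eventually_mem_nhdsWithin).exists
    obtain ⟨ρ, hρ, hbil, hsub⟩ := h.exists_isBilipschitzOn_closedBall hK
    filter_upwards [(h.tendsto_setLIntegral_scaledProfile (zero_lt_one.trans hK) hρ hbil hΦ
      hΦC).eventually_const_lt hKc] with t ht
    refine lt_of_mul_lt_mul_left' (ht.trans_le ((hbil.lintegral_le_lintegral_image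
      (isCompact_closedBall 0 ρ) _).trans ?_))
    gcongr
    exact Measure.restrict_mono_set _ hsub
  · obtain ⟨K, hKc, hK⟩ := (((tendsto_coe_pow_mul d hc.ne_top).eventually_lt_const hc).and
      eventually_mem_nhdsWithin).exists
    obtain ⟨ρ, hρ, hbil, -⟩ := h.exists_isBilipschitzOn_closedBall hK
    set T := σ '' Metric.closedBall 0 ρ
    have hT : T ∈ 𝓝[M] x := h.image_mem_nhdsWithin (Metric.closedBall_mem_nhds 0 hρ)
    have hTm : MeasurableSet T := ((isCompact_closedBall 0 ρ).image_of_continuousOn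
      hbil.lipschitzOnWith.continuousOn).measurableSet
    have hKd : (K : ℝ≥0∞) ^ d ≠ ⊤ := ENNReal.pow_ne_top ENNReal.coe_ne_top
    have hupper := (ENNReal.Tendsto.const_mul (h.tendsto_setLIntegral_scaledProfile
      (zero_lt_one.trans hK) hρ hbil hΦ hΦC) (.inr hKd)).add
        (tendsto_setLIntegral_scaledProfile_diff hMfin hΦC hT (hMm.diff hTm))
    rw [add_zero] at hupper
    filter_upwards [hupper.eventually_lt_const hKc] with t ht
    calc ∫⁻ y, scaledProfile d Φ t x y ∂riemannianVolume d M
        ≤ ∫⁻ y in T ∪ M \ T, scaledProfile d Φ t x y ∂Measure.euclideanHausdorffMeasure d :=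
          lintegral_mono_set fun y hy => (em (y ∈ T)).imp id fun hyT => ⟨hy, hyT⟩
      _ ≤ _ := (lintegral_union_le _ _ _).trans
          (add_le_add_left (hbil.lintegral_image_le Metric.isClosed_closedBall.measurableSet _) _)
      _ < c := ht

end IsTangentParam

end BlowUp

section LocalLimits

variable {N d : ℕ} {M : Set (EuclideanSpace ℝ (Fin N))} {x : EuclideanSpace ℝ (Fin N)}
  {ι : EuclideanSpace ℝ (Fin d) →ₗᵢ[ℝ] EuclideanSpace ℝ (Fin N)}
  {σ : EuclideanSpace ℝ (Fin d) → EuclideanSpace ℝ (Fin N)}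

theorem ofReal_gaussianWeight_mul {t : ℝ} (ht : 0 < t) (x y : EuclideanSpace ℝ (Fin N))
    (ψ : EuclideanSpace ℝ (Fin N) → ℝ) :
    ENNReal.ofReal (gaussianWeight d t x y * ψ ((√t)⁻¹ • (y - x))) =
      scaledProfile d (fun z => ENNReal.ofReal (ψ z * Real.exp (-‖z‖ ^ 2))) t x y := by
  rw [scaledProfile, ← ENNReal.ofReal_mul (by positivity), norm_inv_sqrt_smul_sq ht,
    gaussianWeight, norm_sub_rev, mul_comm (ψ _), mul_assoc]

theorem gaussianWeight_mul_sq_dist_div_le {t : ℝ} (ht : 0 < t) (x y : EuclideanSpace ℝ (Fin N)) :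
    gaussianWeight d t x y * (‖x - y‖ ^ 2 / t) ≤
      2 * 2 ^ ((d : ℝ) / 2) * gaussianWeight d (2 * t) x y := by
  have hle := sq_mul_exp_neg_sq_le (‖x - y‖ / √t)
  rw [div_pow, Real.sq_sqrt ht.le, div_div, mul_comm t 2] at hle
  rw [gaussianWeight, gaussianWeight, Real.mul_rpow two_pos.le ht.le]
  calc 1 / t ^ ((d : ℝ) / 2) * Real.exp (-(‖x - y‖ ^ 2 / t)) * (‖x - y‖ ^ 2 / t)
      = 1 / t ^ ((d : ℝ) / 2) * (‖x - y‖ ^ 2 / t * Real.exp (-(‖x - y‖ ^ 2 / t))) := by ring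
    _ ≤ 1 / t ^ ((d : ℝ) / 2) * (2 * Real.exp (-(‖x - y‖ ^ 2 / (2 * t)))) := by gcongr
    _ = _ := by field_simp

theorem gaussianWeight_mul_sq_dist_div_le_rpow {t : ℝ} (ht : 0 < t)
    (x y : EuclideanSpace ℝ (Fin N)) :
    gaussianWeight d t x y * (‖x - y‖ ^ 2 / t) ≤ 2 * (1 / t ^ ((d : ℝ) / 2)) := by
  refine (gaussianWeight_mul_sq_dist_div_le ht x y).trans ?_
  calc 2 * 2 ^ ((d : ℝ) / 2) * gaussianWeight d (2 * t) x y
      ≤ 2 * 2 ^ ((d : ℝ) / 2) * (1 / (2 * t) ^ ((d : ℝ) / 2)) := by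
        gcongr
        exact gaussianWeight_le (by positivity) x y
    _ = _ := by
        rw [Real.mul_rpow two_pos.le ht.le]
        field_simp

theorem tendstoUniformlyOn_mul_gaussianWeight (d : ℕ) {c : ℝ} (hc : 0 ≤ c)
    {u : Set (EuclideanSpace ℝ (Fin N))} (hu : u ∈ 𝓝 x) :
    TendstoUniformlyOn (fun t y => c * gaussianWeight d t x y) 0 (𝓝[>] 0) uᶜ := by
  obtain ⟨r, hr, hball⟩ := Metric.mem_nhds_iff.1 hu
  refine Metric.tendstoUniformlyOn_iff.2 fun ε hε => ?_
  have hdecay := (tendsto_one_div_rpow_mul_exp ((d : ℝ) / 2)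
    (by positivity : 0 < r ^ 2)).const_mul c
  rw [mul_zero] at hdecay
  filter_upwards [hdecay.eventually_lt_const hε, self_mem_nhdsWithin] with t hlt ht y hy
  have ht' : (0 : ℝ) < t := ht
  have hry : r ≤ ‖x - y‖ := by
    rw [← dist_eq_norm']
    exact not_lt.1 fun hlt => hy (hball hlt)
  rw [Pi.zero_apply, dist_zero_left, Real.norm_of_nonneg
    (mul_nonneg hc (gaussianWeight_nonneg ht x y))]
  refine lt_of_le_of_lt ?_ hlt
  rw [gaussianWeight]
  gcongr

namespace IsTangentParam

theorem tendsto_integral_gaussianWeight_mul_profile (h : IsTangentParam M x ι σ)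
    (hMm : MeasurableSet M) (hMfin : Measure.euclideanHausdorffMeasure d M < ⊤)
    {ψ : EuclideanSpace ℝ (Fin N) → ℝ} (hψ : Continuous ψ) (hψ0 : ∀ z, 0 ≤ ψ z) {C : ℝ≥0}
    (hψC : ∀ z, ψ z * Real.exp (-‖z‖ ^ 2) ≤ C * Real.exp (-(‖z‖ ^ 2 / 2))) :
    Tendsto (fun t => ∫ y, gaussianWeight d t x y * ψ ((√t)⁻¹ • (y - x)) ∂riemannianVolume d M)
      (𝓝[>] 0) (𝓝 (∫ v, ψ (ι v) * Real.exp (-‖v‖ ^ 2))) := by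
  set Φ : EuclideanSpace ℝ (Fin N) → ℝ≥0∞ := fun z => ENNReal.ofReal (ψ z * Real.exp (-‖z‖ ^ 2))
  have hΦC : ∀ z, Φ z ≤ C * ENNReal.ofReal (Real.exp (-(‖z‖ ^ 2 / 2))) := fun z => by
    have hle := ENNReal.ofReal_le_ofReal (hψC z)
    rwa [ENNReal.ofReal_mul C.coe_nonneg, ENNReal.ofReal_coe_nnreal] at hle
  have hfin : ∫⁻ v, Φ (ι v) ≠ ⊤ := by
    refine ne_top_of_le_ne_top ?_ (lintegral_mono fun v => hΦC (ι v))
    simp only [ι.norm_map]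
    rw [lintegral_const_mul' _ _ ENNReal.coe_ne_top]
    have hint := integrable_exp_neg_mul_sq_norm d one_half_pos
    simp only [neg_mul, one_div_mul_eq_div] at hint
    exact (ENNReal.mul_lt_top ENNReal.coe_lt_top hint.lintegral_lt_top).ne
  have hlim := (ENNReal.tendsto_toReal hfin).comp (h.tendsto_lintegral_scaledProfile hMm hMfin
    (ENNReal.continuous_ofReal.comp (by fun_prop)) hΦC)
  have hvalue : (∫⁻ v, Φ (ι v)).toReal = ∫ v, ψ (ι v) * Real.exp (-‖v‖ ^ 2) := by
    rw [integral_eq_lintegral_of_nonneg_ae (.of_forall fun v => mul_nonneg (hψ0 _) (by positivity))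
      (by have := ι.continuous; fun_prop)]
    simp only [Φ, ι.norm_map]
  rw [← hvalue]
  refine hlim.congr' (eventually_mem_nhdsWithin.mono fun t ht => ?_)
  dsimp only [Function.comp_apply]
  rw [integral_eq_lintegral_of_nonneg_ae
    (.of_forall fun y => mul_nonneg (gaussianWeight_nonneg ht x y) (hψ0 _))
    (by have := continuous_gaussianWeight_right d t x; fun_prop)]
  simp only [ofReal_gaussianWeight_mul (d := d) ht, Φ]

theorem tendsto_integral_gaussianWeight (h : IsTangentParam M x ι σ)
    (hMm : MeasurableSet M) (hMfin : Measure.euclideanHausdorffMeasure d M < ⊤) :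
    Tendsto (fun t => ∫ y, gaussianWeight d t x y ∂riemannianVolume d M) (𝓝[>] 0)
      (𝓝 (Real.pi ^ ((d : ℝ) / 2))) := by
  simpa [integral_exp_neg_sq_norm] using h.tendsto_integral_gaussianWeight_mul_profile hMm hMfin
    (ψ := fun _ => 1) (C := 1) continuous_const (fun _ => zero_le_one) fun z => by
      simp only [one_mul, NNReal.coe_one, Real.exp_le_exp]
      linarith [sq_nonneg ‖z‖]

theorem tendsto_integral_gaussianWeight_mul_sq (h : IsTangentParam M x ι σ)
    (hMm : MeasurableSet M) (hMfin : Measure.euclideanHausdorffMeasure d M < ⊤)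
    (ℓ : EuclideanSpace ℝ (Fin N) →L[ℝ] ℝ) :
    Tendsto (fun t => ∫ y, gaussianWeight d t x y * (ℓ (y - x) ^ 2 / t) ∂riemannianVolume d M)
      (𝓝[>] 0) (𝓝 (Real.pi ^ ((d : ℝ) / 2) / 2 * ‖ℓ.comp ι.toContinuousLinearMap‖ ^ 2)) := by
  have hbound : ∀ z, ℓ z ^ 2 * Real.exp (-‖z‖ ^ 2) ≤
      (2 * ‖ℓ‖₊ ^ 2 : ℝ≥0) * Real.exp (-(‖z‖ ^ 2 / 2)) := fun z => by
    calc ℓ z ^ 2 * Real.exp (-‖z‖ ^ 2) ≤ (‖ℓ‖ * ‖z‖) ^ 2 * Real.exp (-‖z‖ ^ 2) := by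
          gcongr ?_ * _
          exact sq_le_sq' (neg_le_of_abs_le (ℓ.le_opNorm z)) (le_of_abs_le (ℓ.le_opNorm z))
      _ = ‖ℓ‖ ^ 2 * (‖z‖ ^ 2 * Real.exp (-‖z‖ ^ 2)) := by ring
      _ ≤ ‖ℓ‖ ^ 2 * (2 * Real.exp (-(‖z‖ ^ 2 / 2))) :=
        mul_le_mul_of_nonneg_left (sq_mul_exp_neg_sq_le _) (sq_nonneg _)
      _ = _ := by push_cast; ring
  rw [← integral_sq_mul_exp_neg_sq_norm]
  refine (h.tendsto_integral_gaussianWeight_mul_profile hMm hMfin (ψ := fun z => ℓ z ^ 2)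
    (by fun_prop) (fun _ => sq_nonneg _) hbound).congr'
      (eventually_mem_nhdsWithin.mono fun t ht => ?_)
  simp only [map_smul, smul_eq_mul, inv_mul_eq_div, div_pow, Real.sq_sqrt (le_of_lt ht)]

theorem tendsto_integral_gaussianWeight_mul (h : IsTangentParam M x ι σ)
    (hMm : MeasurableSet M) (hMfin : Measure.euclideanHausdorffMeasure d M < ⊤)
    {g : EuclideanSpace ℝ (Fin N) → ℝ} (hg : Integrable g (riemannianVolume d M)) {a : ℝ}
    (hga : Tendsto g (𝓝[M] x) (𝓝 a)) :
    Tendsto (fun t => ∫ y, gaussianWeight d t x y * g y ∂riemannianVolume d M)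
      (𝓝[>] 0) (𝓝 (Real.pi ^ ((d : ℝ) / 2) * a)) := by
  set c := Real.pi ^ ((d : ℝ) / 2)
  have hc : 0 < c := by positivity
  have hmass : Tendsto (fun t => ∫ y in M, c⁻¹ * gaussianWeight d t x y
      ∂Measure.euclideanHausdorffMeasure d) (𝓝[>] 0) (𝓝 1) := by
    have hlim := (h.tendsto_integral_gaussianWeight hMm hMfin).const_mul c⁻¹
    rw [inv_mul_cancel₀ hc.ne'] at hlim
    simpa only [integral_const_mul, riemannianVolume] using hlim
  have hpeak := tendsto_setIntegral_peak_smul_of_integrableOn_of_tendsto hMm hMm subset_rfl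
    self_mem_nhdsWithin hMfin.ne (eventually_mem_nhdsWithin.mono fun t ht y _ =>
      mul_nonneg (inv_nonneg.2 hc.le) (gaussianWeight_nonneg ht x y))
    (fun u hu hxu => (tendstoUniformlyOn_mul_gaussianWeight d (inv_pos.2 hc).le
      (hu.mem_nhds hxu)).mono (Set.sdiff_subset_compl _ _)) hmass
    (.of_forall fun t => (continuous_gaussianWeight_right d t x).aestronglyMeasurable.const_mul _)
    hg hga
  refine (hpeak.const_mul c).congr fun t => ?_
  simp only [smul_eq_mul, mul_assoc, integral_const_mul, mul_inv_cancel_left₀ hc.ne']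
  rfl

theorem tendsto_integral_gaussianWeight_mul_sq_dist (h : IsTangentParam M x ι σ)
    (hMm : MeasurableSet M) (hMfin : Measure.euclideanHausdorffMeasure d M < ⊤)
    {g : EuclideanSpace ℝ (Fin N) → ℝ} (hg : Integrable g (riemannianVolume d M))
    (hg0 : Tendsto g (𝓝[M] x) (𝓝 0)) :
    Tendsto (fun t => ∫ y, gaussianWeight d t x y * (‖x - y‖ ^ 2 / t) * g y ∂riemannianVolume d M)
      (𝓝[>] 0) (𝓝 0) := by
  have hdouble : Tendsto (fun t : ℝ => 2 * t) (𝓝[>] 0) (𝓝[>] 0) := by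
    refine tendsto_nhdsWithin_iff.2 ⟨?_, eventually_mem_nhdsWithin.mono fun t ht =>
      mul_pos two_pos (Set.mem_Ioi.1 ht)⟩
    exact (Continuous.tendsto' (by fun_prop) 0 0 (mul_zero 2)).mono_left nhdsWithin_le_nhds
  have hmajor := ((h.tendsto_integral_gaussianWeight_mul hMm hMfin hg.abs
    (abs_zero (α := ℝ) ▸ hg0.abs)).comp hdouble).const_mul (2 * 2 ^ ((d : ℝ) / 2))
  rw [mul_zero, mul_zero] at hmajor
  refine squeeze_zero_norm' (eventually_mem_nhdsWithin.mono fun t ht => ?_) hmajor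
  have ht' : (0 : ℝ) < t := ht
  rw [Function.comp_apply, ← integral_const_mul]
  refine norm_integral_le_of_norm_le ?_ (.of_forall fun y => ?_)
  · refine (hg.abs.bdd_mul (c := 1 / (2 * t) ^ ((d : ℝ) / 2)) (continuous_gaussianWeight_right d
      (2 * t) x).aestronglyMeasurable (.of_forall fun y => ?_)).const_mul _
    rw [Real.norm_of_nonneg (gaussianWeight_nonneg (by positivity) x y)]
    exact gaussianWeight_le (by positivity) x y
  · rw [norm_mul, ← mul_assoc, Real.norm_eq_abs (g y), Real.norm_of_nonneg
      (mul_nonneg (gaussianWeight_nonneg ht x y) (by positivity))]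
    exact mul_le_mul_of_nonneg_right (gaussianWeight_mul_sq_dist_div_le ht x y) (abs_nonneg _)

end IsTangentParam

end LocalLimits

/-! ### The edge energy -/

/-- The edge energy `w_t(x, y) (f x - f y)² / (2 t)`. Its average over a sample is the normalized
graph Laplacian regularizer of the unnormalized weights. -/
noncomputable def energyKernel {N : ℕ} (d : ℕ) (t : ℝ) (f : EuclideanSpace ℝ (Fin N) → ℝ)
    (x y : EuclideanSpace ℝ (Fin N)) : ℝ :=
  gaussianWeight d t x y * (f x - f y) ^ 2 / (2 * t)

section EnergyKernel

variable {N d : ℕ} {f g : EuclideanSpace ℝ (Fin N) → ℝ} {K : ℝ≥0} {t : ℝ}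

theorem energyKernel_nonneg (ht : 0 < t) (f : EuclideanSpace ℝ (Fin N) → ℝ)
    (x y : EuclideanSpace ℝ (Fin N)) : 0 ≤ energyKernel d t f x y :=
  div_nonneg (mul_nonneg (gaussianWeight_nonneg ht x y) (sq_nonneg _)) (by positivity)

theorem energyKernel_comm (f : EuclideanSpace ℝ (Fin N) → ℝ) (x y : EuclideanSpace ℝ (Fin N)) :
    energyKernel d t f x y = energyKernel d t f y x := by
  rw [energyKernel, gaussianWeight_comm, ← neg_sub (f y), neg_sq, energyKernel]

theorem continuous_energyKernel (d : ℕ) (t : ℝ) (hf : Continuous f) :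
    Continuous fun z : EuclideanSpace ℝ (Fin N) × EuclideanSpace ℝ (Fin N) =>
      energyKernel d t f z.1 z.2 :=
  ((continuous_gaussianWeight d t).mul (by fun_prop)).div_const _

theorem energyKernel_le_mul_sq_dist (hf : LipschitzWith K f) (ht : 0 < t)
    (x y : EuclideanSpace ℝ (Fin N)) :
    energyKernel d t f x y ≤ (K : ℝ) ^ 2 / 2 * (gaussianWeight d t x y * (‖x - y‖ ^ 2 / t)) := by
  have hlip : |f x - f y| ≤ K * ‖x - y‖ := hf.norm_sub_le x y
  have hweight := gaussianWeight_nonneg (d := d) ht x y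
  calc energyKernel d t f x y
      ≤ gaussianWeight d t x y * ((K : ℝ) * ‖x - y‖) ^ 2 / (2 * t) := by
        rw [energyKernel, ← sq_abs]
        gcongr
    _ = _ := by field_simp

theorem energyKernel_le (hf : LipschitzWith K f) (ht : 0 < t) (x y : EuclideanSpace ℝ (Fin N)) :
    energyKernel d t f x y ≤ (K : ℝ) ^ 2 * 2 ^ ((d : ℝ) / 2) * gaussianWeight d (2 * t) x y := by
  linarith [energyKernel_le_mul_sq_dist (d := d) hf ht x y, mul_le_mul_of_nonneg_left
    (gaussianWeight_mul_sq_dist_div_le (d := d) ht x y) (by positivity : 0 ≤ (K : ℝ) ^ 2 / 2)]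

theorem energyKernel_le_rpow (hf : LipschitzWith K f) (ht : 0 < t)
    (x y : EuclideanSpace ℝ (Fin N)) :
    energyKernel d t f x y ≤ (K : ℝ) ^ 2 * (1 / t ^ ((d : ℝ) / 2)) := by
  linarith [energyKernel_le_mul_sq_dist (d := d) hf ht x y, mul_le_mul_of_nonneg_left
    (gaussianWeight_mul_sq_dist_div_le_rpow (d := d) ht x y) (by positivity : 0 ≤ (K : ℝ) ^ 2 / 2)]

end EnergyKernel

section LocalEnergy

variable {N d : ℕ} {M : Set (EuclideanSpace ℝ (Fin N))} {x : EuclideanSpace ℝ (Fin N)}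
  {ι : EuclideanSpace ℝ (Fin d) →ₗᵢ[ℝ] EuclideanSpace ℝ (Fin N)}
  {σ : EuclideanSpace ℝ (Fin d) → EuclideanSpace ℝ (Fin N)} {f g : EuclideanSpace ℝ (Fin N) → ℝ}

theorem norm_gradientOn (M : Set (EuclideanSpace ℝ (Fin N))) (f : EuclideanSpace ℝ (Fin N) → ℝ)
    (x : EuclideanSpace ℝ (Fin N)) :
    ‖gradientOn M f x‖ = ‖(fderivWithin ℝ f M x).comp (tangentSpace M x).subtypeL‖ :=
  LinearIsometryEquiv.norm_map _ _

theorem IsTangentParam.norm_comp_eq (h : IsTangentParam M x ι σ) :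
    ‖(fderivWithin ℝ f M x).comp ι.toContinuousLinearMap‖ = ‖gradientOn M f x‖ := by
  rw [norm_gradientOn, ← h.range_eq]
  exact ContinuousLinearMap.opNorm_comp_linearIsometryEquiv
    ((fderivWithin ℝ f M x).comp (LinearMap.range ι.toLinearMap).subtypeL) ι.equivRange

/-- The error, relative to `‖x - y‖²`, of replacing `(f x - f y)² g y` by its leading term
`ℓ(y - x)² g x` at `x`, where `ℓ` is meant to be the derivative of `f`. -/
noncomputable def energyRemainder (f g : EuclideanSpace ℝ (Fin N) → ℝ)
    (ℓ : EuclideanSpace ℝ (Fin N) →L[ℝ] ℝ) (x y : EuclideanSpace ℝ (Fin N)) : ℝ :=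
  ((f x - f y) ^ 2 * g y - ℓ (y - x) ^ 2 * g x) / ‖x - y‖ ^ 2

theorem tendsto_energyRemainder {ℓ : EuclideanSpace ℝ (Fin N) →L[ℝ] ℝ}
    (hf : HasFDerivWithinAt f ℓ M x) (hg : ContinuousWithinAt g M x) :
    Tendsto (energyRemainder f g ℓ x) (𝓝[M] x) (𝓝 0) := by
  have hℓ : (fun y => ℓ (y - x)) =O[𝓝[M] x] fun y => y - x := ℓ.isBigO_comp _ _
  have hdiff : (fun y => f y - f x) =O[𝓝[M] x] fun y => y - x := hf.isBigO_sub
  have hsq : (fun y => (f y - f x - ℓ (y - x)) * (f y - f x + ℓ (y - x))) =o[𝓝[M] x]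
      fun y => ‖y - x‖ * ‖y - x‖ := hf.isLittleO.norm_right.mul_isBigO (hdiff.add hℓ).norm_right
  have hg0 : (fun y => g y - g x) =o[𝓝[M] x] fun _ => (1 : ℝ) :=
    (Asymptotics.isLittleO_one_iff ℝ).2 (by simpa using hg.sub_const (g x))
  have hsum := (hsq.mul_isBigO (hg.isBigO_one ℝ)).add
    ((hℓ.norm_right.mul hℓ.norm_right).mul_isLittleO hg0)
  simp only [mul_one] at hsum
  refine hsum.tendsto_div_nhds_zero.congr fun y => ?_
  rw [energyRemainder, norm_sub_rev]
  ring

theorem integrable_energyRemainder {μ : Measure (EuclideanSpace ℝ (Fin N))} [IsFiniteMeasure μ]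
    {K : ℝ≥0} (hf : LipschitzWith K f) (hg : Integrable g μ)
    (ℓ : EuclideanSpace ℝ (Fin N) →L[ℝ] ℝ) (x : EuclideanSpace ℝ (Fin N)) :
    Integrable (energyRemainder f g ℓ x) μ := by
  have hfc := hf.continuous
  refine ((hg.abs.const_mul ((K : ℝ) ^ 2)).add
    (integrable_const (‖ℓ‖ ^ 2 * |g x|))).mono' ?_ (.of_forall fun y => ?_)
  · have hgm := hg.aestronglyMeasurable
    refine AEStronglyMeasurable.div₀ ?_ (by fun_prop)
    fun_prop
  · have hfy : |f x - f y| ≤ K * ‖x - y‖ := hf.norm_sub_le x y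
    have hℓy : |ℓ (y - x)| ≤ ‖ℓ‖ * ‖x - y‖ := norm_sub_rev y x ▸ ℓ.le_opNorm (y - x)
    rw [energyRemainder, norm_div, Real.norm_of_nonneg (sq_nonneg ‖x - y‖)]
    refine div_le_of_le_mul₀ (sq_nonneg _) (by simp only [Pi.add_apply]; positivity)
      ((norm_sub_le _ _).trans ?_)
    rw [norm_mul, norm_mul, norm_pow, norm_pow, Pi.add_apply, add_mul]
    calc |f x - f y| ^ 2 * |g y| + |ℓ (y - x)| ^ 2 * |g x|
        ≤ (K * ‖x - y‖) ^ 2 * |g y| + (‖ℓ‖ * ‖x - y‖) ^ 2 * |g x| := by gcongr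
      _ = _ := by ring

theorem energyKernel_mul_eq (d : ℕ) (t : ℝ) (f g : EuclideanSpace ℝ (Fin N) → ℝ)
    (ℓ : EuclideanSpace ℝ (Fin N) →L[ℝ] ℝ) (x y : EuclideanSpace ℝ (Fin N)) :
    energyKernel d t f x y * g y =
      g x / 2 * (gaussianWeight d t x y * (ℓ (y - x) ^ 2 / t)) +
        1 / 2 * (gaussianWeight d t x y * (‖x - y‖ ^ 2 / t) * energyRemainder f g ℓ x y) := by
  have hcancel : ‖x - y‖ ^ 2 * energyRemainder f g ℓ x y =
      (f x - f y) ^ 2 * g y - ℓ (y - x) ^ 2 * g x := by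
    rcases eq_or_ne x y with rfl | hxy
    · simp
    · exact mul_div_cancel₀ _ (pow_ne_zero 2 (norm_ne_zero_iff.2 (sub_ne_zero.2 hxy)))
  rw [energyKernel]
  linear_combination (-gaussianWeight d t x y / (2 * t)) * hcancel

theorem integrable_gaussianWeight_mul_sq {μ : Measure (EuclideanSpace ℝ (Fin N))}
    [IsFiniteMeasure μ] {t : ℝ} (ht : 0 < t) (x : EuclideanSpace ℝ (Fin N))
    (ℓ : EuclideanSpace ℝ (Fin N) →L[ℝ] ℝ) :
    Integrable (fun y => gaussianWeight d t x y * (ℓ (y - x) ^ 2 / t)) μ := by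
  have hcont := continuous_gaussianWeight_right d t x
  refine .of_bound (by fun_prop) (‖ℓ‖ ^ 2 * (2 * (1 / t ^ ((d : ℝ) / 2)))) (.of_forall fun y => ?_)
  have hℓy : |ℓ (y - x)| ≤ ‖ℓ‖ * ‖x - y‖ := norm_sub_rev y x ▸ ℓ.le_opNorm (y - x)
  have hweight := gaussianWeight_nonneg (d := d) ht x y
  rw [Real.norm_of_nonneg (mul_nonneg hweight (by positivity)), ← sq_abs]
  calc gaussianWeight d t x y * (|ℓ (y - x)| ^ 2 / t)
      ≤ gaussianWeight d t x y * ((‖ℓ‖ * ‖x - y‖) ^ 2 / t) := by gcongr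
    _ = ‖ℓ‖ ^ 2 * (gaussianWeight d t x y * (‖x - y‖ ^ 2 / t)) := by ring
    _ ≤ _ := mul_le_mul_of_nonneg_left (gaussianWeight_mul_sq_dist_div_le_rpow ht x y)
        (sq_nonneg _)

theorem integrable_gaussianWeight_mul_sq_dist {μ : Measure (EuclideanSpace ℝ (Fin N))} {t : ℝ}
    (ht : 0 < t) (x : EuclideanSpace ℝ (Fin N)) (hg : Integrable g μ) :
    Integrable (fun y => gaussianWeight d t x y * (‖x - y‖ ^ 2 / t) * g y) μ := by
  have hcont := continuous_gaussianWeight_right d t x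
  refine hg.bdd_mul (c := 2 * (1 / t ^ ((d : ℝ) / 2))) (by fun_prop) (.of_forall fun y => ?_)
  rw [Real.norm_of_nonneg (mul_nonneg (gaussianWeight_nonneg ht x y) (by positivity))]
  exact gaussianWeight_mul_sq_dist_div_le_rpow ht x y

theorem IsTangentParam.tendsto_integral_energyKernel (h : IsTangentParam M x ι σ)
    (hMm : MeasurableSet M) (hMfin : Measure.euclideanHausdorffMeasure d M < ⊤) {K : ℝ≥0}
    (hf : LipschitzWith K f) (hfd : DifferentiableWithinAt ℝ f M x)
    (hg : Integrable g (riemannianVolume d M)) (hgx : ContinuousWithinAt g M x) :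
    Tendsto (fun t => ∫ y, energyKernel d t f x y * g y ∂riemannianVolume d M) (𝓝[>] 0)
      (𝓝 (Real.pi ^ ((d : ℝ) / 2) / 4 * ‖gradientOn M f x‖ ^ 2 * g x)) := by
  have : IsFiniteMeasure (riemannianVolume d M) := isFiniteMeasure_restrict.2 hMfin.ne
  set ℓ := fderivWithin ℝ f M x
  have hrem := integrable_energyRemainder hf hg ℓ x
  have hlim := ((h.tendsto_integral_gaussianWeight_mul_sq hMm hMfin ℓ).const_mul (g x / 2)).add
    ((h.tendsto_integral_gaussianWeight_mul_sq_dist hMm hMfin hrem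
      (tendsto_energyRemainder hfd.hasFDerivWithinAt hgx)).const_mul (1 / 2))
  rw [h.norm_comp_eq] at hlim
  refine (hlim.congr' (eventually_mem_nhdsWithin.mono fun t ht => ?_)).trans_eq ?_
  · simp only [energyKernel_mul_eq d t f g ℓ x]
    rw [integral_add, integral_const_mul, integral_const_mul]
    · exact (integrable_gaussianWeight_mul_sq ht x ℓ).const_mul _
    · exact (integrable_gaussianWeight_mul_sq_dist ht x hrem).const_mul _
  · ring_nf

end LocalEnergy

/-! ### Integrals against bounded kernels -/

section Kernel

variable {Ω : Type*} [MeasurableSpace Ω] {ν : Measure Ω} {h : Ω → Ω → ℝ} {B C D : ℝ}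

/-- A nonnegative measurable kernel `h`, bounded by `B`, whose rows have `ν`-mass at most `C`.
The kernels of interest have bounded mass while `B` blows up like `t ^ (-d / 2)`. -/
structure IsBoundedKernel (ν : Measure Ω) (h : Ω → Ω → ℝ) (B C : ℝ) : Prop where
  measurable : Measurable (Function.uncurry h)
  nonneg : ∀ x y, 0 ≤ h x y
  le : ∀ x y, h x y ≤ B
  integral_le : ∀ x, ∫ y, h x y ∂ν ≤ C

theorem integral_prod_mul_mul_comm [SFinite ν] (hsymm : ∀ x y, h x y = h y x) (v w : Ω → ℝ) :
    ∫ z, h z.1 z.2 * (v z.1 * w z.2) ∂ν.prod ν = ∫ z, h z.1 z.2 * (w z.1 * v z.2) ∂ν.prod ν := by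
  rw [← integral_prod_swap]
  simp only [Prod.fst_swap, Prod.snd_swap, hsymm, mul_comm]

namespace IsBoundedKernel

theorem measurable_right (hh : IsBoundedKernel ν h B C) (x : Ω) : Measurable (h x) :=
  hh.measurable.of_uncurry_left

theorem mono {B' C' : ℝ} (hh : IsBoundedKernel ν h B C) (hB : B ≤ B') (hC : C ≤ C') :
    IsBoundedKernel ν h B' C' :=
  ⟨hh.measurable, hh.nonneg, fun x y => (hh.le x y).trans hB, fun x => (hh.integral_le x).trans hC⟩

theorem mass_nonneg (hh : IsBoundedKernel ν h B C) (x : Ω) : 0 ≤ C :=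
  (integral_nonneg (hh.nonneg x)).trans (hh.integral_le x)

theorem integrable [IsFiniteMeasure ν] (hh : IsBoundedKernel ν h B C) (x : Ω) :
    Integrable (h x) ν :=
  .of_bound (hh.measurable_right x).aestronglyMeasurable B
    (.of_forall fun y => (Real.norm_of_nonneg (hh.nonneg x y)).trans_le (hh.le x y))

theorem measurable_integral [SFinite ν] (hh : IsBoundedKernel ν h B C) :
    Measurable fun x => ∫ y, h x y ∂ν :=
  hh.measurable.stronglyMeasurable.integral_prod_right.measurable

theorem mul_mul (hh : IsBoundedKernel ν h B C) [IsFiniteMeasure ν] {u : Ω → ℝ}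
    (hum : Measurable u) (hu0 : ∀ x, 0 ≤ u x) (huD : ∀ x, u x ≤ D) :
    IsBoundedKernel ν (fun x y => h x y * (u x * u y)) (B * D ^ 2) (C * D ^ 2) where
  measurable := hh.measurable.mul ((hum.comp measurable_fst).mul (hum.comp measurable_snd))
  nonneg x y := mul_nonneg (hh.nonneg x y) (mul_nonneg (hu0 x) (hu0 y))
  le x y := by
    rw [sq]
    exact mul_le_mul (hh.le x y)
      (mul_le_mul (huD x) (huD y) (hu0 y) ((hu0 x).trans (huD x))) (mul_nonneg (hu0 x) (hu0 y))
      ((hh.nonneg x y).trans (hh.le x y))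
  integral_le x := by
    calc ∫ y, h x y * (u x * u y) ∂ν
        ≤ ∫ y, h x y * D ^ 2 ∂ν := by
          refine integral_mono_of_nonneg (.of_forall fun y => mul_nonneg (hh.nonneg x y)
            (mul_nonneg (hu0 x) (hu0 y))) ((hh.integrable x).mul_const _) (.of_forall fun y => ?_)
          dsimp only
          rw [sq]
          gcongr
          exacts [hh.nonneg x y, hu0 y, (hu0 x).trans (huD x), huD x, huD y]
      _ ≤ C * D ^ 2 := by
          rw [integral_mul_const]
          exact mul_le_mul_of_nonneg_right (hh.integral_le x) (sq_nonneg D)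

theorem abs_integral_mul_le [IsFiniteMeasure ν] (hh : IsBoundedKernel ν h B C) {v : Ω → ℝ}
    (hvD : ∀ x, |v x| ≤ D) (x : Ω) : |∫ y, h x y * v y ∂ν| ≤ C * D := by
  have hD : 0 ≤ D := (abs_nonneg _).trans (hvD x)
  calc |∫ y, h x y * v y ∂ν|
      ≤ ∫ y, h x y * D ∂ν := by
        rw [← Real.norm_eq_abs]
        refine norm_integral_le_of_norm_le ((hh.integrable x).mul_const D) (.of_forall fun y => ?_)
        rw [norm_mul, Real.norm_of_nonneg (hh.nonneg x y)]
        exact mul_le_mul_of_nonneg_left (hvD y) (hh.nonneg x y)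
    _ ≤ C * D := by
        rw [integral_mul_const]
        exact mul_le_mul_of_nonneg_right (hh.integral_le x) hD

theorem integrable_mul_mul (hh : IsBoundedKernel ν h B C) {v w : Ω → ℝ}
    (hv : Integrable v ν) (hw : Integrable w ν) :
    Integrable (fun z : Ω × Ω => h z.1 z.2 * (v z.1 * w z.2)) (ν.prod ν) :=
  (hv.mul_prod hw).bdd_mul hh.measurable.aestronglyMeasurable
    (.of_forall fun z => (Real.norm_of_nonneg (hh.nonneg z.1 z.2)).trans_le (hh.le z.1 z.2))

theorem abs_integral_prod_mul_mul_le [IsFiniteMeasure ν] (hh : IsBoundedKernel ν h B C)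
    {v w : Ω → ℝ} (hv : Integrable v ν) (hw : Integrable w ν) (hwD : ∀ x, |w x| ≤ D) :
    |∫ z, h z.1 z.2 * (v z.1 * w z.2) ∂ν.prod ν| ≤ C * D * ∫ x, |v x| ∂ν := by
  rw [integral_prod _ (hh.integrable_mul_mul hv hw), ← integral_const_mul, ← Real.norm_eq_abs]
  refine norm_integral_le_of_norm_le (hv.abs.const_mul _) (.of_forall fun x => ?_)
  simp only [mul_left_comm (h x _) (v x), integral_const_mul, norm_mul, Real.norm_eq_abs]
  rw [mul_comm]
  exact mul_le_mul_of_nonneg_right (hh.abs_integral_mul_le hwD x) (abs_nonneg _)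

theorem abs_integral_prod_mul_mul_sub_le [IsFiniteMeasure ν] (hh : IsBoundedKernel ν h B C)
    (hsymm : ∀ x y, h x y = h y x) {u v : Ω → ℝ} (hum : Measurable u) (huD : ∀ x, |u x| ≤ D)
    (hvm : Measurable v) (hvD : ∀ x, |v x| ≤ D) :
    |∫ z, h z.1 z.2 * (u z.1 * u z.2) ∂ν.prod ν - ∫ z, h z.1 z.2 * (v z.1 * v z.2) ∂ν.prod ν| ≤
      2 * (C * D) * ∫ x, |u x - v x| ∂ν := by
  have hu : Integrable u ν := .of_bound hum.aestronglyMeasurable D (.of_forall huD)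
  have hv : Integrable v ν := .of_bound hvm.aestronglyMeasurable D (.of_forall hvD)
  have hsplit : ∫ z, h z.1 z.2 * (u z.1 * u z.2) ∂ν.prod ν -
      ∫ z, h z.1 z.2 * (v z.1 * v z.2) ∂ν.prod ν =
      ∫ z, h z.1 z.2 * ((u - v) z.1 * u z.2) ∂ν.prod ν +
        ∫ z, h z.1 z.2 * ((u - v) z.1 * v z.2) ∂ν.prod ν := by
    rw [integral_prod_mul_mul_comm hsymm (u - v) v, ← integral_sub (hh.integrable_mul_mul hu hu)
      (hh.integrable_mul_mul hv hv), ← integral_add (hh.integrable_mul_mul (hu.sub hv) hu)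
      (hh.integrable_mul_mul hv (hu.sub hv))]
    exact integral_congr_ae (.of_forall fun z => by simp only [Pi.sub_apply]; ring)
  rw [hsplit]
  refine (abs_add_le _ _).trans ?_
  have hdiffu := hh.abs_integral_prod_mul_mul_le (hu.sub hv) hu huD
  have hdiffv := hh.abs_integral_prod_mul_mul_le (hu.sub hv) hv hvD
  simp only [Pi.sub_apply] at hdiffu hdiffv ⊢
  linarith

theorem tendsto_integral_prod_mul_mul_const [IsFiniteMeasure ν] {τ : Type*} {l : Filter τ}
    [l.IsCountablyGenerated] {h : τ → Ω → Ω → ℝ} {B : τ → ℝ}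
    (hh : ∀ᶠ s in l, IsBoundedKernel ν (h s) (B s) C) {v e : Ω → ℝ} (hvm : Measurable v)
    (hvD : ∀ x, |v x| ≤ D)
    (he : ∀ᵐ x ∂ν, Tendsto (fun s => ∫ y, h s x y * v y ∂ν) l (𝓝 (e x))) :
    Tendsto (fun s => ∫ z, h s z.1 z.2 * (v z.1 * v z.2) ∂ν.prod ν) l
      (𝓝 (∫ x, v x * e x ∂ν)) := by
  have hv : Integrable v ν := .of_bound hvm.aestronglyMeasurable D (.of_forall hvD)
  have hrow : ∀ᶠ s in l, ∫ x, v x * ∫ y, h s x y * v y ∂ν ∂ν =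
      ∫ z, h s z.1 z.2 * (v z.1 * v z.2) ∂ν.prod ν := hh.mono fun s hs => by
    rw [integral_prod _ (hs.integrable_mul_mul hv hv)]
    simp only [mul_left_comm (h s _ _) (v _), integral_const_mul]
  refine Tendsto.congr' hrow (tendsto_integral_filter_of_dominated_convergence
    (fun _ => D * (C * D)) ?_ ?_ (integrable_const _) ?_)
  · filter_upwards [hh] with s hs
    exact (hvm.mul (hs.measurable.mul
      (hvm.comp measurable_snd)).stronglyMeasurable.integral_prod_right.measurable
      ).aestronglyMeasurable
  · filter_upwards [hh] with s hs
    refine .of_forall fun x => ?_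
    rw [norm_mul]
    exact mul_le_mul (hvD x) (hs.abs_integral_mul_le hvD x) (norm_nonneg _)
      ((abs_nonneg _).trans (hvD x))
  · filter_upwards [he] with x hx using hx.const_mul (v x)

/-- The functions `u s` need not converge locally uniformly, so one cannot pass to the limit row by
row; the symmetry of the kernels trades this for convergence in `L¹`. -/
theorem tendsto_integral_prod_mul_mul [IsFiniteMeasure ν] {τ : Type*} {l : Filter τ}
    [l.IsCountablyGenerated] {h : τ → Ω → Ω → ℝ} {B : τ → ℝ}
    (hh : ∀ᶠ s in l, IsBoundedKernel ν (h s) (B s) C) (hsymm : ∀ s x y, h s x y = h s y x)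
    {u : τ → Ω → ℝ} {v e : Ω → ℝ} (hum : ∀ s, Measurable (u s))
    (huD : ∀ᶠ s in l, ∀ x, |u s x| ≤ D) (hvm : Measurable v) (hvD : ∀ x, |v x| ≤ D)
    (huv : ∀ᵐ x ∂ν, Tendsto (u · x) l (𝓝 (v x)))
    (he : ∀ᵐ x ∂ν, Tendsto (fun s => ∫ y, h s x y * v y ∂ν) l (𝓝 (e x))) :
    Tendsto (fun s => ∫ z, h s z.1 z.2 * (u s z.1 * u s z.2) ∂ν.prod ν) l
      (𝓝 (∫ x, v x * e x ∂ν)) := by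
  have hfrozen := tendsto_integral_prod_mul_mul_const hh hvm hvD he
  have hL1 : Tendsto (fun s => ∫ x, |u s x - v x| ∂ν) l (𝓝 0) := by
    rw [← integral_zero Ω ℝ (μ := ν)]
    refine tendsto_integral_filter_of_dominated_convergence (fun _ => D + D)
      (.of_forall fun s => ((hum s).sub hvm).abs.aestronglyMeasurable) ?_ (integrable_const _) ?_
    · filter_upwards [huD] with s hs
      refine .of_forall fun x => ?_
      rw [Real.norm_eq_abs, abs_abs]
      exact (abs_sub _ _).trans (add_le_add (hs x) (hvD x))
    · filter_upwards [huv] with x hx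
      simpa using (hx.sub_const (v x)).abs
  refine hfrozen.congr_dist (squeeze_zero' (.of_forall fun s => dist_nonneg) ?_
    (mul_zero (2 * (C * D)) ▸ hL1.const_mul _))
  filter_upwards [hh, huD] with s hs husD
  rw [dist_comm, Real.dist_eq]
  exact hs.abs_integral_prod_mul_mul_sub_le (hsymm s) (hum s) husD hvm hvD

end IsBoundedKernel

end Kernel

/-! ### Sampling measure and mean degree -/

/-- The measure on `M` with density `p` with respect to the Riemannian volume: the law of the
sample points. -/
noncomputable def densityMeasure {N : ℕ} (d : ℕ) (M : Set (EuclideanSpace ℝ (Fin N)))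
    (p : EuclideanSpace ℝ (Fin N) → ℝ) : Measure (EuclideanSpace ℝ (Fin N)) :=
  (riemannianVolume d M).withDensity fun x => ENNReal.ofReal (p x)

/-- The expected degree `∫ w_t(x, y) dν(y)` of `x`, the large sample limit of `empiricalDegree`. -/
noncomputable def meanDegree {N : ℕ} (d : ℕ) (ν : Measure (EuclideanSpace ℝ (Fin N))) (t : ℝ)
    (x : EuclideanSpace ℝ (Fin N)) : ℝ :=
  ∫ y, gaussianWeight d t x y ∂ν

section DensityMeasure

variable {N d : ℕ} {M : Set (EuclideanSpace ℝ (Fin N))} {f g p : EuclideanSpace ℝ (Fin N) → ℝ}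

theorem ae_densityMeasure_of_ae {q : EuclideanSpace ℝ (Fin N) → Prop}
    (h : ∀ᵐ x ∂riemannianVolume d M, q x) : ∀ᵐ x ∂densityMeasure d M p, q x :=
  (withDensity_absolutelyContinuous _ _).ae_le h

theorem ae_mem_densityMeasure (hMm : MeasurableSet M) : ∀ᵐ x ∂densityMeasure d M p, x ∈ M :=
  ae_densityMeasure_of_ae (ae_restrict_mem hMm)

theorem integral_densityMeasure (hMm : MeasurableSet M) (hp : ContinuousOn p M)
    (hp0 : ∀ x ∈ M, 0 ≤ p x) (g : EuclideanSpace ℝ (Fin N) → ℝ) :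
    ∫ x, g x ∂densityMeasure d M p = ∫ x, g x * p x ∂riemannianVolume d M := by
  have hpm : AEMeasurable p (riemannianVolume d M) := hp.aemeasurable hMm
  rw [densityMeasure, integral_withDensity_eq_integral_toReal_smul₀
    hpm.ennreal_ofReal (.of_forall fun _ => ENNReal.ofReal_lt_top)]
  refine integral_congr_ae ((ae_restrict_mem hMm).mono fun x hx => ?_)
  dsimp only
  rw [ENNReal.toReal_ofReal (hp0 x hx), smul_eq_mul, mul_comm]

namespace IsSubmanifoldWithBoundary

theorem isFiniteMeasure_riemannianVolume (hM : IsSubmanifoldWithBoundary d M)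
    (hMc : IsCompact M) : IsFiniteMeasure (riemannianVolume d M) :=
  isFiniteMeasure_restrict.2 (hM.measure_lt_top hMc).ne

theorem integrable_of_continuousOn (hM : IsSubmanifoldWithBoundary d M) (hMc : IsCompact M)
    (hg : ContinuousOn g M) : Integrable g (riemannianVolume d M) := by
  have := hM.isFiniteMeasure_riemannianVolume hMc
  obtain ⟨b, hb⟩ := hMc.exists_bound_of_continuousOn hg
  exact .of_bound (hg.aestronglyMeasurable hMc.measurableSet) b
    ((ae_restrict_mem hMc.measurableSet).mono hb)

theorem isFiniteMeasure_densityMeasure (hM : IsSubmanifoldWithBoundary d M) (hMc : IsCompact M)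
    (hp : ContinuousOn p M) : IsFiniteMeasure (densityMeasure d M p) :=
  isFiniteMeasure_withDensity_ofReal (hM.integrable_of_continuousOn hMc hp).2

theorem integrable_gaussianWeight (hM : IsSubmanifoldWithBoundary d M) (hMc : IsCompact M) (t : ℝ)
    (x : EuclideanSpace ℝ (Fin N)) :
    Integrable (fun y => gaussianWeight d t x y) (riemannianVolume d M) :=
  hM.integrable_of_continuousOn hMc (continuous_gaussianWeight_right d t x).continuousOn

theorem exists_isBoundedKernel_gaussianWeight (hM : IsSubmanifoldWithBoundary d M)
    (hMc : IsCompact M) (hp : ContinuousOn p M) (hp0 : ∀ x ∈ M, 0 ≤ p x) :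
    ∃ C : ℝ, ∀ t > 0, IsBoundedKernel (densityMeasure d M p) (gaussianWeight d t)
      (1 / t ^ ((d : ℝ) / 2)) C := by
  obtain ⟨C, hC⟩ := hM.exists_lintegral_gaussianWeight_le hMc
  obtain ⟨b, hb⟩ := hMc.exists_bound_of_continuousOn hp
  refine ⟨C * |b|, fun t ht => ⟨(continuous_gaussianWeight d t).measurable,
    gaussianWeight_nonneg ht, gaussianWeight_le ht, fun x => ?_⟩⟩
  have hmass : ∫ y, gaussianWeight d t x y ∂riemannianVolume d M ≤ C := by
    rw [integral_eq_lintegral_of_nonneg_ae (.of_forall (gaussianWeight_nonneg ht x))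
      (continuous_gaussianWeight_right d t x).aestronglyMeasurable]
    exact ENNReal.toReal_le_of_le_ofReal C.2 ((hC t ht x).trans_eq (ENNReal.ofReal_coe_nnreal).symm)
  rw [integral_densityMeasure hMc.measurableSet hp hp0]
  calc ∫ y, gaussianWeight d t x y * p y ∂riemannianVolume d M
      ≤ ∫ y, gaussianWeight d t x y * |b| ∂riemannianVolume d M := by
        refine setIntegral_mono_on (hM.integrable_of_continuousOn hMc
          ((continuous_gaussianWeight_right d t x).continuousOn.mul hp))
          ((hM.integrable_gaussianWeight hMc t x).mul_const _) hMc.measurableSet fun y hy => ?_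
        exact mul_le_mul_of_nonneg_left ((le_abs_self _).trans ((hb y hy).trans (le_abs_self b)))
          (gaussianWeight_nonneg ht x y)
    _ ≤ C * |b| := by
        rw [integral_mul_const]
        exact mul_le_mul_of_nonneg_right hmass (abs_nonneg b)

theorem exists_le_meanDegree (hM : IsSubmanifoldWithBoundary d M) (hMc : IsCompact M)
    (hp : ContinuousOn p M) (hp0 : ∀ x ∈ M, 0 < p x) :
    ∃ c > 0, ∀ t ∈ Set.Ioc (0 : ℝ) 1, ∀ x ∈ M, c ≤ meanDegree d (densityMeasure d M p) t x := by
  obtain ⟨c, hc0, hc⟩ := hM.exists_le_lintegral_gaussianWeight hMc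
  obtain ⟨a, ha0, ha⟩ := hMc.exists_forall_le' hp hp0
  refine ⟨c * a, by positivity, fun t ht x hx => ?_⟩
  have := hM.isFiniteMeasure_riemannianVolume hMc
  have hmass : c ≤ ∫ y, gaussianWeight d t x y ∂riemannianVolume d M := by
    rw [integral_eq_lintegral_of_nonneg_ae (.of_forall (gaussianWeight_nonneg ht.1 x))
      (continuous_gaussianWeight_right d t x).aestronglyMeasurable,
      ← ENNReal.ofReal_le_iff_le_toReal (hM.integrable_gaussianWeight hMc t x).lintegral_lt_top.ne,
      ENNReal.ofReal_coe_nnreal]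
    exact hc t ht x hx
  rw [meanDegree, integral_densityMeasure hMc.measurableSet hp fun y hy => (hp0 y hy).le]
  calc c * a ≤ ∫ y, gaussianWeight d t x y * a ∂riemannianVolume d M := by
        rw [integral_mul_const]
        exact mul_le_mul_of_nonneg_right hmass ha0.le
    _ ≤ ∫ y, gaussianWeight d t x y * p y ∂riemannianVolume d M := by
        refine setIntegral_mono_on ((hM.integrable_gaussianWeight hMc t x).mul_const _)
          (hM.integrable_of_continuousOn hMc
          ((continuous_gaussianWeight_right d t x).continuousOn.mul hp)) hMc.measurableSet
          fun y hy => mul_le_mul_of_nonneg_left (ha y hy) (gaussianWeight_nonneg ht.1 x y)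

theorem ae_tendsto_meanDegree (hM : IsSubmanifoldWithBoundary d M) (hMc : IsCompact M)
    (hp : ContinuousOn p M) (hp0 : ∀ x ∈ M, 0 ≤ p x) :
    ∀ᵐ x ∂riemannianVolume d M, Tendsto (fun t => meanDegree d (densityMeasure d M p) t x) (𝓝[>] 0)
      (𝓝 (Real.pi ^ ((d : ℝ) / 2) * p x)) := by
  filter_upwards [hM.ae_exists_isTangentParam hMc.measurableSet,
    ae_restrict_mem hMc.measurableSet] with x ⟨ι, σ, hσ⟩ hx
  simp only [meanDegree, integral_densityMeasure hMc.measurableSet hp hp0]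
  exact hσ.tendsto_integral_gaussianWeight_mul hMc.measurableSet (hM.measure_lt_top hMc)
    (hM.integrable_of_continuousOn hMc hp) (hp x hx)

theorem exists_isBoundedKernel_energyKernel (hM : IsSubmanifoldWithBoundary d M)
    (hMc : IsCompact M) (hp : ContinuousOn p M) (hp0 : ∀ x ∈ M, 0 ≤ p x) {K : ℝ≥0}
    (hf : LipschitzWith K f) :
    ∃ C : ℝ, ∀ t > 0, IsBoundedKernel (densityMeasure d M p) (energyKernel d t f)
      ((K : ℝ) ^ 2 * (1 / t ^ ((d : ℝ) / 2))) C := by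
  have := hM.isFiniteMeasure_densityMeasure hMc hp
  obtain ⟨C, hC⟩ := hM.exists_isBoundedKernel_gaussianWeight hMc hp hp0
  refine ⟨(K : ℝ) ^ 2 * 2 ^ ((d : ℝ) / 2) * C, fun t ht =>
    ⟨(continuous_energyKernel d t hf.continuous).measurable, energyKernel_nonneg ht f,
      energyKernel_le_rpow hf ht, fun x => ?_⟩⟩
  have hC2 := hC (2 * t) (by positivity)
  calc ∫ y, energyKernel d t f x y ∂densityMeasure d M p
      ≤ ∫ y, (K : ℝ) ^ 2 * 2 ^ ((d : ℝ) / 2) * gaussianWeight d (2 * t) x y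
          ∂densityMeasure d M p :=
        integral_mono_of_nonneg (.of_forall (energyKernel_nonneg ht f x))
          ((hC2.integrable x).const_mul _) (.of_forall (energyKernel_le hf ht x))
    _ ≤ _ := by
        rw [integral_const_mul]
        exact mul_le_mul_of_nonneg_left (hC2.integral_le x) (by positivity)

end IsSubmanifoldWithBoundary

end DensityMeasure

/-- The factor `q_t(x) ^ (-α)`, with `q_t` the expected degree, that replaces `d_{t,n}(x) ^ (-α)` in
the large sample limit. It is set to `0` off `M`, where `q_t` has no lower bound. -/
noncomputable def degreeFactor {N : ℕ} (d : ℕ) (M : Set (EuclideanSpace ℝ (Fin N)))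
    (p : EuclideanSpace ℝ (Fin N) → ℝ) (α t : ℝ) : EuclideanSpace ℝ (Fin N) → ℝ :=
  M.indicator fun x => meanDegree d (densityMeasure d M p) t x ^ (-α)

theorem exists_rpow_le {c : ℝ} (hc : 0 < c) (C r : ℝ) : ∃ D, ∀ s ∈ Set.Icc c C, s ^ r ≤ D := by
  obtain ⟨D, hD⟩ := isCompact_Icc.bddAbove_image (f := fun s : ℝ => s ^ r)
    (continuousOn_id.rpow_const fun s hs => Or.inl (hc.trans_le hs.1).ne')
  exact ⟨D, fun s hs => hD (Set.mem_image_of_mem _ hs)⟩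

theorem rpow_neg_mul_energy_eq (d : ℕ) (α : ℝ) {q : ℝ} (hq : 0 < q) (G : ℝ) :
    (Real.pi ^ ((d : ℝ) / 2) * q) ^ (-α) *
        (Real.pi ^ ((d : ℝ) / 2) / 4 * G * ((Real.pi ^ ((d : ℝ) / 2) * q) ^ (-α) * q)) * q =
      1 / 4 * Real.pi ^ ((d : ℝ) * (1 / 2 - α)) * (G * q ^ (2 - 2 * α)) := by
  have hpi : Real.pi ^ ((d : ℝ) * (1 / 2 - α)) =
      Real.pi ^ ((d : ℝ) / 2) * (Real.pi ^ ((d : ℝ) / 2 * -α) * Real.pi ^ ((d : ℝ) / 2 * -α)) := by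
    rw [← Real.rpow_add Real.pi_pos, ← Real.rpow_add Real.pi_pos]
    ring_nf
  have hqpow : q ^ (2 - 2 * α) = q ^ (-α) * q ^ (-α) * (q * q) := by
    rw [show 2 - 2 * α = -α + -α + 2 by ring, Real.rpow_add hq, Real.rpow_add hq, Real.rpow_two, sq]
  rw [Real.mul_rpow (by positivity) hq.le, ← Real.rpow_mul Real.pi_pos.le, hpi, hqpow]
  ring

section MeanEnergy

variable {N d : ℕ} {M : Set (EuclideanSpace ℝ (Fin N))} {f p : EuclideanSpace ℝ (Fin N) → ℝ}
  {α t : ℝ}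

theorem measurable_indicator_of_continuousOn (hMm : MeasurableSet M) (hf : ContinuousOn f M) :
    Measurable (M.indicator f) := by
  classical
  rw [← Set.piecewise_eq_indicator]
  exact hf.measurable_piecewise continuousOn_const hMm

theorem exists_abs_indicator_le (hMc : IsCompact M) (hf : ContinuousOn f M) :
    ∃ D, ∀ x, |M.indicator f x| ≤ D := by
  obtain ⟨D, hD⟩ := hMc.exists_bound_of_continuousOn hf
  exact ⟨max D 0, fun x => (norm_indicator_eq_indicator_norm f x).trans_le (Set.indicator_le'
    (fun x hx => (hD x hx).trans (le_max_left _ _)) (fun _ _ => le_max_right _ _) x)⟩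

theorem degreeFactor_nonneg (ht : 0 < t) (x : EuclideanSpace ℝ (Fin N)) :
    0 ≤ degreeFactor d M p α t x :=
  Set.indicator_nonneg (fun x _ => Real.rpow_nonneg
    (integral_nonneg fun y => gaussianWeight_nonneg ht x y) _) x

theorem measurable_degreeFactor [SFinite (densityMeasure d M p)] (hMm : MeasurableSet M) :
    Measurable (degreeFactor d M p α t) := by
  have hdegree : Measurable (meanDegree d (densityMeasure d M p) t) :=
    (continuous_gaussianWeight d t).stronglyMeasurable.integral_prod_right.measurable
  exact (hdegree.pow_const _).indicator hMm

namespace IsSubmanifoldWithBoundary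

theorem exists_abs_degreeFactor_le (hM : IsSubmanifoldWithBoundary d M) (hMc : IsCompact M)
    (hp : ContinuousOn p M) (hp0 : ∀ x ∈ M, 0 < p x) (α : ℝ) :
    ∃ D : ℝ, ∀ t ∈ Set.Ioc (0 : ℝ) 1, ∀ x, |degreeFactor d M p α t x| ≤ D := by
  obtain ⟨c, hc0, hc⟩ := hM.exists_le_meanDegree hMc hp hp0
  obtain ⟨C, hC⟩ := hM.exists_isBoundedKernel_gaussianWeight hMc hp fun x hx => (hp0 x hx).le
  obtain ⟨D, hD⟩ := exists_rpow_le hc0 C (-α)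
  refine ⟨max D 0, fun t ht x => ?_⟩
  rw [abs_of_nonneg (degreeFactor_nonneg ht.1 x)]
  refine Set.indicator_le' (fun x hx => ?_) (fun _ _ => le_max_right _ _) x
  exact (hD _ ⟨hc t ht x hx, (hC t ht.1).integral_le x⟩).trans (le_max_left _ _)

theorem ae_tendsto_degreeFactor (hM : IsSubmanifoldWithBoundary d M) (hMc : IsCompact M)
    (hp : ContinuousOn p M) (hp0 : ∀ x ∈ M, 0 < p x) (α : ℝ) :
    ∀ᵐ x ∂riemannianVolume d M, Tendsto (fun t => degreeFactor d M p α t x) (𝓝[>] 0)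
      (𝓝 ((Real.pi ^ ((d : ℝ) / 2) * p x) ^ (-α))) := by
  filter_upwards [hM.ae_tendsto_meanDegree hMc hp fun x hx => (hp0 x hx).le,
    ae_restrict_mem hMc.measurableSet] with x hlim hx
  have hpos := hp0 x hx
  simp only [degreeFactor, Set.indicator_of_mem hx]
  exact hlim.rpow_const (.inl (by positivity))

theorem ae_tendsto_integral_energyKernel_mul (hM : IsSubmanifoldWithBoundary d M)
    (hMc : IsCompact M) (hp : ContinuousOn p M) (hp0 : ∀ x ∈ M, 0 ≤ p x) {K : ℝ≥0}
    (hf : LipschitzWith K f)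
    {v : EuclideanSpace ℝ (Fin N) → ℝ} (hv : ContinuousOn v M) :
    ∀ᵐ x ∂riemannianVolume d M, Tendsto
      (fun t => ∫ y, energyKernel d t f x y * v y ∂densityMeasure d M p) (𝓝[>] 0)
      (𝓝 (Real.pi ^ ((d : ℝ) / 2) / 4 * ‖gradientOn M f x‖ ^ 2 * (v x * p x))) := by
  filter_upwards [hM.ae_exists_isTangentParam hMc.measurableSet,
    hM.ae_differentiableWithinAt hMc.measurableSet hf, ae_restrict_mem hMc.measurableSet]
    with x ⟨ι, σ, hσ⟩ hfx hx
  simp only [integral_densityMeasure hMc.measurableSet hp hp0, mul_assoc (energyKernel d _ f x _)]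
  exact hσ.tendsto_integral_energyKernel hMc.measurableSet (hM.measure_lt_top hMc) hf hfx
    (hM.integrable_of_continuousOn hMc (hv.mul hp)) (hv.mul hp x hx)

theorem integrable_sq_norm_gradientOn (hM : IsSubmanifoldWithBoundary d M) (hMc : IsCompact M)
    {K : ℝ≥0} (hf : LipschitzWith K f) :
    Integrable (fun x => ‖gradientOn M f x‖ ^ 2) (riemannianVolume d M) := by
  have hvol : densityMeasure d M (fun _ => 1) = riemannianVolume d M := by
    simp only [densityMeasure, ENNReal.ofReal_one]
    exact withDensity_one
  have := hM.isFiniteMeasure_riemannianVolume hMc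
  have hlim := hM.ae_tendsto_integral_energyKernel_mul hMc (p := fun _ => 1)
    continuousOn_const (fun _ _ => zero_le_one) hf (v := fun _ => 1) continuousOn_const
  obtain ⟨C, hC⟩ := hM.exists_isBoundedKernel_energyKernel hMc (p := fun _ => 1)
    continuousOn_const (fun _ _ => zero_le_one) hf
  simp only [hvol, mul_one] at hlim hC
  have hscaled : Integrable (fun x => Real.pi ^ ((d : ℝ) / 2) / 4 * ‖gradientOn M f x‖ ^ 2)
      (riemannianVolume d M) := by
    refine .of_bound (aemeasurable_of_tendsto_metrizable_ae _ (fun t => ?_)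
      hlim).aestronglyMeasurable C (hlim.mono fun x hx => ?_)
    · exact (continuous_energyKernel d t
        hf.continuous).stronglyMeasurable.integral_prod_right.measurable.aemeasurable
    · rw [Real.norm_of_nonneg (by positivity)]
      exact le_of_tendsto hx (eventually_mem_nhdsWithin.mono fun t ht => (hC t ht).integral_le x)
  exact (integrable_const_mul_iff (by positivity : Real.pi ^ ((d : ℝ) / 2) / 4 ≠ 0).isUnit _).1
    hscaled

theorem integrable_sq_norm_gradientOn_mul (hM : IsSubmanifoldWithBoundary d M) (hMc : IsCompact M)
    {K : ℝ≥0} (hf : LipschitzWith K f)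
    {g : EuclideanSpace ℝ (Fin N) → ℝ} (hg : ContinuousOn g M) :
    Integrable (fun x => ‖gradientOn M f x‖ ^ 2 * g x) (riemannianVolume d M) := by
  obtain ⟨b, hb⟩ := hMc.exists_bound_of_continuousOn hg
  exact (hM.integrable_sq_norm_gradientOn hMc hf).mul_bdd
    (hg.aestronglyMeasurable hMc.measurableSet) ((ae_restrict_mem hMc.measurableSet).mono hb)

theorem tendsto_integral_energyKernel_mul_degreeFactor (hM : IsSubmanifoldWithBoundary d M)
    (hMc : IsCompact M) (hp : ContinuousOn p M) (hp0 : ∀ x ∈ M, 0 < p x) {K : ℝ≥0}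
    (hf : LipschitzWith K f) (α : ℝ) :
    Tendsto (fun t => ∫ z, energyKernel d t f z.1 z.2 *
        (degreeFactor d M p α t z.1 * degreeFactor d M p α t z.2)
          ∂(densityMeasure d M p).prod (densityMeasure d M p)) (𝓝[>] 0)
      (𝓝 (1 / 4 * Real.pi ^ ((d : ℝ) * (1 / 2 - α)) *
        ∫ x, ‖gradientOn M f x‖ ^ 2 * p x ^ (2 - 2 * α) ∂riemannianVolume d M)) := by
  have hMm := hMc.measurableSet
  have hp0' : ∀ x ∈ M, 0 ≤ p x := fun x hx => (hp0 x hx).le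
  have := hM.isFiniteMeasure_densityMeasure hMc hp
  set w : EuclideanSpace ℝ (Fin N) → ℝ := fun x => (Real.pi ^ ((d : ℝ) / 2) * p x) ^ (-α)
  have hw : ContinuousOn w M := (hp.const_mul _).rpow_const fun x hx =>
    .inl (mul_pos (by positivity) (hp0 x hx)).ne'
  obtain ⟨C, hC⟩ := hM.exists_isBoundedKernel_energyKernel hMc hp hp0' hf
  obtain ⟨D, hD⟩ := hM.exists_abs_degreeFactor_le hMc hp hp0 α
  obtain ⟨D', hD'⟩ := exists_abs_indicator_le hMc hw
  have hfactor : ∀ᵐ x ∂densityMeasure d M p, Tendsto (fun t => degreeFactor d M p α t x) (𝓝[>] 0)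
      (𝓝 (M.indicator w x)) := by
    filter_upwards [ae_densityMeasure_of_ae (hM.ae_tendsto_degreeFactor hMc hp hp0 α),
      ae_mem_densityMeasure hMm] with x hx hxM
    rwa [Set.indicator_of_mem hxM]
  have hrow : ∀ᵐ x ∂densityMeasure d M p, Tendsto (fun t => ∫ y, energyKernel d t f x y *
      M.indicator w y ∂densityMeasure d M p) (𝓝[>] 0)
      (𝓝 (Real.pi ^ ((d : ℝ) / 2) / 4 * ‖gradientOn M f x‖ ^ 2 * (w x * p x))) := by
    filter_upwards [ae_densityMeasure_of_ae
      (hM.ae_tendsto_integral_energyKernel_mul hMc hp hp0' hf hw)] with x hx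
    refine hx.congr fun t => integral_congr_ae ((ae_mem_densityMeasure hMm).mono fun y hy => ?_)
    simp only [Set.indicator_of_mem hy]
  refine (IsBoundedKernel.tendsto_integral_prod_mul_mul (l := 𝓝[>] (0 : ℝ)) (D := max D D')
    (eventually_mem_nhdsWithin.mono hC) (fun t => energyKernel_comm f)
    (fun t => measurable_degreeFactor hMm)
    (mem_of_superset (Ioc_mem_nhdsGT one_pos) fun t ht x => (hD t ht x).trans (le_max_left _ _))
    (measurable_indicator_of_continuousOn hMm hw) (fun x => (hD' x).trans (le_max_right _ _))
    hfactor hrow).trans_eq ?_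
  rw [integral_densityMeasure hMm hp hp0', ← integral_const_mul]
  congr 1
  refine setIntegral_congr_fun hMm fun x hx => ?_
  simp only [Set.indicator_of_mem hx, w]
  exact rpow_neg_mul_energy_eq d α (hp0 x hx) _

end IsSubmanifoldWithBoundary

end MeanEnergy

/-! ### Concentration -/

section Chernoff

variable {S ι : Type*} [MeasurableSpace S] {P : Measure S} [IsProbabilityMeasure P]

theorem mgf_le_exp_of_mem_Icc {Y : S → ℝ} {B l : ℝ} (hY : Measurable Y)
    (hYB : ∀ s, Y s ∈ Set.Icc 0 B) (hl : |l| * B ≤ 1) :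
    mgf Y P l ≤ Real.exp ((l + l ^ 2 * B) * ∫ s, Y s ∂P) := by
  have hYint : Integrable Y P := .of_mem_Icc 0 B hY.aemeasurable (.of_forall hYB)
  have hquadratic (s : S) : Real.exp (l * Y s) ≤ (l + l ^ 2 * B) * Y s + 1 := by
    obtain ⟨hY0, hYle⟩ := hYB s
    have hsmall : |l * Y s| ≤ 1 := by
      rw [abs_mul, abs_of_nonneg hY0]
      exact (mul_le_mul_of_nonneg_left hYle (abs_nonneg l)).trans hl
    have hexp := (abs_le.1 (Real.abs_exp_sub_one_sub_id_le hsmall)).2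
    have hsq : l ^ 2 * Y s * Y s ≤ l ^ 2 * Y s * B := by gcongr
    linarith
  calc mgf Y P l
      ≤ ∫ s, ((l + l ^ 2 * B) * Y s + 1) ∂P :=
        integral_mono (integrable_exp_mul_of_mem_Icc hY.aemeasurable (.of_forall hYB))
          ((hYint.const_mul _).add (integrable_const _)) hquadratic
    _ = (l + l ^ 2 * B) * ∫ s, Y s ∂P + 1 := by
        rw [integral_add (hYint.const_mul _) (integrable_const _), integral_const_mul]
        simp only [integral_const, probReal_univ, one_smul]
    _ ≤ Real.exp ((l + l ^ 2 * B) * ∫ s, Y s ∂P) := Real.add_one_le_exp _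

variable [Fintype ι] {X : ι → S → ℝ} {B ε v : ℝ}

theorem mgf_sum_le_exp_of_mem_Icc {l : ℝ} (hX : ∀ i, Measurable (X i)) (hind : iIndepFun X P)
    (hXB : ∀ i s, X i s ∈ Set.Icc 0 B) (hl : |l| * B ≤ 1) :
    mgf (∑ i, X i) P l ≤ Real.exp ((l + l ^ 2 * B) * ∑ i, ∫ s, X i s ∂P) := by
  rw [hind.mgf_sum hX, Finset.mul_sum, Real.exp_sum]
  exact Finset.prod_le_prod (fun i _ => mgf_nonneg)
    fun i _ => mgf_le_exp_of_mem_Icc (hX i) (hXB i) hl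

theorem measureReal_abs_sum_sub_integral_ge_le (hX : ∀ i, Measurable (X i))
    (hind : iIndepFun X P) (hB : 0 < B) (hXB : ∀ i s, X i s ∈ Set.Icc 0 B)
    (hv : ∑ i, ∫ s, X i s ∂P ≤ v) (hε : ε ∈ Set.Icc 0 1) :
    P.real {s | 2 * ε * v ≤ |∑ i, X i s - ∑ i, ∫ s, X i s ∂P|} ≤
      2 * Real.exp (-(ε ^ 2 * v / B)) := by
  set m := ∑ i, ∫ s, X i s ∂P with hm
  have hint (l : ℝ) : Integrable (fun s => Real.exp (l * (∑ i, X i) s)) P :=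
    hind.integrable_exp_mul_sum hX fun i _ =>
      integrable_exp_mul_of_mem_Icc (hX i).aemeasurable (.of_forall (hXB i))
  have hl0 : 0 ≤ ε / B := div_nonneg hε.1 hB.le
  have hmv : ε ^ 2 * m / B ≤ ε ^ 2 * v / B := by gcongr
  have hmgf {l : ℝ} (hl : |l| = ε / B) :
      mgf (∑ i, X i) P l ≤ Real.exp (l * m + ε ^ 2 * m / B) := by
    refine (mgf_sum_le_exp_of_mem_Icc hX hind hXB ?_).trans_eq ?_
    · rw [hl, div_mul_cancel₀ ε hB.ne']
      exact hε.2
    · rw [← sq_abs l, hl]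
      rw [← hm]
      congr 1
      field_simp
  have hupper : P.real {s | m + 2 * ε * v ≤ (∑ i, X i) s} ≤ Real.exp (-(ε ^ 2 * v / B)) := by
    refine (measure_ge_le_exp_mul_mgf _ hl0 (hint _)).trans ((mul_le_mul_of_nonneg_left
      (hmgf (abs_of_nonneg hl0)) (Real.exp_pos _).le).trans ?_)
    rw [← Real.exp_add, Real.exp_le_exp]
    linear_combination hmv
  have hlower : P.real {s | (∑ i, X i) s ≤ m - 2 * ε * v} ≤ Real.exp (-(ε ^ 2 * v / B)) := by
    refine (measure_le_le_exp_mul_mgf _ (neg_nonpos.2 hl0) (hint _)).trans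
      ((mul_le_mul_of_nonneg_left (hmgf (abs_neg (ε / B) ▸ abs_of_nonneg hl0))
        (Real.exp_pos _).le).trans ?_)
    rw [← Real.exp_add, Real.exp_le_exp]
    linear_combination hmv
  have hcover : {s | 2 * ε * v ≤ |∑ i, X i s - m|} ⊆
      {s | m + 2 * ε * v ≤ (∑ i, X i) s} ∪ {s | (∑ i, X i) s ≤ m - 2 * ε * v} := fun s hs => by
    rw [Set.mem_ofPred_eq, le_abs, ← Finset.sum_apply] at hs
    exact hs.imp (fun h => by rw [Set.mem_ofPred_eq]; linarith)
      fun h => by rw [Set.mem_ofPred_eq]; linarith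
  exact (measureReal_mono hcover).trans
    (((measureReal_union_le _ _).trans (add_le_add hupper hlower)).trans_eq (two_mul _).symm)

end Chernoff

section HighProbability

variable {Ω : Type*} [MeasurableSpace Ω] {ν : Measure Ω}

/-- The property `E n` of a sample of `n` independent points of law `ν` holds with probability
tending to `1`. -/
def WithHighProbability (ν : Measure Ω) (E : ∀ n, (Fin n → Ω) → Prop) : Prop :=
  Tendsto (fun n => Measure.pi (fun _ : Fin n => ν) {x | ¬E n x}) atTop (𝓝 0)

namespace WithHighProbability

variable {E E' : ∀ n, (Fin n → Ω) → Prop}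

theorem mono (hE : WithHighProbability ν E)
    (hEE' : ∀ᶠ n in atTop, ∀ᵐ x ∂Measure.pi (fun _ : Fin n => ν), E n x → E' n x) :
    WithHighProbability ν E' :=
  tendsto_of_tendsto_of_tendsto_of_le_of_le' tendsto_const_nhds hE (.of_forall fun _ => zero_le)
    (hEE'.mono fun _ hn => measure_mono_ae (hn.mono fun _ hx => mt hx))

theorem and (hE : WithHighProbability ν E) (hE' : WithHighProbability ν E') :
    WithHighProbability ν fun n x => E n x ∧ E' n x := by
  refine tendsto_of_tendsto_of_tendsto_of_le_of_le tendsto_const_nhds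
    (add_zero (0 : ℝ≥0∞) ▸ Tendsto.add hE hE') (fun _ => zero_le) fun n => ?_
  refine (measure_mono fun x hx => ?_).trans (measure_union_le _ _)
  exact not_and_or.1 hx

end WithHighProbability

theorem tendstoInMeasure_of_withHighProbability {S : Type*} [MeasurableSpace S]
    {P : Measure S} [IsProbabilityMeasure P] {X : ℕ → S → Ω} (hXm : ∀ i, Measurable (X i))
    (hXν : ∀ i, P.map (X i) = ν) (hXi : iIndepFun X P) {F : ∀ n, (Fin n → Ω) → ℝ} {ℓ : ℝ}
    (hF : ∀ θ > 0, WithHighProbability ν fun n x => |F n x - ℓ| < θ) :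
    TendstoInMeasure P (fun n s => F n fun i => X i s) atTop fun _ => ℓ := by
  refine tendstoInMeasure_iff_norm.2 fun θ hθ => ?_
  refine tendsto_of_tendsto_of_tendsto_of_le_of_le tendsto_const_nhds (hF θ hθ)
    (fun _ => zero_le) fun n => ?_
  have hjoint : P.map (fun s (i : Fin n) => X i s) = Measure.pi fun _ : Fin n => ν := by
    simpa only [hXν] using (iIndepFun_iff_map_fun_eq_pi_map fun i : Fin n =>
      (hXm i).aemeasurable).1 (hXi.precomp Fin.val_injective)
  rw [← hjoint]
  refine (measure_mono fun s hs => ?_).trans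
    (Measure.le_map_apply (measurable_pi_lambda _ fun i : Fin n => hXm i).aemeasurable _)
  exact not_lt.2 hs

end HighProbability

section LawOfLargeNumbers

variable {Ω : Type*} [MeasurableSpace Ω] {ν : Measure Ω} [IsProbabilityMeasure ν]

theorem measureReal_pi_abs_sum_sub_integral_ge_le {ι : Type*} [Fintype ι] {φ : Ω → ℝ}
    {B ε v : ℝ} (hφ : Measurable φ) (hB : 0 < B) (hφB : ∀ x, φ x ∈ Set.Icc 0 B)
    (hv : Fintype.card ι * ∫ x, φ x ∂ν ≤ v) (hε : ε ∈ Set.Icc 0 1) :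
    (Measure.pi fun _ : ι => ν).real
        {x | 2 * ε * v ≤ |∑ i, φ (x i) - Fintype.card ι * ∫ x, φ x ∂ν|} ≤
      2 * Real.exp (-(ε ^ 2 * v / B)) := by
  have hmean : ∑ i : ι, ∫ x, φ (x i) ∂Measure.pi (fun _ : ι => ν) =
      Fintype.card ι * ∫ x, φ x ∂ν := by
    simp only [integral_comp_eval (μ := fun _ : ι => ν) hφ.aestronglyMeasurable,
      Finset.sum_const, Finset.card_univ, nsmul_eq_mul]
  rw [← hmean] at hv ⊢
  exact measureReal_abs_sum_sub_integral_ge_le (fun i => hφ.comp (measurable_pi_apply i))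
    (iIndepFun_pi fun _ => hφ.aemeasurable) hB (fun i x => hφB (x i)) hv hε

namespace IsBoundedKernel

variable {g : Ω → Ω → ℝ} {B C ε : ℝ}

theorem integral_mem_Icc (hg : IsBoundedKernel ν g B C) (x : Ω) :
    ∫ y, g x y ∂ν ∈ Set.Icc 0 B := by
  refine ⟨integral_nonneg (hg.nonneg x), ?_⟩
  simpa using integral_mono (hg.integrable x) (integrable_const B) (hg.le x)

/-- The diagonal term `g (x i) (x i)` is not independent of the point `x i`, so it is split off; the
remaining terms are independent conditionally on `x i`. -/
theorem mul_le_abs_sum_succAbove_sub (hg : IsBoundedKernel ν g B C) {m : ℕ} (i : Fin (m + 1))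
    (hBn : B ≤ ε * C * (m + 1)) {x : Fin (m + 1) → Ω}
    (hx : 3 * ε * C ≤ |1 / (m + 1) * ∑ j, g (x i) (x j) - ∫ y, g (x i) y ∂ν|) :
    2 * ε * (C * (m + 1)) ≤ |∑ k, g (x i) (x (i.succAbove k)) - m * ∫ y, g (x i) y ∂ν| := by
  have hm : (0 : ℝ) < m + 1 := by positivity
  obtain ⟨hI0, hIB⟩ := hg.integral_mem_Icc (x i)
  have hdiag : |g (x i) (x i) - ∫ y, g (x i) y ∂ν| ≤ B :=
    abs_sub_le_of_nonneg_of_le (hg.nonneg _ _) (hg.le _ _) hI0 hIB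
  rw [Fin.sum_univ_succAbove _ i] at hx
  set I := ∫ y, g (x i) y ∂ν
  set s := ∑ k, g (x i) (x (i.succAbove k))
  have hscale : 3 * ε * C * (m + 1) ≤ |(g (x i) (x i) - I) + (s - m * I)| := by
    calc 3 * ε * C * (m + 1)
        ≤ |1 / (m + 1) * (g (x i) (x i) + s) - I| * |(m : ℝ) + 1| := by
          rw [abs_of_pos hm]
          gcongr
      _ = |(g (x i) (x i) - I) + (s - m * I)| := by
          rw [← abs_mul]
          congr 1
          field_simp
          ring
  linarith [abs_add_le (g (x i) (x i) - I) (s - m * I)]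

theorem measure_pi_abs_average_sub_integral_ge_le (hg : IsBoundedKernel ν g B C) (hB : 0 < B)
    (hε : ε ∈ Set.Icc 0 1) {m : ℕ} (i : Fin (m + 1)) (hBn : B ≤ ε * C * (m + 1)) :
    Measure.pi (fun _ : Fin (m + 1) => ν)
        {x | 3 * ε * C ≤ |1 / (m + 1) * ∑ j, g (x i) (x j) - ∫ y, g (x i) y ∂ν|} ≤
      ENNReal.ofReal (2 * Real.exp (-(ε ^ 2 * (C * (m + 1)) / B))) := by
  set E : Set (Ω × (Fin m → Ω)) :=
    {z | 2 * ε * (C * (m + 1)) ≤ |∑ k, g z.1 (z.2 k) - m * ∫ y, g z.1 y ∂ν|}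
  have hE : MeasurableSet E := by
    refine measurableSet_le measurable_const (((Finset.measurable_sum _ fun k _ => ?_).sub
      ((hg.measurable_integral.comp measurable_fst).const_mul _)).abs)
    exact hg.measurable.comp
      (measurable_fst.prodMk ((measurable_pi_apply k).comp measurable_snd))
  have hrow (x : Ω) : Measure.pi (fun _ : Fin m => ν) (Prod.mk x ⁻¹' E) ≤
      ENNReal.ofReal (2 * Real.exp (-(ε ^ 2 * (C * (m + 1)) / B))) := by
    rw [← ofReal_measureReal]
    refine ENNReal.ofReal_le_ofReal ?_
    have hv : (Fintype.card (Fin m) : ℝ) * ∫ y, g x y ∂ν ≤ C * (m + 1) := by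
      rw [Fintype.card_fin]
      nlinarith [hg.mass_nonneg x, hg.integral_le x]
    have hchernoff := measureReal_pi_abs_sum_sub_integral_ge_le (hg.measurable_right x) hB
      (fun y => ⟨hg.nonneg x y, hg.le x y⟩) hv hε
    rwa [Fintype.card_fin] at hchernoff
  calc Measure.pi (fun _ : Fin (m + 1) => ν)
        {x | 3 * ε * C ≤ |1 / (m + 1) * ∑ j, g (x i) (x j) - ∫ y, g (x i) y ∂ν|}
      ≤ Measure.pi (fun _ : Fin (m + 1) => ν)
          (MeasurableEquiv.piFinSuccAbove (fun _ => Ω) i ⁻¹' E) :=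
        measure_mono fun x hx => hg.mul_le_abs_sum_succAbove_sub i hBn hx
    _ = ∫⁻ x, Measure.pi (fun _ : Fin m => ν) (Prod.mk x ⁻¹' E) ∂ν := by
        rw [(measurePreserving_piFinSuccAbove (fun _ => ν) i).measure_preimage
          hE.nullMeasurableSet, Measure.prod_apply hE]
    _ ≤ ∫⁻ _, ENNReal.ofReal (2 * Real.exp (-(ε ^ 2 * (C * (m + 1)) / B))) ∂ν :=
        lintegral_mono hrow
    _ = ENNReal.ofReal (2 * Real.exp (-(ε ^ 2 * (C * (m + 1)) / B))) := by
        rw [lintegral_const, measure_univ, mul_one]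

theorem measure_pi_exists_abs_average_sub_integral_ge_le (hg : IsBoundedKernel ν g B C)
    (hB : 0 < B) (hε : ε ∈ Set.Icc 0 1) {n : ℕ} (hBn : B ≤ ε * C * n) :
    Measure.pi (fun _ : Fin n => ν)
        {x | ∃ i, 3 * ε * C ≤ |1 / n * ∑ j, g (x i) (x j) - ∫ y, g (x i) y ∂ν|} ≤
      ENNReal.ofReal (n * (2 * Real.exp (-(ε ^ 2 * (C * n) / B)))) := by
  obtain _ | m := n
  · simp only [IsEmpty.exists_iff, Set.ofPred_false, measure_empty, zero_le]
  · rw [Set.ofPred_exists, ENNReal.ofReal_mul (Nat.cast_nonneg _), ENNReal.ofReal_natCast]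
    push_cast at hBn ⊢
    refine (measure_iUnion_fintype_le _ _).trans ((Finset.sum_le_sum fun i _ =>
      hg.measure_pi_abs_average_sub_integral_ge_le hB hε i hBn).trans_eq ?_)
    rw [Finset.sum_const, Finset.card_univ, Fintype.card_fin, nsmul_eq_mul, Nat.cast_succ]

theorem integral_kernel (hg : IsBoundedKernel ν g B C) :
    IsBoundedKernel ν (fun _ y => ∫ z, g y z ∂ν) B C where
  measurable := hg.measurable_integral.comp measurable_snd
  nonneg _ y := (hg.integral_mem_Icc y).1
  le _ y := (hg.integral_mem_Icc y).2
  integral_le _ := by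
    simpa using integral_mono_of_nonneg (μ := ν)
      (.of_forall fun y => (hg.integral_mem_Icc y).1) (integrable_const C)
      (.of_forall hg.integral_le)

end IsBoundedKernel

theorem natCast_mul_two_mul_exp_le {n : ℕ} (hn : 0 < n) {b c : ℝ} (hb : 0 < b)
    (hbn : b * Real.log n ≤ c / 2 * n) :
    n * (2 * Real.exp (-(c * n / b))) ≤ 2 / n := by
  have hn' : (0 : ℝ) < n := Nat.cast_pos.2 hn
  have hexponent : -(c * n / b) ≤ -Real.log n + -Real.log n := by
    rw [← neg_add, neg_le_neg_iff, le_div_iff₀ hb]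
    linarith
  calc n * (2 * Real.exp (-(c * n / b)))
      ≤ n * (2 * Real.exp (-Real.log n + -Real.log n)) := by gcongr
    _ = 2 / n := by
        rw [Real.exp_add, Real.exp_neg, Real.exp_log hn']
        field_simp

theorem eventually_abs_add_one_le {B : ℕ → ℝ}
    (hB : (fun n => B n * Real.log n) =o[atTop] fun n : ℕ => (n : ℝ)) {δ : ℝ} (hδ : 0 < δ) :
    ∀ᶠ n : ℕ in atTop, (|B n| + 1) * Real.log n ≤ δ * n ∧ |B n| + 1 ≤ δ * n := by
  have hsum : (fun n => (|B n| + 1) * Real.log n) =o[atTop] fun n : ℕ => (n : ℝ) := by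
    have hlog : (fun n : ℕ => Real.log n) =o[atTop] fun n : ℕ => (n : ℝ) :=
      Real.isLittleO_log_id_atTop.comp_tendsto tendsto_natCast_atTop_atTop
    refine (hB.abs_left.add hlog).congr' ?_ .rfl
    filter_upwards with n
    rw [abs_mul, abs_of_nonneg (Real.log_natCast_nonneg n)]
    ring
  filter_upwards [hsum.bound hδ, (Real.tendsto_log_atTop.comp
    tendsto_natCast_atTop_atTop).eventually_ge_atTop 1] with n hn hlog
  have hle : (|B n| + 1) * Real.log n ≤ δ * n := by
    simpa only [Real.norm_eq_abs, Nat.abs_cast] using (le_abs_self _).trans hn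
  exact ⟨hle, (le_mul_of_one_le_right (by positivity) hlog).trans hle⟩

section Kernels

variable {g : ℕ → Ω → Ω → ℝ} {B : ℕ → ℝ} {C θ : ℝ}

theorem withHighProbability_abs_average_sub_integral_lt
    (hg : ∀ᶠ n in atTop, IsBoundedKernel ν (g n) (B n) C)
    (hB : (fun n => B n * Real.log n) =o[atTop] fun n : ℕ => (n : ℝ)) (hθ : 0 < θ) :
    WithHighProbability ν fun n x =>
      ∀ i, |1 / n * ∑ j, g n (x i) (x j) - ∫ y, g n (x i) y ∂ν| < θ := by
  set C' := max C 1
  have hC' : 0 < C' := zero_lt_one.trans_le (le_max_right _ _)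
  set ε := min 1 (θ / (3 * C'))
  have hε0 : 0 < ε := by positivity
  have hε1 : ε ≤ 1 := min_le_left _ _
  have hεθ : 3 * ε * C' ≤ θ := by
    have h := min_le_right 1 (θ / (3 * C'))
    rw [le_div_iff₀ (by positivity)] at h
    linarith
  have hbound : Tendsto (fun n : ℕ => ENNReal.ofReal (2 / n)) atTop (𝓝 0) := by
    simpa using ENNReal.tendsto_ofReal (tendsto_const_div_atTop_nhds_zero_nat 2)
  refine tendsto_of_tendsto_of_tendsto_of_le_of_le' tendsto_const_nhds hbound
    (.of_forall fun _ => zero_le) ?_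
  filter_upwards [hg, eventually_gt_atTop 0,
    eventually_abs_add_one_le hB (δ := ε ^ 2 * C' / 2) (by positivity)] with n hgn hn0 hBn
  have hb : 0 < |B n| + 1 := by positivity
  have hbn : |B n| + 1 ≤ ε * C' * n := by
    refine hBn.2.trans ?_
    gcongr
    nlinarith [mul_pos hε0 hC']
  have htail := natCast_mul_two_mul_exp_le hn0 hb hBn.1
  rw [mul_assoc (ε ^ 2)] at htail
  refine (measure_mono fun x hx => ?_).trans
    (((hgn.mono ((le_abs_self _).trans (lt_add_one _).le) (le_max_left C 1)
      ).measure_pi_exists_abs_average_sub_integral_ge_le hb ⟨hε0.le, hε1⟩ hbn).trans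
      (ENNReal.ofReal_le_ofReal htail))
  obtain ⟨i, hi⟩ := not_forall.1 hx
  exact ⟨i, hεθ.trans (not_lt.1 hi)⟩

theorem withHighProbability_abs_average_average_sub_integral_lt
    (hg : ∀ᶠ n in atTop, IsBoundedKernel ν (g n) (B n) C)
    (hB : (fun n => B n * Real.log n) =o[atTop] fun n : ℕ => (n : ℝ)) (hθ : 0 < θ) :
    WithHighProbability ν fun n x =>
      |1 / n ^ 2 * ∑ i, ∑ j, g n (x i) (x j) - ∫ z, g n z.1 z.2 ∂ν.prod ν| < θ := by
  have hrows := withHighProbability_abs_average_sub_integral_lt hg hB (half_pos hθ)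
  have hmean := withHighProbability_abs_average_sub_integral_lt
    (hg.mono fun n hgn => hgn.integral_kernel) hB (half_pos hθ)
  refine (hrows.and hmean).mono ?_
  filter_upwards [hg, eventually_gt_atTop 0] with n hgn hn0
  refine .of_forall fun x ⟨hrow, hmean⟩ => ?_
  have hn : (0 : ℝ) < n := Nat.cast_pos.2 hn0
  have hint : Integrable (fun z : Ω × Ω => g n z.1 z.2) (ν.prod ν) := by
    simpa using hgn.integrable_mul_mul (integrable_const 1) (integrable_const 1)
  set J : Ω → ℝ := fun y => ∫ z, g n y z ∂ν
  have hJ : |1 / n * ∑ j, J (x j) - ∫ z, g n z.1 z.2 ∂ν.prod ν| < θ / 2 := by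
    rw [integral_prod _ hint]
    exact hmean ⟨0, hn0⟩
  have hrowsum : |∑ i, (1 / n * ∑ j, g n (x i) (x j) - J (x i))| ≤ n * (θ / 2) := by
    refine (Finset.abs_sum_le_sum_abs _ _).trans
      ((Finset.sum_le_sum fun i _ => (hrow i).le).trans_eq ?_)
    rw [Finset.sum_const, Finset.card_univ, Fintype.card_fin, nsmul_eq_mul]
  have hsplit : 1 / n ^ 2 * ∑ i, ∑ j, g n (x i) (x j) =
      1 / n * ∑ i, (1 / n * ∑ j, g n (x i) (x j) - J (x i)) + 1 / n * ∑ j, J (x j) := by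
    rw [Finset.sum_sub_distrib, ← Finset.mul_sum]
    ring
  have hrowavg : |1 / n * ∑ i, (1 / n * ∑ j, g n (x i) (x j) - J (x i))| ≤ θ / 2 := by
    rw [abs_mul, abs_of_pos (one_div_pos.2 hn), div_mul_eq_mul_div, one_mul, div_le_iff₀' hn]
    exact hrowsum
  rw [hsplit, add_sub_assoc]
  linarith [abs_add_le (1 / n * ∑ i, (1 / n * ∑ j, g n (x i) (x j) - J (x i)))
    (1 / n * ∑ j, J (x j) - ∫ z, g n z.1 z.2 ∂ν.prod ν)]

end Kernels

end LawOfLargeNumbers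

/-! ### The regularizer -/

theorem dotProduct_diagonal_sub_mulVec {ι : Type*} [Fintype ι] [DecidableEq ι]
    {W : Matrix ι ι ℝ} (hW : ∀ i j, W i j = W j i) (v : ι → ℝ) :
    v ⬝ᵥ ((Matrix.diagonal (fun i => ∑ j, W i j) - W) *ᵥ v) =
      1 / 2 * ∑ i, ∑ j, W i j * (v i - v j) ^ 2 := by
  have hrows : v ⬝ᵥ ((Matrix.diagonal (fun i => ∑ j, W i j) - W) *ᵥ v) =
      ∑ i, ∑ j, W i j * (v i * (v i - v j)) := by
    rw [Matrix.sub_mulVec]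
    simp only [dotProduct, Pi.sub_apply, Matrix.mulVec_diagonal]
    simp only [Matrix.mulVec, dotProduct, Finset.sum_mul, ← Finset.sum_sub_distrib, Finset.mul_sum]
    exact Finset.sum_congr rfl fun i _ => Finset.sum_congr rfl fun j _ => by ring
  have hcols : ∑ i, ∑ j, W i j * (v i * (v i - v j)) =
      ∑ i, ∑ j, W i j * (v j * (v j - v i)) := by
    rw [Finset.sum_comm]
    exact Finset.sum_congr rfl fun i _ => Finset.sum_congr rfl fun j _ => by rw [hW]
  have hsq : ∑ i, ∑ j, W i j * (v i - v j) ^ 2 =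
      ∑ i, ∑ j, W i j * (v i * (v i - v j)) + ∑ i, ∑ j, W i j * (v j * (v j - v i)) := by
    simp only [← Finset.sum_add_distrib]
    exact Finset.sum_congr rfl fun i _ => Finset.sum_congr rfl fun j _ => by ring
  rw [hrows, hsq, ← hcols]
  ring

theorem exists_abs_rpow_mul_rpow_sub_le {c η : ℝ} (hc : 0 < c) (hη : 0 < η) (r : ℝ) :
    ∃ δ > 0, ∀ a b q q' : ℝ, c ≤ q → c ≤ q' → |a - q| < δ → |b - q'| < δ →
      |a ^ r * b ^ r - q ^ r * q' ^ r| ≤ η * (q ^ r * q' ^ r) := by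
  have hcont : ContinuousAt (fun z : ℝ × ℝ => z.1 ^ r * z.2 ^ r) (1, 1) :=
    (continuousAt_fst.rpow_const (Or.inl one_ne_zero)).mul
      (continuousAt_snd.rpow_const (Or.inl one_ne_zero))
  have hnear : ∀ᶠ z : ℝ × ℝ in 𝓝 (1, 1), 0 < z.1 ∧ 0 < z.2 ∧ |z.1 ^ r * z.2 ^ r - 1| < η := by
    filter_upwards [continuousAt_fst.eventually (lt_mem_nhds zero_lt_one),
      continuousAt_snd.eventually (lt_mem_nhds zero_lt_one),
      hcont.eventually (Metric.ball_mem_nhds _ hη)] with z h₁ h₂ h₃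
    simp only [Real.one_rpow, mul_one, Real.dist_eq] at h₃
    exact ⟨h₁, h₂, h₃⟩
  obtain ⟨δ, hδ, hball⟩ := Metric.eventually_nhds_iff.1 hnear
  refine ⟨c * δ, mul_pos hc hδ, fun a b q q' hq hq' ha hb => ?_⟩
  have hq0 : 0 < q := hc.trans_le hq
  have hq'0 : 0 < q' := hc.trans_le hq'
  have hratio {a q : ℝ} (hq : c ≤ q) (ha : |a - q| < c * δ) : dist (a / q) 1 < δ := by
    have hq0 : 0 < q := hc.trans_le hq
    rw [Real.dist_eq, div_sub_one hq0.ne', abs_div, abs_of_pos hq0, div_lt_iff₀' hq0]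
    exact ha.trans_le (by gcongr)
  obtain ⟨hu, hv, huv⟩ := hball (y := (a / q, b / q')) (max_lt (hratio hq ha) (hratio hq' hb))
  have hscale : a ^ r * b ^ r - q ^ r * q' ^ r =
      ((a / q) ^ r * (b / q') ^ r - 1) * (q ^ r * q' ^ r) := by
    conv_lhs => rw [← div_mul_cancel₀ a hq0.ne', ← div_mul_cancel₀ b hq'0.ne',
      Real.mul_rpow hu.le hq0.le, Real.mul_rpow hv.le hq'0.le]
    ring
  have hpos : 0 < q ^ r * q' ^ r := by positivity
  rw [hscale, abs_mul, abs_of_pos hpos]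
  exact mul_le_mul_of_nonneg_right huv.le hpos.le

section Regularizer

variable {N d : ℕ} {M : Set (EuclideanSpace ℝ (Fin N))} {f p : EuclideanSpace ℝ (Fin N) → ℝ}
  {α : ℝ}

theorem normalizedWeightMatrix_apply {n : ℕ} (d : ℕ) (α t : ℝ)
    (x : Fin n → EuclideanSpace ℝ (Fin N)) (i j : Fin n) :
    normalizedWeightMatrix d α t x i j = gaussianWeight d t (x i) (x j) *
      (empiricalDegree d t x i ^ (-α) * empiricalDegree d t x j ^ (-α)) := by
  simp only [normalizedWeightMatrix, Matrix.mul_diagonal, Matrix.diagonal_mul, weightMatrix,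
    Matrix.of_apply]
  ring

theorem normalizedWeightMatrix_comm {n : ℕ} (d : ℕ) (α t : ℝ)
    (x : Fin n → EuclideanSpace ℝ (Fin N)) (i j : Fin n) :
    normalizedWeightMatrix d α t x i j = normalizedWeightMatrix d α t x j i := by
  rw [normalizedWeightMatrix_apply, normalizedWeightMatrix_apply, gaussianWeight_comm, mul_comm
    (empiricalDegree d t x i ^ (-α))]

theorem regularizer_eq_sum_energyKernel {n : ℕ} (d : ℕ) (α : ℝ) {t : ℝ} (ht : t ≠ 0)
    (f : EuclideanSpace ℝ (Fin N) → ℝ) (x : Fin n → EuclideanSpace ℝ (Fin N)) :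
    1 / ((n : ℝ) ^ 2 * t) * regularizer d α t f x =
      1 / (n : ℝ) ^ 2 * ∑ i, ∑ j, energyKernel d t f (x i) (x j) *
        (empiricalDegree d t x i ^ (-α) * empiricalDegree d t x j ^ (-α)) := by
  have hterm (i j : Fin n) : normalizedWeightMatrix d α t x i j * (f (x i) - f (x j)) ^ 2 =
      2 * t * (energyKernel d t f (x i) (x j) *
        (empiricalDegree d t x i ^ (-α) * empiricalDegree d t x j ^ (-α))) := by
    rw [normalizedWeightMatrix_apply, energyKernel]
    field_simp
  rw [regularizer, unnormalizedLaplacian,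
    dotProduct_diagonal_sub_mulVec (normalizedWeightMatrix_comm d α t x)]
  simp only [hterm, ← Finset.mul_sum]
  field_simp

theorem isLittleO_one_div_rpow_mul_log {t : ℕ → ℝ} (ht : ∀ᶠ n in atTop, 0 < t n)
    (hlog : (fun n : ℕ => Real.log n) =o[atTop] fun n => n * t n ^ ((d : ℝ) / 2)) :
    (fun n => 1 / t n ^ ((d : ℝ) / 2) * Real.log n) =o[atTop] fun n : ℕ => (n : ℝ) := by
  refine ((Asymptotics.isBigO_refl (fun n => 1 / t n ^ ((d : ℝ) / 2)) atTop).mul_isLittleO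
    hlog).congr' .rfl ?_
  filter_upwards [ht] with n hn
  field_simp

theorem abs_sum_mul_sub_sum_mul_le {ι κ : Type*} [Fintype ι] [Fintype κ] {h a b : ι → κ → ℝ}
    {η : ℝ} (hh : ∀ i j, 0 ≤ h i j) (hab : ∀ i j, |a i j - b i j| ≤ η * b i j) :
    |∑ i, ∑ j, h i j * a i j - ∑ i, ∑ j, h i j * b i j| ≤ η * ∑ i, ∑ j, h i j * b i j := by
  simp only [← Finset.sum_sub_distrib, Finset.mul_sum]
  refine (Finset.abs_sum_le_sum_abs _ _).trans (Finset.sum_le_sum fun i _ =>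
    (Finset.abs_sum_le_sum_abs _ _).trans (Finset.sum_le_sum fun j _ => ?_))
  rw [← mul_sub, abs_mul, abs_of_nonneg (hh i j), mul_left_comm]
  exact mul_le_mul_of_nonneg_left (hab i j) (hh i j)

theorem abs_sub_lt_of_relative_error_le {T V ℓ θ : ℝ} (hθ : 0 < θ)
    (hTV : |T - V| ≤ θ / 2 / (|ℓ| + θ / 2) * V) (hV : |V - ℓ| < θ / 2) : |T - ℓ| < θ := by
  have hden : 0 < |ℓ| + θ / 2 := by positivity
  have hVle : V ≤ |ℓ| + θ / 2 := by linarith [le_abs_self (V - ℓ), le_abs_self ℓ]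
  have hrel : θ / 2 / (|ℓ| + θ / 2) * V ≤ θ / 2 := by
    rw [div_mul_eq_mul_div, div_le_iff₀ hden]
    gcongr
  linarith [abs_sub_le T V ℓ]

namespace IsSubmanifoldWithBoundary

variable [IsProbabilityMeasure (densityMeasure d M p)] {t : ℕ → ℝ} {K : ℝ≥0} {θ : ℝ}

theorem withHighProbability_abs_empiricalDegree_sub_lt (hM : IsSubmanifoldWithBoundary d M)
    (hMc : IsCompact M) (hp : ContinuousOn p M) (hp0 : ∀ x ∈ M, 0 ≤ p x)
    (ht : ∀ᶠ n in atTop, 0 < t n)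
    (hlog : (fun n : ℕ => Real.log n) =o[atTop] fun n => n * t n ^ ((d : ℝ) / 2)) (hθ : 0 < θ) :
    WithHighProbability (densityMeasure d M p) fun n x =>
      ∀ i, |empiricalDegree d (t n) x i - meanDegree d (densityMeasure d M p) (t n) (x i)| < θ := by
  obtain ⟨C, hC⟩ := hM.exists_isBoundedKernel_gaussianWeight hMc hp hp0
  simpa only [empiricalDegree, weightMatrix, Matrix.of_apply, meanDegree] using
    withHighProbability_abs_average_sub_integral_lt (ht.mono fun n => hC (t n))
      (isLittleO_one_div_rpow_mul_log ht hlog) hθ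

theorem withHighProbability_abs_average_energyKernel_sub_lt (hM : IsSubmanifoldWithBoundary d M)
    (hMc : IsCompact M) (hp : ContinuousOn p M) (hp0 : ∀ x ∈ M, 0 < p x)
    (hf : LipschitzWith K f) (α : ℝ)
    (ht : Tendsto t atTop (𝓝[>] 0))
    (hlog : (fun n : ℕ => Real.log n) =o[atTop] fun n => n * t n ^ ((d : ℝ) / 2)) (hθ : 0 < θ) :
    WithHighProbability (densityMeasure d M p) fun n x =>
      |1 / n ^ 2 * ∑ i, ∑ j, energyKernel d (t n) f (x i) (x j) *
          (degreeFactor d M p α (t n) (x i) * degreeFactor d M p α (t n) (x j)) -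
        1 / 4 * Real.pi ^ ((d : ℝ) * (1 / 2 - α)) *
          ∫ x, ‖gradientOn M f x‖ ^ 2 * p x ^ (2 - 2 * α) ∂riemannianVolume d M| < θ := by
  obtain ⟨C, hC⟩ := hM.exists_isBoundedKernel_energyKernel hMc hp (fun x hx => (hp0 x hx).le) hf
  obtain ⟨D, hD⟩ := hM.exists_abs_degreeFactor_le hMc hp hp0 α
  have htIoc : ∀ᶠ n in atTop, t n ∈ Set.Ioc 0 1 := ht.eventually (Ioc_mem_nhdsGT zero_lt_one)
  have hsample := withHighProbability_abs_average_average_sub_integral_lt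
    (htIoc.mono fun n hn => (hC (t n) hn.1).mul_mul (measurable_degreeFactor hMc.measurableSet)
      (degreeFactor_nonneg hn.1) fun x => (le_abs_self _).trans (hD (t n) hn x))
    (((isLittleO_one_div_rpow_mul_log (htIoc.mono fun n hn => hn.1) hlog).const_mul_left
      ((K : ℝ) ^ 2 * D ^ 2)).congr_left fun n => by ring) (half_pos hθ)
  have hmean := Metric.tendsto_nhds.1 ((hM.tendsto_integral_energyKernel_mul_degreeFactor hMc hp
    hp0 hf α).comp ht) (θ / 2) (half_pos hθ)
  refine hsample.mono (hmean.mono fun n hn => .of_forall fun x hx => ?_)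
  exact (abs_sub_le _ _ _).trans_lt ((add_lt_add hx hn).trans_eq (add_halves θ))

theorem withHighProbability_abs_regularizer_sub_lt (hM : IsSubmanifoldWithBoundary d M)
    (hMc : IsCompact M) (hp : ContinuousOn p M) (hp0 : ∀ x ∈ M, 0 < p x)
    (hf : LipschitzWith K f) (α : ℝ)
    (ht : Tendsto t atTop (𝓝[>] 0))
    (hlog : (fun n : ℕ => Real.log n) =o[atTop] fun n => n * t n ^ ((d : ℝ) / 2)) (hθ : 0 < θ) :
    WithHighProbability (densityMeasure d M p) fun n x =>
      |1 / ((n : ℝ) ^ 2 * t n) * regularizer d α (t n) f x -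
        1 / 4 * Real.pi ^ ((d : ℝ) * (1 / 2 - α)) *
          ∫ x, ‖gradientOn M f x‖ ^ 2 * p x ^ (2 - 2 * α) ∂riemannianVolume d M| < θ := by
  set ℓ := 1 / 4 * Real.pi ^ ((d : ℝ) * (1 / 2 - α)) *
    ∫ x, ‖gradientOn M f x‖ ^ 2 * p x ^ (2 - 2 * α) ∂riemannianVolume d M
  obtain ⟨c, hc0, hc⟩ := hM.exists_le_meanDegree hMc hp hp0
  obtain ⟨δ, hδ, hratio⟩ :=
    exists_abs_rpow_mul_rpow_sub_le hc0 (η := θ / 2 / (|ℓ| + θ / 2)) (by positivity) (-α)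
  have htIoc : ∀ᶠ n in atTop, t n ∈ Set.Ioc 0 1 := ht.eventually (Ioc_mem_nhdsGT zero_lt_one)
  have hdegree := hM.withHighProbability_abs_empiricalDegree_sub_lt hMc hp
    (fun x hx => (hp0 x hx).le) (htIoc.mono fun n hn => hn.1) hlog hδ
  have henergy := hM.withHighProbability_abs_average_energyKernel_sub_lt hMc hp hp0 hf α ht hlog
    (half_pos hθ)
  refine (hdegree.and henergy).mono (htIoc.mono fun n hn => ?_)
  have hsample : ∀ᵐ x ∂Measure.pi (fun _ : Fin n => densityMeasure d M p), ∀ i, x i ∈ M :=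
    ae_all_iff.2 fun i => (Measure.quasiMeasurePreserving_eval _ i).ae
      (ae_mem_densityMeasure hMc.measurableSet)
  filter_upwards [hsample] with x hxM ⟨hdeg, hen⟩
  have hrel := abs_sum_mul_sub_sum_mul_le
    (fun i j => energyKernel_nonneg (d := d) hn.1 f (x i) (x j)) fun i j =>
      hratio _ _ _ _ (hc (t n) hn _ (hxM i)) (hc (t n) hn _ (hxM j)) (hdeg i) (hdeg j)
  simp only [degreeFactor, Set.indicator_of_mem (hxM _)] at hen
  rw [regularizer_eq_sum_energyKernel d α hn.1.ne']
  refine abs_sub_lt_of_relative_error_le hθ ?_ hen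
  rw [← mul_sub, abs_mul, abs_of_nonneg (by positivity), mul_left_comm]
  exact mul_le_mul_of_nonneg_left hrel (by positivity)

end IsSubmanifoldWithBoundary

end Regularizer

section Main

variable {N d : ℕ} {M : Set (EuclideanSpace ℝ (Fin N))} {f g : EuclideanSpace ℝ (Fin N) → ℝ}

theorem regularizer_congr {n : ℕ} {α t : ℝ} {x : Fin n → EuclideanSpace ℝ (Fin N)}
    (hfg : ∀ i, f (x i) = g (x i)) : regularizer d α t f x = regularizer d α t g x := by
  simp only [regularizer, hfg]

theorem gradientOn_congr (hfg : Set.EqOn f g M) {x : EuclideanSpace ℝ (Fin N)} (hx : x ∈ M) :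
    gradientOn M f x = gradientOn M g x := by
  rw [gradientOn, fderivWithin_congr hfg (hfg hx), gradientOn]

theorem sq_natCast_mul_rpow_mul (d n : ℕ) {t : ℝ} (ht : 0 ≤ t) :
    ((n : ℝ) * t ^ ((d : ℝ) / 2) * t) ^ 2 = (n : ℝ) ^ 2 * t ^ (d + 2) := by
  rw [mul_pow, mul_pow, ← Real.rpow_mul_natCast ht, Nat.cast_ofNat, div_mul_cancel₀ _ two_ne_zero,
    Real.rpow_natCast, pow_add, mul_assoc]

theorem log_isLittleO_mul_rpow {t : ℕ → ℝ} (htpos : ∀ n, 0 < t n) (ht0 : Tendsto t atTop (𝓝 0))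
    (hnt : Tendsto (fun n : ℕ => (n : ℝ) ^ 2 * t n ^ (d + 2)) atTop atTop) :
    (fun n : ℕ => Real.log n) =o[atTop] fun n => n * t n ^ ((d : ℝ) / 2) := by
  set m : ℕ → ℝ := fun n => n * t n ^ ((d : ℝ) / 2)
  have hmt : ∀ᶠ n in atTop, (t n)⁻¹ ≤ m n := by
    filter_upwards [hnt.eventually_ge_atTop 1] with n hn
    have htn := htpos n
    rw [← sq_natCast_mul_rpow_mul d n htn.le, one_le_sq_iff₀ (by positivity)] at hn
    exact (inv_le_iff_one_le_mul₀ htn).2 hn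
  have hm : Tendsto m atTop atTop := tendsto_atTop_mono' _ hmt
    (tendsto_inv_nhdsGT_zero.comp (tendsto_nhdsWithin_iff.2 ⟨ht0, .of_forall htpos⟩))
  have hlog : (fun n : ℕ => Real.log n) =O[atTop] fun n => Real.log (m n) := by
    refine .of_bound (1 + (d : ℝ) / 2) ?_
    filter_upwards [hmt, hm.eventually_ge_atTop 1, eventually_gt_atTop 0] with n hmt hm1 hn
    have hlogt : -Real.log (t n) ≤ Real.log (m n) :=
      Real.log_inv (t n) ▸ Real.log_le_log (inv_pos.2 (htpos n)) hmt
    have hlogm : Real.log (m n) = Real.log n + (d : ℝ) / 2 * Real.log (t n) := by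
      rw [Real.log_mul (by positivity) (Real.rpow_pos_of_pos (htpos n) _).ne',
        Real.log_rpow (htpos n)]
    rw [Real.norm_of_nonneg (Real.log_natCast_nonneg n), Real.norm_of_nonneg (Real.log_nonneg hm1)]
    linarith [mul_le_mul_of_nonneg_left hlogt (by positivity : 0 ≤ (d : ℝ) / 2)]
  exact hlog.trans_isLittleO (Real.isLittleO_log_id_atTop.comp_tendsto hm)

end Main

end GraphLaplacian

open GraphLaplacian in
theorem mainTheorem2_general {N d : ℕ} {M : Set (EuclideanSpace ℝ (Fin N))}
    (hM : IsSubmanifoldWithBoundary d M) (hMc : IsCompact M)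
    {f : EuclideanSpace ℝ (Fin N) → ℝ} {K : NNReal} (hf : LipschitzOnWith K f M)
    {p : EuclideanSpace ℝ (Fin N) → ℝ} (hp : ContinuousOn p M) (hp0 : ∀ x ∈ M, 0 < p x)
    {S : Type*} [MeasurableSpace S] {P : Measure S} [IsProbabilityMeasure P]
    {X : ℕ → S → EuclideanSpace ℝ (Fin N)} (hXm : ∀ i, Measurable (X i))
    (hXp : ∀ i, P.map (X i) = densityMeasure d M p)
    (hXi : iIndepFun X P) (α : ℝ) {t : ℕ → ℝ} (ht : Tendsto t atTop (𝓝[>] 0))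
    (hlog : (fun n : ℕ => Real.log n) =o[atTop] fun n => n * t n ^ ((d : ℝ) / 2)) :
    Integrable (fun x => ‖gradientOn M f x‖ ^ 2 * p x ^ (2 - 2 * α)) (riemannianVolume d M) ∧
      TendstoInMeasure P
        (fun (n : ℕ) (s : S) => 1 / ((n : ℝ) ^ 2 * t n) *
          regularizer d α (t n) f (fun i : Fin n => X i s))
        atTop
        (fun _ => 1 / 4 * Real.pi ^ ((d : ℝ) * (1 / 2 - α)) *
          ∫ x, ‖gradientOn M f x‖ ^ 2 * p x ^ (2 - 2 * α) ∂riemannianVolume d M) := by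
  obtain ⟨F, hF, hfF⟩ := hf.extend_real
  have hgrad : (fun x => ‖gradientOn M F x‖ ^ 2 * p x ^ (2 - 2 * α)) =ᵐ[riemannianVolume d M]
      fun x => ‖gradientOn M f x‖ ^ 2 * p x ^ (2 - 2 * α) := by
    filter_upwards [ae_restrict_mem hMc.measurableSet] with x hx
    rw [gradientOn_congr hfF hx]
  have hsample : ∀ᵐ s ∂P, ∀ i, X i s ∈ M := ae_all_iff.2 fun i =>
    ae_of_ae_map (hXm i).aemeasurable (hXp i ▸ ae_mem_densityMeasure hMc.measurableSet)
  have : IsProbabilityMeasure (densityMeasure d M p) :=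
    hXp 0 ▸ Measure.isProbabilityMeasure_map (hXm 0).aemeasurable
  refine ⟨(hM.integrable_sq_norm_gradientOn_mul hMc hF
    (hp.rpow_const fun x hx => Or.inl (hp0 x hx).ne')).congr hgrad, ?_⟩
  rw [← integral_congr_ae hgrad]
  refine (tendstoInMeasure_of_withHighProbability hXm hXp hXi fun θ hθ =>
    hM.withHighProbability_abs_regularizer_sub_lt hMc hp hp0 hF α ht hlog hθ).congr_left
      fun n => ?_
  filter_upwards [hsample] with s hs
  rw [regularizer_congr fun i => (hfF (hs i)).symm]

theorem mainTheorem2 {N d : ℕ} (M : Set (EuclideanSpace ℝ (Fin N)))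
    (hM : GraphLaplacian.IsSubmanifoldWithBoundary d M) (hMc : IsCompact M)
    (f : EuclideanSpace ℝ (Fin N) → ℝ) (hf : ContDiffOn ℝ 1 f M)
    (p : EuclideanSpace ℝ (Fin N) → ℝ) (hp : ContDiffOn ℝ ∞ p M)
    (a b : ℝ) (ha : 0 < a) (hab : ∀ x ∈ M, a ≤ p x ∧ p x ≤ b)
    {S : Type*} [MeasurableSpace S] (P : Measure S) [IsProbabilityMeasure P]
    (X : ℕ → S → EuclideanSpace ℝ (Fin N)) (hXm : ∀ i, Measurable (X i))
    (hXp : ∀ i, P.map (X i) =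
      (GraphLaplacian.riemannianVolume d M).withDensity (fun x => ENNReal.ofReal (p x)))
    (hXi : iIndepFun X P)
    (α : ℝ) (t : ℕ → ℝ) (htpos : ∀ n, 0 < t n) (ht0 : Tendsto t atTop (𝓝 0))
    (hnt : Tendsto (fun n : ℕ => (n : ℝ) ^ 2 * t n ^ (d + 2)) atTop atTop) :
    Integrable (fun x => ‖GraphLaplacian.gradientOn M f x‖ ^ 2 * p x ^ (2 - 2 * α))
        (GraphLaplacian.riemannianVolume d M) ∧
      TendstoInMeasure P
        (fun (n : ℕ) (s : S) => 1 / ((n : ℝ) ^ 2 * t n) *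
          GraphLaplacian.regularizer d α (t n) f (fun i : Fin n => X i s))
        atTop
        (fun _ => 1 / 4 * Real.pi ^ ((d : ℝ) * (1 / 2 - α)) *
          ∫ x, ‖GraphLaplacian.gradientOn M f x‖ ^ 2 * p x ^ (2 - 2 * α)
            ∂(GraphLaplacian.riemannianVolume d M)) := by
  obtain ⟨K, hK⟩ := hM.exists_lipschitzOnWith hMc hf
  exact mainTheorem2_general hM hMc hK hp.continuousOn (fun x hx => ha.trans_le (hab x hx).1)
    hXm hXp hXi α (tendsto_nhdsWithin_iff.2 ⟨ht0, .of_forall htpos⟩)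
    (GraphLaplacian.log_isLittleO_mul_rpow htpos ht0 hnt)
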